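/- **Setting.** Let $d\ge 3$, $p,q\in[1,\infty]$, $1/p+1/p^*=1$ (with $1/\infty=0$), and let $\mathbb B_p^d=\{x\in\mathbb R^d:\|x\|_p<1\}$. Let $\mathcal X\subset\mathbb R^d$ be compact and convex with $r\mathbb B_p^d\subseteq\mathcal X\subseteq R\,\mathbb B_p^d$ for some $r,R>0$. Let $T\ge1$, $G>0$, and let $f_1,\dots,f_T:\mathbb R^d\to\mathbb R$ be (non-random) convex functions with $|f_t(x)-f_t(y)|\le G\|x-y\|_q$ for all $x,y\in\mathcal X$. Let $\psi:\operatorname{int}(\mathcal X)\to\mathbb R$ be differentiable, bounded above, and $\lambda$-strongly convex with respect to $\|\cdot\|_p$, $\lambda>0$; put $B_\psi(x;y)=\psi(x)-\psi(y)-\langle\nabla\psi(y),x-y\rangle$ and $F_\psi=\sup_{\operatorname{int}\mathcal X}\psi-\inf_{\operatorname{int}\mathcal X}\psi$. Let $u_1,\dots,u_{T+1}\in\mathcal X$ be comparators with path variation $\mathcal P_{T,p}=\sum_{t=1}^T\|u_{t+1}-u_t\|_p$, and set $$\xi_{p,q}(d)=d^{\,1+\frac{2}{\min\{q,2\}}-\frac2p},\qquad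 \upsilon_{p,q}(d)=d^{\,1+\frac1q-\frac1p-\frac1{\max\{q,p\}}},\qquad \zeta_q(d)=\begin{cases}q\,d^{1/q}/(d+1),&q<\log d,\\ e\log(d)/(d+1),&q\ge\log d.\end{cases}$$ **Algorithm (bandit mirror descent).** Given $\mu,\eta>0$ and $\alpha\in(0,1)$ with $\mu d^{1-1/p}=\alpha r$, start at a fixed $y_1\in(1-\alpha)\mathcal X$. For $t=1,\dots,T$ draw $s_t$, independently and uniformly on the unit $\ell_1$-sphere, play $x_t^\pm=y_t\pm\mu s_t$, form $g_t=\frac{d}{2\mu}\big(f_t(x_t^+)-f_t(x_t^-)\big)\operatorname{sign}(s_t)$ (componentwise sign, $\operatorname{sign}(0)=1$), and set $$y_{t+1}=\operatorname*{argmin}_{y\in(1-\alpha)\mathcal X}\ \langle g_t,y\rangle+\tfrac1\eta B_\psi(y;y_t).$$ Let $v_1=(1-\alpha)u_1$, let $G_\psi$ be a constant with $\max_{1\le t\le T}\|\nabla\psi(y_t)\|_{p^*}\le G_\psi$ almost surely, and put $D=F_\psi+B_\psi(v_1;y_1)+G_\psi\mathcal P_{T,p}$. **Theorem.** For all $c_1,c_2,c_3>0$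 there is a constant $C>0$, depending only on $c_1,c_2,c_3$, such that the following holds for all data as above. If the parameters (which may depend on the path variation $\mathcal P_{T,p}$) satisfy $$c_1\sqrt{\frac{D}{G^2\xi_{p,q}(d)T/\lambda}}\ \le\ \eta\ \le\ c_2\sqrt{\frac{D}{G^2\xi_{p,q}(d)T/\lambda}},\qquad 0<\mu\le c_3\,\frac{\sqrt{D\,\xi_{p,q}(d)}}{\sqrt{\lambda T}\,\big(1+\upsilon_{p,q}(d)+\zeta_q(d)\big)R/r},$$ then the dynamic regret is integrable and $$\mathbb E\left[\sum_{t=1}^T\frac{f_t(x_t^+)+f_t(x_t^-)}2-f_t(u_t)\right]\ \le\ C\,G\sqrt{\big(F_\psi+B_\psi(v_1;y_1)+G_\psi\mathcal P_{T,p}\big)\,\xi_{p,q}(d)\,T/\lambda},$$ the expectation being over $s_1,\dots,s_T$. -/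

import Mathlib

open MeasureTheory ProbabilityTheory
open scoped ENNReal Pointwise

noncomputable section

namespace BMD

/-- The space `ℝ^d`; its inner product is the standard one. -/
abbrev Vec (d : ℕ) := EuclideanSpace ℝ (Fin d)

variable {d : ℕ}

/-- The `ℓ_p`-norm on `ℝ^d`, for `p ∈ [1, ∞]`. -/
def ellNorm (p : ℝ≥0∞) (x : Vec d) : ℝ :=
  ‖(WithLp.toLp p (fun i => x i) : PiLp p (fun _ : Fin d => ℝ))‖

/-- The open unit `ℓ_p`-ball. -/
def ellBall (d : ℕ) (p : ℝ≥0∞) : Set (Vec d) := {x | ellNorm p x < 1}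

/-- The uniform distribution on the unit `ℓ_1`-sphere: the law of `x / ‖x‖₁` when `x` is uniformly
distributed (with respect to Lebesgue measure) on the unit `ℓ_1`-ball. All facets of the
`ℓ_1`-sphere are congruent and lie at the same distance from the origin, so this is the
normalised surface measure. -/
def unifL1Sphere (d : ℕ) : Measure (Vec d) :=
  (volume[|ellBall d 1]).map (fun x => (ellNorm 1 x)⁻¹ • x)

/-- Componentwise sign, with the value `1` at `0`. -/
def signVec (x : Vec d) : Vec d :=
  WithLp.toLp 2 (fun i => if 0 ≤ x i then (1 : ℝ) else -1)

/-- `ψ` is `lam`-strongly convex on `S` with respect to the `ℓ_p`-norm. -/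
def StrongConvexOnEll (p : ℝ≥0∞) (lam : ℝ) (S : Set (Vec d)) (ψ : Vec d → ℝ) : Prop :=
  Convex ℝ S ∧ ∀ x ∈ S, ∀ y ∈ S, ∀ a b : ℝ, 0 ≤ a → 0 ≤ b → a + b = 1 →
    ψ (a • x + b • y) ≤ a * ψ x + b * ψ y - a * b * (lam / 2 * ellNorm p (x - y) ^ 2)

/-- `G`-Lipschitz continuity on `S` with respect to the `ℓ_q`-norm. -/
def LipschitzOnEll (q : ℝ≥0∞) (G : ℝ) (S : Set (Vec d)) (f : Vec d → ℝ) : Prop :=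
  ∀ x ∈ S, ∀ y ∈ S, |f x - f y| ≤ G * ellNorm q (x - y)

/-- The Bregman divergence `B_ψ(x; y)`. -/
def bregman (ψ : Vec d → ℝ) (x y : Vec d) : ℝ :=
  ψ x - ψ y - inner ℝ (gradient ψ y) (x - y)

/-- The oscillation `F_ψ` of the divergence-generating function, which lives on `int X`. -/
def oscillation (X : Set (Vec d)) (ψ : Vec d → ℝ) : ℝ :=
  sSup (ψ '' interior X) - sInf (ψ '' interior X)

/-- The path variation `P_{T,p}` of `u_1, …, u_{T+1}` (stored as `u 0, …, u T`). -/
def pathVariation (p : ℝ≥0∞) (T : ℕ) (u : ℕ → Vec d) : ℝ :=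
  ∑ t ∈ Finset.range T, ellNorm p (u (t + 1) - u t)

/-- `ξ_{p,q}(d) = d ^ (1 + 2 / min{q,2} - 2 / p)`. -/
def xi (d : ℕ) (p q : ℝ≥0∞) : ℝ :=
  (d : ℝ) ^ (1 + 2 / (min q 2).toReal - 2 * (p⁻¹).toReal)

/-- `υ_{p,q}(d) = d ^ (1 + 1/q - 1/p - 1 / max{q,p})`. -/
def upsilon (d : ℕ) (p q : ℝ≥0∞) : ℝ :=
  (d : ℝ) ^ (1 + (q⁻¹).toReal - (p⁻¹).toReal - ((max q p)⁻¹).toReal)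

/-- `ζ_q(d)`, equal to `q d^{1/q} / (d+1)` if `q < log d` and to `e log d / (d+1)` otherwise. -/
def zeta (d : ℕ) (q : ℝ≥0∞) : ℝ :=
  if q < ENNReal.ofReal (Real.log d) then
    q.toReal * (d : ℝ) ^ (q⁻¹).toReal / (d + 1)
  else Real.exp 1 * Real.log d / (d + 1)

/-- The reference step size, `D` standing for `F_ψ + B_ψ(v_1; y_1) + G_ψ P_{T,p}`. -/
def stepScale (d : ℕ) (p q : ℝ≥0∞) (T : ℕ) (G lam D : ℝ) : ℝ :=
  Real.sqrt (D / (G ^ 2 * xi d p q * T / lam))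

/-- The reference smoothing parameter, `D` standing for `F_ψ + B_ψ(v_1; y_1) + G_ψ P_{T,p}`. -/
def smoothScale (d : ℕ) (p q : ℝ≥0∞) (T : ℕ) (r R lam D : ℝ) : ℝ :=
  Real.sqrt (D * xi d p q) /
    (Real.sqrt (lam * T) * (1 + upsilon d p q + zeta d q) * (R / r))

/-- The two-point gradient estimator at `y` with perturbation `s`. -/
def gradEst (f : Vec d → ℝ) (μ : ℝ) (y s : Vec d) : Vec d :=
  ((d : ℝ) / (2 * μ) * (f (y + μ • s) - f (y - μ • s))) • signVec s

/-- `y` is the sequence of iterates of bandit mirror descent over `T` rounds on the feasible set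
`X`, for losses `f`, started at `y₁` and driven by the perturbations `s`. Rounds are numbered from
`0`: `y t`, `s t`, `f t` belong to round `t + 1`. -/
structure IsBMDRun {Ω : Type*} (X : Set (Vec d)) (f : ℕ → Vec d → ℝ) (ψ : Vec d → ℝ)
    (μ α η : ℝ) (T : ℕ) (y₁ : Vec d) (s y : ℕ → Ω → Vec d) : Prop where
  init_mem : y₁ ∈ (1 - α) • X
  init : ∀ ω, y 0 ω = y₁
  step_mem : ∀ t < T, ∀ ω, y (t + 1) ω ∈ (1 - α) • X
  step_min : ∀ t < T, ∀ ω,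
    IsMinOn (fun z => inner ℝ (gradEst (f t) μ (y t ω) (s t ω)) z
      + 1 / η * bregman ψ z (y t ω)) ((1 - α) • X) (y (t + 1) ω)

/-- The dynamic regret against `u` when the points `y t ± μ s t` are played. -/
def dynRegret (f : ℕ → Vec d → ℝ) (μ : ℝ) (T : ℕ) (u : ℕ → Vec d) (y s : ℕ → Vec d) : ℝ :=
  ∑ t ∈ Finset.range T,
    ((f t (y t + μ • s t) + f t (y t - μ • s t)) / 2 - f t (u t))

end BMD

end

/-!
The regret of bandit mirror descent splits into an optimisation part, which is deterministic along
every trajectory, and two probabilistic facts about the gradient estimator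
`g(s) = d / (2 μ) (f (y + μ s) - f (y - μ s)) sign s`, with `s` uniform on the unit `ℓ_1`-sphere.

*Mean.* The estimator is unbiased for the gradient of `f` smoothed over the `ℓ_1`-ball of radius
`μ`, and the smoothed loss differs from `f` by at most `G μ`. No divergence theorem is needed for
this: `f` is smoothed with a Lipschitz kernel that approximates the indicator function of the ball,
the derivative falls on the kernel, and the volume integral is turned into an integral over the
sphere by polar coordinates. Only the subgradient inequality
`f y - f v - 2 G μ ≤ E ⟪g, y - v⟫` is used (`le_integral_inner_gradEst`).

*Second moment.* The squared dual norm of `sign s` is at most `d ^ (2 - 2 / p)`, so what is left is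
the variance of the odd function `s ↦ f (y + μ s) - f (y - μ s)`, which is Lipschitz for the
Euclidean norm with a constant of order `G μ d ^ max 0 (1 / q - 1 / 2)`. Such a function has
variance of order `M² / d²`, for `M` its Lipschitz constant (`integral_sq_odd_le`): if `x` has
independent Laplace coordinates, then `x / ‖x‖₁` is uniform on the sphere and independent of `‖x‖₁`, so the
claim follows from the Poincaré inequality for the product Laplace distribution
(`poincare_laplacePi`), applied to the positively homogeneous extension. The factor `d²` cancels the
one in `g`, and the mean squared dual norm of `g` is at most `384 G² ξ`.

*Optimisation.* Mirror descent against the shrunk comparators `(1 - α) u_t` has linearised regret at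
most `D / η + η / (2 λ) ∑ ‖g_t‖²` (`mirror_step`, `sum_bregman_sub_le`). Shrinking the comparators
costs `G μ υ R / r` per round. The iterate of a round depends on the earlier perturbations only, in
a measurable way because the mirror step is Lipschitz in its dual vector (`dist_mirror_step_le`);
hence it is independent of the perturbation of that round, which can be integrated out first.

Summing over the rounds gives `integral_dynRegret_le`, and the choice of `η` and `μ` makes each of
the three terms a multiple of `G √(D ξ T / λ)` (`tuning`).
-/

open MeasureTheory ProbabilityTheory
open scoped ENNReal Pointwise

noncomputable section

namespace BMD

variable {d : ℕ}

/-! ### The `ℓ_p`-norms -/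

/-- The identity of `ℝ^d` as a linear map onto `ℝ^d` normed by the `ℓ_p`-norm. -/
def toEll (p : ℝ≥0∞) : Vec d →ₗ[ℝ] PiLp p (fun _ : Fin d => ℝ) where
  toFun x := WithLp.toLp p (fun i => x i)
  map_add' _ _ := rfl
  map_smul' _ _ := rfl

lemma ellNorm_eq (p : ℝ≥0∞) (x : Vec d) : ellNorm p x = ‖toEll p x‖ := rfl

lemma continuous_toEll (p : ℝ≥0∞) : Continuous (toEll (d := d) p) :=
  (PiLp.continuous_toLp p _).comp (PiLp.continuous_ofLp 2 _)

lemma ellNorm_nonneg {p : ℝ≥0∞} (hp : 1 ≤ p) (x : Vec d) : 0 ≤ ellNorm p x := by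
  have := Fact.mk hp
  exact norm_nonneg _

lemma continuous_ellNorm {p : ℝ≥0∞} (hp : 1 ≤ p) : Continuous (ellNorm (d := d) p) := by
  have := Fact.mk hp
  exact (continuous_toEll p).norm

lemma ellNorm_add_le {p : ℝ≥0∞} (hp : 1 ≤ p) (x y : Vec d) :
    ellNorm p (x + y) ≤ ellNorm p x + ellNorm p y := by
  have := Fact.mk hp
  simp only [ellNorm_eq, map_add]
  exact norm_add_le _ _

lemma ellNorm_smul {p : ℝ≥0∞} (hp : 1 ≤ p) (c : ℝ) (x : Vec d) :
    ellNorm p (c • x) = |c| * ellNorm p x := by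
  have := Fact.mk hp
  simp only [ellNorm_eq, map_smul, norm_smul, Real.norm_eq_abs]

lemma ellNorm_neg {p : ℝ≥0∞} (hp : 1 ≤ p) (x : Vec d) : ellNorm p (-x) = ellNorm p x := by
  have := Fact.mk hp
  simp only [ellNorm_eq, map_neg, norm_neg]

lemma ellNorm_sub_comm {p : ℝ≥0∞} (hp : 1 ≤ p) (x y : Vec d) :
    ellNorm p (x - y) = ellNorm p (y - x) := by
  rw [← ellNorm_neg hp, neg_sub]

lemma ellNorm_zero {p : ℝ≥0∞} (hp : 1 ≤ p) : ellNorm p (0 : Vec d) = 0 := by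
  have := Fact.mk hp
  simp only [ellNorm_eq, map_zero, norm_zero]

lemma ellNorm_eq_zero {p : ℝ≥0∞} (hp : 1 ≤ p) {x : Vec d} : ellNorm p x = 0 ↔ x = 0 := by
  have := Fact.mk hp
  rw [ellNorm_eq, norm_eq_zero]
  refine ⟨fun h => ?_, fun h => by rw [h, map_zero]⟩
  ext i
  exact congrArg (fun z : PiLp p (fun _ : Fin d => ℝ) => z i) h

lemma ellNorm_one (x : Vec d) : ellNorm 1 x = ∑ i, |x i| := by
  rw [ellNorm, PiLp.norm_eq_of_L1]; rfl

lemma ellNorm_two (x : Vec d) : ellNorm 2 x = ‖x‖ := rfl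

lemma ellNorm_top (x : Vec d) : ellNorm ∞ x = ⨆ i, |x i| := rfl

lemma ellNorm_eq_sum {p : ℝ≥0∞} (hp : 1 ≤ p) (hp' : p ≠ ∞) (x : Vec d) :
    ellNorm p x = (∑ i, |x i| ^ p.toReal) ^ (1 / p.toReal) := by
  rw [ellNorm, PiLp.norm_eq_sum (ENNReal.toReal_pos (by positivity) hp')]
  rfl

lemma abs_apply_le_ellNorm {p : ℝ≥0∞} (hp : 1 ≤ p) (x : Vec d) (i : Fin d) :
    |x i| ≤ ellNorm p x := by
  have := Fact.mk hp
  exact PiLp.norm_apply_le (toEll p x) i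

lemma ellNorm_eq_eLpNorm {p : ℝ≥0∞} (hp : 1 ≤ p) (x : Vec d) :
    ENNReal.ofReal (ellNorm p x) = eLpNorm (fun i => x i) p Measure.count := by
  rcases eq_or_ne p ∞ with rfl | hp'
  · rw [eLpNorm_exponent_top, eLpNormEssSup_count, ellNorm_top]
    rcases isEmpty_or_nonempty (Fin d) with h | h
    · simp
    · refine le_antisymm ?_ (iSup_le fun i => ?_)
      · obtain ⟨i, hi⟩ := exists_eq_ciSup_of_finite (f := fun i => |x i|)
        rw [← hi, ← Real.norm_eq_abs, ofReal_norm]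
        exact le_iSup (fun i => ‖x i‖ₑ) i
      · rw [← ofReal_norm, Real.norm_eq_abs]
        exact ENNReal.ofReal_le_ofReal
          (le_ciSup (f := fun i => |x i|) (Set.finite_range _).bddAbove i)
  · rw [eLpNorm_eq_lintegral_rpow_enorm_toReal (by positivity) hp', lintegral_count, tsum_fintype,
      ellNorm_eq_sum hp hp', ← ENNReal.ofReal_rpow_of_nonneg (by positivity) (by positivity),
      ENNReal.ofReal_sum_of_nonneg (fun _ _ => by positivity)]
    congr 1
    refine Finset.sum_congr rfl fun i _ => ?_
    rw [← ENNReal.ofReal_rpow_of_nonneg (by positivity) (by positivity), ← Real.norm_eq_abs,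
      ofReal_norm]

/-- The `ℓ_q`-norm is at most the `ℓ_p`-norm if `p ≤ q`. -/
lemma ellNorm_anti {p q : ℝ≥0∞} (hp : 1 ≤ p) (hpq : p ≤ q) (x : Vec d) :
    ellNorm q x ≤ ellNorm p x := by
  have hq := hp.trans hpq
  have h0 := ellNorm_nonneg hp x
  rcases eq_or_ne q ∞ with rfl | hq'
  · rw [ellNorm_top]
    exact Real.iSup_le (abs_apply_le_ellNorm hp x) h0
  have hp' : p ≠ ∞ := ne_top_of_le_ne_top hq' hpq
  have hp0 : 0 < p.toReal := ENNReal.toReal_pos (by positivity) hp'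
  have hq0 : 0 < q.toReal := ENNReal.toReal_pos (by positivity) hq'
  have hpq' : p.toReal ≤ q.toReal := ENNReal.toReal_mono hq' hpq
  set M := ellNorm p x with hM
  have hMp : ∑ i, |x i| ^ p.toReal = M ^ p.toReal := by
    rw [hM, ellNorm_eq_sum hp hp', ← Real.rpow_mul (by positivity), one_div,
      inv_mul_cancel₀ hp0.ne', Real.rpow_one]
  rw [ellNorm_eq_sum hq hq', one_div, Real.rpow_inv_le_iff_of_pos (by positivity) h0 hq0]
  rcases h0.eq_or_lt with h0 | h0
  · have : x = 0 := (ellNorm_eq_zero hp).1 h0.symm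
    subst this
    simp [Real.zero_rpow hq0.ne', ← h0]
  calc ∑ i, |x i| ^ q.toReal
      = ∑ i, |x i| ^ p.toReal * |x i| ^ (q.toReal - p.toReal) := by
        refine Finset.sum_congr rfl fun i _ => ?_
        rcases (abs_nonneg (x i)).eq_or_lt with h | h
        · rw [← h, Real.zero_rpow hq0.ne', Real.zero_rpow hp0.ne', zero_mul]
        · rw [← Real.rpow_add h, add_sub_cancel]
    _ ≤ ∑ i, |x i| ^ p.toReal * M ^ (q.toReal - p.toReal) := by
        refine Finset.sum_le_sum fun i _ => mul_le_mul_of_nonneg_left ?_ (by positivity)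
        exact Real.rpow_le_rpow (abs_nonneg _) (abs_apply_le_ellNorm hp x i) (by linarith)
    _ = M ^ q.toReal := by
        rw [← Finset.sum_mul, hMp, ← Real.rpow_add h0, add_sub_cancel]

/-- Comparison of the `ℓ_q`-norm with the `ℓ_p`-norm. -/
lemma ellNorm_le_mul {p q : ℝ≥0∞} (hp : 1 ≤ p) (hq : 1 ≤ q) (x : Vec d) :
    ellNorm q x ≤ (d : ℝ) ^ max 0 ((q⁻¹).toReal - (p⁻¹).toReal) * ellNorm p x := by
  have h0 := ellNorm_nonneg hp x
  rcases le_total p q with hpq | hpq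
  · have : (q⁻¹).toReal ≤ (p⁻¹).toReal :=
      ENNReal.toReal_mono (ENNReal.inv_ne_top.2 (by positivity)) (ENNReal.inv_le_inv.2 hpq)
    rw [max_eq_left (by linarith), Real.rpow_zero, one_mul]
    exact ellNorm_anti hp hpq x
  · have : (p⁻¹).toReal ≤ (q⁻¹).toReal :=
      ENNReal.toReal_mono (ENNReal.inv_ne_top.2 (by positivity)) (ENNReal.inv_le_inv.2 hpq)
    rw [max_eq_right (by linarith)]
    have key := eLpNorm_le_eLpNorm_mul_rpow_measure_univ (μ := (Measure.count : Measure (Fin d)))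
      (f := fun i => x i) hpq (by fun_prop)
    rw [← ellNorm_eq_eLpNorm hp, ← ellNorm_eq_eLpNorm hq, one_div, one_div,
      ← ENNReal.toReal_inv, ← ENNReal.toReal_inv, mul_comm] at key
    have hc : (Measure.count : Measure (Fin d)) Set.univ = ENNReal.ofReal (d : ℝ) := by
      rw [Measure.count_univ]; simp
    rw [hc, ENNReal.ofReal_rpow_of_nonneg (by positivity) (by linarith),
      ← ENNReal.ofReal_mul (by positivity)] at key
    exact (ENNReal.ofReal_le_ofReal_iff (by positivity)).1 key

lemma inner_eq_sum (x y : Vec d) : inner ℝ x y = ∑ i, x i * y i := by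
  simp [PiLp.inner_apply, mul_comm]

lemma abs_inner_le_one_top (x y : Vec d) : |inner ℝ x y| ≤ ellNorm 1 x * ellNorm ∞ y := by
  rw [inner_eq_sum, ellNorm_one, Finset.sum_mul]
  refine (Finset.abs_sum_le_sum_abs _ _).trans (Finset.sum_le_sum fun i _ => ?_)
  rw [abs_mul]
  exact mul_le_mul_of_nonneg_left (abs_apply_le_ellNorm (by simp) y i) (abs_nonneg _)

/-- Hölder's inequality. -/
lemma abs_inner_le {p : ℝ≥0∞} (hp : 1 ≤ p) (x y : Vec d) :
    |inner ℝ x y| ≤ ellNorm (ENNReal.conjExponent p) x * ellNorm p y := by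
  rcases eq_or_ne p ∞ with rfl | hp'
  · simpa [ENNReal.conjExponent] using abs_inner_le_one_top x y
  rcases eq_or_ne p 1 with rfl | hp1
  · have := abs_inner_le_one_top y x
    rw [real_inner_comm, mul_comm] at this
    simpa [ENNReal.conjExponent] using this
  lift p to NNReal using hp'
  have h1 : 1 < p := by
    have := lt_of_le_of_ne hp (Ne.symm hp1)
    exact_mod_cast this
  have hc := (NNReal.HolderConjugate.conjExponent h1).symm
  have h2 : (1 : ℝ≥0∞) ≤ p.conjExponent := by
    rw [ENNReal.coe_conjExponent h1]; simp [ENNReal.conjExponent]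
  rw [← ENNReal.coe_conjExponent h1, ellNorm_eq_sum h2 (by simp), ellNorm_eq_sum hp (by simp),
    inner_eq_sum]
  refine (Finset.abs_sum_le_sum_abs _ _).trans ?_
  simp only [abs_mul]
  simpa only [abs_abs, ENNReal.coe_toReal] using Real.inner_le_Lp_mul_Lq Finset.univ
    (fun i => |x i|) (fun i => |y i|) (NNReal.holderConjugate_coe_iff.2 hc)

lemma one_le_conjExponent (p : ℝ≥0∞) : 1 ≤ ENNReal.conjExponent p := by
  simp [ENNReal.conjExponent]

lemma abs_signVec_apply (x : Vec d) (i : Fin d) : |signVec x i| = 1 := by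
  simp only [signVec]
  split_ifs <;> simp

lemma toReal_inv_le_one {p : ℝ≥0∞} (hp : 1 ≤ p) : (p⁻¹).toReal ≤ 1 := by
  have := ENNReal.toReal_mono (by simp) (ENNReal.inv_le_inv.2 hp)
  simpa using this

/-- The dual norm of a sign vector. -/
lemma ellNorm_signVec_le {p : ℝ≥0∞} (hp : 1 ≤ p) (x : Vec d) :
    ellNorm (ENNReal.conjExponent p) (signVec x) ≤ (d : ℝ) ^ (1 - (p⁻¹).toReal) := by
  have h := ellNorm_le_mul (p := ∞) le_top (one_le_conjExponent p) (signVec x)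
  have h1 : ellNorm ∞ (signVec x) ≤ 1 :=
    Real.iSup_le (fun i => (abs_signVec_apply x i).le) zero_le_one
  have h2 : ((ENNReal.conjExponent p)⁻¹).toReal = 1 - (p⁻¹).toReal := by
    have := Fact.mk hp
    have := ENNReal.HolderConjugate.inv_add_inv_eq_one p (ENNReal.conjExponent p)
    have := congrArg ENNReal.toReal this
    rw [ENNReal.toReal_add (ENNReal.inv_ne_top.2 (by positivity))
      (ENNReal.inv_ne_top.2 (by have := one_le_conjExponent p; positivity))] at this
    simp at this ⊢
    linarith
  rw [h2] at h
  have h3 := toReal_inv_le_one hp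
  simp only [ENNReal.inv_top, ENNReal.toReal_zero, sub_zero] at h
  rw [max_eq_right (by linarith)] at h
  exact h.trans (mul_le_of_le_one_right (by positivity) h1)

lemma ellNorm_one_le_sqrt_mul_norm (x : Vec d) : ellNorm 1 x ≤ √d * ‖x‖ := by
  have := ellNorm_le_mul (p := 2) (q := 1) (by norm_num) le_rfl x
  rw [ellNorm_two] at this
  convert this using 2
  rw [Real.sqrt_eq_rpow]
  norm_num

lemma norm_le_ellNorm_one (x : Vec d) : ‖x‖ ≤ ellNorm 1 x :=
  ellNorm_anti (p := 1) (q := 2) le_rfl (by norm_num) x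

lemma measurable_signVec : Measurable (signVec (d := d)) := by
  refine (MeasurableEquiv.toLp 2 (Fin d → ℝ)).measurable.comp (measurable_pi_lambda _ fun i => ?_)
  exact Measurable.ite (measurableSet_le measurable_const (by fun_prop)) measurable_const
    measurable_const

/-! ### Polar coordinates for the `ℓ_1`-norm -/

open Measure Set Metric in
/-- Polar coordinates for a normed space. -/
lemma integral_polar {E : Type*} [NormedAddCommGroup E] [NormedSpace ℝ E] [FiniteDimensional ℝ E]
    [MeasurableSpace E] [BorelSpace E] [Nontrivial E] (μ : Measure E) [μ.IsAddHaarMeasure]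
    (g : E → ℝ) (φ : ℝ → ℝ) :
    ∫ x, g (‖x‖⁻¹ • x) * φ ‖x‖ ∂μ = (∫ s : sphere (0 : E) 1, g s ∂μ.toSphere) *
      ∫ ρ in Ioi (0 : ℝ), ρ ^ (Module.finrank ℝ E - 1) * φ ρ :=
  calc
    ∫ x, g (‖x‖⁻¹ • x) * φ ‖x‖ ∂μ
      = ∫ x : ({(0)}ᶜ : Set E), g (‖x.1‖⁻¹ • x.1) * φ ‖x.1‖ ∂(μ.comap (↑)) := by
      rw [integral_subtype_comap (measurableSet_singleton _).compl
        fun x ↦ g (‖x‖⁻¹ • x) * φ (‖x‖), restrict_compl_singleton]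
    _ = ∫ x, g x.1 * φ x.2 ∂μ.toSphere.prod (.volumeIoiPow (Module.finrank ℝ E - 1)) := by
      simpa using μ.measurePreserving_homeomorphUnitSphereProd.integral_comp
        (Homeomorph.measurableEmbedding _)
        (fun z : sphere (0 : E) 1 × Ioi (0 : ℝ) => g z.1 * φ z.2)
    _ = (∫ s : sphere (0 : E) 1, g s ∂μ.toSphere) *
        ∫ x : Ioi (0 : ℝ), φ x ∂.volumeIoiPow (Module.finrank ℝ E - 1) :=
      integral_prod_mul (fun s : sphere (0 : E) 1 => g s) (fun ρ : Ioi (0 : ℝ) => φ ρ)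
    _ = _ := by
      simp only [Measure.volumeIoiPow, ENNReal.ofReal]
      rw [integral_withDensity_eq_integral_smul,
        integral_subtype_comap measurableSet_Ioi
          fun a ↦ Real.toNNReal (a ^ (Module.finrank ℝ E - 1)) • φ a,
        setIntegral_congr_fun measurableSet_Ioi fun x hx ↦ ?_]
      · rw [NNReal.smul_def, Real.coe_toNNReal _ (pow_nonneg hx.out.le _)]; rfl
      · exact (measurable_subtype_coe.pow_const _).real_toNNReal

lemma measurableSet_ellBall_one : MeasurableSet (ellBall d 1) :=
  (isOpen_lt (continuous_ellNorm le_rfl) continuous_const).measurableSet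

/-- `ℝ^d` with the Euclidean norm and `ℝ^d` with the `ℓ_1`-norm are linearly homeomorphic. -/
def euclidEquivL1 (d : ℕ) : Vec d ≃L[ℝ] PiLp 1 (fun _ : Fin d => ℝ) :=
  (PiLp.continuousLinearEquiv 2 ℝ (fun _ : Fin d => ℝ)).trans
    (PiLp.continuousLinearEquiv 1 ℝ (fun _ : Fin d => ℝ)).symm

lemma norm_euclidEquivL1 (x : Vec d) : ‖euclidEquivL1 d x‖ = ellNorm 1 x := rfl

/-- Lebesgue measure on `ℝ^d` with the `ℓ_1`-norm. -/
def volL1 (d : ℕ) : Measure (PiLp 1 (fun _ : Fin d => ℝ)) := volume.map (euclidEquivL1 d)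

instance : (volL1 d).IsAddHaarMeasure := by
  unfold volL1; exact (euclidEquivL1 d).isAddHaarMeasure_map volume

lemma measurableEmbedding_euclidEquivL1 : MeasurableEmbedding (euclidEquivL1 d) :=
  (euclidEquivL1 d).toHomeomorph.measurableEmbedding

lemma volL1_ball : (volL1 d) (Metric.ball 0 1) = volume (ellBall d 1) := by
  rw [volL1, measurableEmbedding_euclidEquivL1.map_apply]
  congr 1
  ext x
  simp [ellBall, norm_euclidEquivL1]

lemma volume_ellBall_one_pos : 0 < volume (ellBall d 1) := by
  rw [← volL1_ball]
  exact Metric.measure_ball_pos _ _ zero_lt_one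

lemma volume_ellBall_one_ne_top : volume (ellBall d 1) ≠ ∞ := by
  rw [← volL1_ball]
  exact measure_ball_lt_top.ne

/-- The total surface mass of the `ℓ_1`-sphere in polar coordinates, `d` times the volume of the
unit ball. -/
def surfL1 (d : ℕ) : ℝ := d * volume.real (ellBall d 1)

lemma surfL1_pos (hd : 0 < d) : 0 < surfL1 d :=
  mul_pos (by exact_mod_cast hd)
    (ENNReal.toReal_pos volume_ellBall_one_pos.ne' volume_ellBall_one_ne_top)

lemma measurable_l1Normalize : Measurable (fun x : Vec d => (ellNorm 1 x)⁻¹ • x) :=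
  ((continuous_ellNorm le_rfl).measurable.inv).smul measurable_id

lemma integral_ball_l1Normalize {g : Vec d → ℝ} (hg : Measurable g) :
    ∫ x in ellBall d 1, g ((ellNorm 1 x)⁻¹ • x) =
      volume.real (ellBall d 1) * ∫ s, g s ∂unifL1Sphere d := by
  rw [unifL1Sphere, integral_map measurable_l1Normalize.aemeasurable hg.aestronglyMeasurable,
    ProbabilityTheory.cond, integral_smul_measure, ENNReal.toReal_inv, smul_eq_mul, ← mul_assoc]
  change _ = (volume.real (ellBall d 1)) * (volume.real (ellBall d 1))⁻¹ * _
  rw [mul_inv_cancel₀, one_mul]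
  exact (ENNReal.toReal_pos volume_ellBall_one_pos.ne' volume_ellBall_one_ne_top).ne'

open Set in
/-- Polar coordinates for the `ℓ_1`-norm, in terms of the uniform distribution on the sphere. -/
theorem integral_polar_l1 (hd : 0 < d) {g : Vec d → ℝ} (hg : Measurable g) (φ : ℝ → ℝ) :
    ∫ x, g ((ellNorm 1 x)⁻¹ • x) * φ (ellNorm 1 x) =
      surfL1 d * (∫ s, g s ∂unifL1Sphere d) * ∫ ρ in Ioi (0 : ℝ), ρ ^ (d - 1) * φ ρ := by
  have : Nonempty (Fin d) := ⟨⟨0, hd⟩⟩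
  have : Nontrivial (PiLp 1 (fun _ : Fin d => ℝ)) :=
    (WithLp.equiv 1 (Fin d → ℝ)).nontrivial
  have hfin : Module.finrank ℝ (PiLp 1 (fun _ : Fin d => ℝ)) = d := by
    rw [← (euclidEquivL1 d).toLinearEquiv.finrank_eq]; simp
  set I := ∫ s : Metric.sphere (0 : PiLp 1 (fun _ : Fin d => ℝ)) 1,
    g ((euclidEquivL1 d).symm s) ∂(volL1 d).toSphere with hI
  have key : ∀ φ : ℝ → ℝ, ∫ x, g ((ellNorm 1 x)⁻¹ • x) * φ (ellNorm 1 x) =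
      I * ∫ ρ in Ioi (0 : ℝ), ρ ^ (d - 1) * φ ρ := by
    intro φ
    have := integral_polar (volL1 d) (fun z => g ((euclidEquivL1 d).symm z)) φ
    rw [hfin, ← hI] at this
    rw [← this, volL1, measurableEmbedding_euclidEquivL1.integral_map]
    simp [norm_euclidEquivL1]
  rw [key]
  congr 1
  have h1 := key ((Iio 1).indicator 1)
  have h2 : ∫ x, g ((ellNorm 1 x)⁻¹ • x) * (Iio 1).indicator 1 (ellNorm 1 x) =
      ∫ x in ellBall d 1, g ((ellNorm 1 x)⁻¹ • x) := by
    rw [← integral_indicator measurableSet_ellBall_one]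
    congr 1; ext x
    by_cases h : ellNorm 1 x < 1 <;> simp [ellBall, indicator, h]
  have h3 : ∫ ρ in Ioi (0 : ℝ), ρ ^ (d - 1) * (Iio (1 : ℝ)).indicator 1 ρ = (d : ℝ)⁻¹ := by
    have : ∀ ρ : ℝ, ρ ^ (d - 1) * (Iio (1 : ℝ)).indicator 1 ρ =
        (Iio (1 : ℝ)).indicator (fun ρ => ρ ^ (d - 1)) ρ := by
      intro ρ
      by_cases h : ρ < 1 <;> simp [h]
    simp_rw [this]
    rw [setIntegral_indicator measurableSet_Iio, Ioi_inter_Iio, ← integral_Ioc_eq_integral_Ioo,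
      ← intervalIntegral.integral_of_le zero_le_one, integral_pow, Nat.sub_add_cancel hd,
      Nat.cast_pred hd]
    simp [hd.ne']
  rw [h2, h3, integral_ball_l1Normalize hg] at h1
  rw [surfL1, mul_assoc, h1]
  field_simp

instance : IsProbabilityMeasure (unifL1Sphere d) := by
  have : IsProbabilityMeasure (volume[|ellBall d 1]) :=
    cond_isProbabilityMeasure_of_finite volume_ellBall_one_pos.ne' volume_ellBall_one_ne_top
  exact Measure.isProbabilityMeasure_map measurable_l1Normalize.aemeasurable

lemma ae_ellNorm_one_eq_one (hd : 0 < d) : ∀ᵐ s ∂unifL1Sphere d, ellNorm 1 s = 1 := by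
  have : Nonempty (Fin d) := ⟨⟨0, hd⟩⟩
  have : Nontrivial (Vec d) := (WithLp.equiv 2 (Fin d → ℝ)).nontrivial
  rw [unifL1Sphere, ae_map_iff measurable_l1Normalize.aemeasurable
    (measurableSet_eq_fun (continuous_ellNorm le_rfl).measurable measurable_const)]
  refine cond_absolutelyContinuous.ae_le ?_
  filter_upwards [compl_mem_ae_iff.2 (measure_singleton (0 : Vec d))] with x hx
  have h0 : ellNorm 1 x ≠ 0 := fun h => hx ((ellNorm_eq_zero le_rfl).1 h)
  rw [ellNorm_smul le_rfl, abs_inv, abs_of_nonneg (ellNorm_nonneg le_rfl x), inv_mul_cancel₀ h0]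

lemma map_neg_unifL1Sphere : (unifL1Sphere d).map (fun s => -s) = unifL1Sphere d := by
  rw [unifL1Sphere, Measure.map_map measurable_neg measurable_l1Normalize]
  have : (fun s : Vec d => -s) ∘ (fun x : Vec d => (ellNorm 1 x)⁻¹ • x) =
      (fun x : Vec d => (ellNorm 1 x)⁻¹ • x) ∘ (fun s => -s) := by
    ext x; simp [ellNorm_neg]
  rw [this, ← Measure.map_map measurable_l1Normalize measurable_neg]
  congr 1
  rw [ProbabilityTheory.cond, Measure.map_smul]
  congr 1
  have hm : MeasurePreserving (fun x : Vec d => -x) volume volume :=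
    Measure.measurePreserving_neg volume
  have hpre : (fun x : Vec d => -x) ⁻¹' ellBall d 1 = ellBall d 1 := by
    ext x; simp [ellBall, ellNorm_neg]
  conv_lhs => rw [← hpre]
  exact (hm.restrict_preimage measurableSet_ellBall_one).map_eq

lemma integral_neg_unifL1Sphere (g : Vec d → ℝ) :
    ∫ s, g (-s) ∂unifL1Sphere d = ∫ s, g s ∂unifL1Sphere d := by
  conv_rhs => rw [← map_neg_unifL1Sphere]
  exact ((MeasurableEquiv.neg (Vec d)).measurableEmbedding.integral_map g).symm

/-! ### The Poincaré inequality for the product Laplace distribution -/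

section EfronStein

variable {α β : Type*} [MeasurableSpace α] [MeasurableSpace β]

lemma memLp_two_integral_prod {μ : Measure α} {ν : Measure β} [IsProbabilityMeasure μ]
    [IsProbabilityMeasure ν] {F : α × β → ℝ} (hF : MemLp F 2 (μ.prod ν)) :
    MemLp (fun a => ∫ b, F (a, b) ∂ν) 2 μ := by
  have hm : AEStronglyMeasurable (fun a => ∫ b, F (a, b) ∂ν) μ :=
    hF.1.integral_prod_right'
  rw [memLp_two_iff_integrable_sq hm]
  have h2 := hF.integrable_sq
  refine h2.integral_prod_left.mono' (hm.pow 2) ?_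
  filter_upwards [h2.prod_right_ae, (hF.integrable one_le_two).prod_right_ae] with a ha1 ha2
  rw [Real.norm_eq_abs, abs_of_nonneg (sq_nonneg _)]
  have := (even_two.convexOn_pow (𝕜 := ℝ)).map_integral_le (μ := ν) (f := fun b => F (a, b))
    (continuous_pow 2).continuousOn isClosed_univ (by simp) ha2 ha1
  simpa using this

/-- The variance of a function of two independent variables is at most the sum of the mean
variances in each of the variables: both sides differ by the mean square of
`F - E[F | a] - E[F | b] + E F`. -/
lemma variance_prod_le {μ : Measure α} {ν : Measure β} [IsProbabilityMeasure μ]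
    [IsProbabilityMeasure ν] {F : α × β → ℝ} (hF : MemLp F 2 (μ.prod ν)) :
    ∫ z, F z ^ 2 ∂μ.prod ν - (∫ z, F z ∂μ.prod ν) ^ 2 ≤
      ∫ a, (∫ b, F (a, b) ^ 2 ∂ν - (∫ b, F (a, b) ∂ν) ^ 2) ∂μ +
      ∫ b, (∫ a, F (a, b) ^ 2 ∂μ - (∫ a, F (a, b) ∂μ) ^ 2) ∂ν := by
  set m : α → ℝ := fun a => ∫ b, F (a, b) ∂ν with hm
  set g : β → ℝ := fun b => ∫ a, F (a, b) ∂μ with hg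
  set M := ∫ z, F z ∂μ.prod ν with hM
  have hm2 : MemLp m 2 μ := memLp_two_integral_prod hF
  have hg2 : MemLp g 2 ν :=
    memLp_two_integral_prod (F := fun z : β × α => F z.swap)
      (hF.comp_measurePreserving Measure.measurePreserving_swap)
  have hmp : MemLp (fun z : α × β => m z.1) 2 (μ.prod ν) :=
    hm2.comp_measurePreserving measurePreserving_fst
  have hgp : MemLp (fun z : α × β => g z.2) 2 (μ.prod ν) :=
    hg2.comp_measurePreserving measurePreserving_snd
  have hF2 := hF.integrable_sq
  have hF1 := hF.integrable one_le_two
  have iFm : Integrable (fun z => F z * m z.1) (μ.prod ν) := hF.integrable_mul hmp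
  have iFg : Integrable (fun z => F z * g z.2) (μ.prod ν) := hF.integrable_mul hgp
  have img : Integrable (fun z : α × β => m z.1 * g z.2) (μ.prod ν) := hmp.integrable_mul hgp
  have imm : Integrable (fun z : α × β => m z.1 ^ 2) (μ.prod ν) := hmp.integrable_sq
  have igg : Integrable (fun z : α × β => g z.2 ^ 2) (μ.prod ν) := hgp.integrable_sq
  have im : Integrable (fun z : α × β => m z.1) (μ.prod ν) := hmp.integrable one_le_two
  have ig : Integrable (fun z : α × β => g z.2) (μ.prod ν) := hgp.integrable one_le_two
  have eM : ∫ a, m a ∂μ = M := (integral_prod _ hF1).symm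
  have eG : ∫ b, g b ∂ν = M := (integral_prod_symm _ hF1).symm
  have em : ∫ z : α × β, m z.1 ∂μ.prod ν = M := by rw [integral_fun_fst]; simpa using eM
  have eg : ∫ z : α × β, g z.2 ∂μ.prod ν = M := by rw [integral_fun_snd]; simpa using eG
  have emm : ∫ z : α × β, m z.1 ^ 2 ∂μ.prod ν = ∫ a, m a ^ 2 ∂μ := by
    rw [integral_fun_fst (fun a => m a ^ 2)]; simp
  have egg : ∫ z : α × β, g z.2 ^ 2 ∂μ.prod ν = ∫ b, g b ^ 2 ∂ν := by
    rw [integral_fun_snd (fun a => g a ^ 2)]; simp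
  have eFm : ∫ z, F z * m z.1 ∂μ.prod ν = ∫ a, m a ^ 2 ∂μ := by
    rw [integral_prod _ iFm]
    simp only [integral_mul_const, sq]; rfl
  have eFg : ∫ z, F z * g z.2 ∂μ.prod ν = ∫ b, g b ^ 2 ∂ν := by
    rw [integral_prod_symm _ iFg]
    simp only [integral_mul_const, sq]; rfl
  have emg : ∫ z : α × β, m z.1 * g z.2 ∂μ.prod ν = M ^ 2 := by
    rw [integral_prod_mul, eM, eG, sq]
  have e1 : ∫ a, (∫ b, F (a, b) ^ 2 ∂ν - m a ^ 2) ∂μ =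
      ∫ z, F z ^ 2 ∂μ.prod ν - ∫ a, m a ^ 2 ∂μ := by
    rw [integral_sub hF2.integral_prod_left hm2.integrable_sq, integral_prod _ hF2]
  have e2 : ∫ b, (∫ a, F (a, b) ^ 2 ∂μ - g b ^ 2) ∂ν =
      ∫ z, F z ^ 2 ∂μ.prod ν - ∫ b, g b ^ 2 ∂ν := by
    rw [integral_sub hF2.integral_prod_right hg2.integrable_sq, integral_prod_symm _ hF2]
  have key : 0 ≤ ∫ z : α × β, (F z - m z.1 - g z.2 + M) ^ 2 ∂μ.prod ν :=
    integral_nonneg fun _ => sq_nonneg _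
  have expand : ∀ z : α × β, (F z - m z.1 - g z.2 + M) ^ 2 =
      (F z ^ 2 + m z.1 ^ 2 + g z.2 ^ 2 + M ^ 2) + (2 * (m z.1 * g z.2) + 2 * M * F z) -
      (2 * (F z * m z.1) + 2 * (F z * g z.2) + (2 * M * m z.1 + 2 * M * g z.2)) := fun z => by ring
  simp_rw [expand] at key
  have iM : Integrable (fun _ : α × β => M ^ 2) (μ.prod ν) := integrable_const _
  have j1 := img.const_mul 2
  have j2 := hF1.const_mul (2 * M)
  have j3 := iFm.const_mul 2
  have j4 := iFg.const_mul 2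
  have j5 := im.const_mul (2 * M)
  have j6 := ig.const_mul (2 * M)
  rw [integral_sub, integral_add, integral_add, integral_add, integral_add, integral_add,
    integral_add, integral_add, integral_add] at key
  · simp only [integral_const_mul, integral_const, probReal_univ, one_smul, emm, egg, eFm, eFg, emg,
      em, eg, ← hM] at key
    rw [e1, e2]
    nlinarith [key]
  all_goals first
    | assumption
    | exact ((hF2.add imm).add igg).add iM
    | exact (hF2.add imm).add igg
    | exact hF2.add imm
    | exact j1.add j2
    | exact j3.add j4
    | exact j5.add j6
    | exact (j3.add j4).add (j5.add j6)
    | exact (((hF2.add imm).add igg).add iM).add (j1.add j2)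

end EfronStein

/-- The Laplace distribution, with density `exp (-|x|) / 2`. -/
def laplace : Measure ℝ := volume.withDensity fun x => ENNReal.ofReal (Real.exp (-|x|) / 2)

lemma measurable_laplaceDensity : Measurable fun x : ℝ => ENNReal.ofReal (Real.exp (-|x|) / 2) := by
  fun_prop

lemma integral_laplace (g : ℝ → ℝ) : ∫ x, g x ∂laplace = ∫ x, Real.exp (-|x|) / 2 * g x := by
  rw [laplace, integral_withDensity_eq_integral_toReal_smul measurable_laplaceDensity (by simp)]
  congr 1; ext x
  rw [ENNReal.toReal_ofReal (by positivity), smul_eq_mul]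

lemma integrable_laplace_iff (g : ℝ → ℝ) :
    Integrable g laplace ↔ Integrable (fun x => Real.exp (-|x|) / 2 * g x) := by
  rw [laplace, integrable_withDensity_iff_integrable_smul' measurable_laplaceDensity (by simp)]
  refine integrable_congr (.of_forall fun x => ?_)
  simp only [smul_eq_mul]
  rw [ENNReal.toReal_ofReal (by positivity)]

open Set in
lemma integrableOn_pow_mul_exp_neg (n : ℕ) :
    IntegrableOn (fun x : ℝ => x ^ n * Real.exp (-x)) (Ioi 0) := by
  have := Real.GammaIntegral_convergent (s := n + 1) (by positivity)
  refine this.congr_fun (fun x hx => ?_) measurableSet_Ioi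
  simp only [add_sub_cancel_right, Real.rpow_natCast]
  ring

open Set in
lemma integral_pow_mul_exp_neg (n : ℕ) :
    ∫ x in Ioi (0 : ℝ), x ^ n * Real.exp (-x) = n.factorial := by
  rw [← Real.Gamma_nat_eq_factorial, Real.Gamma_eq_integral (by positivity)]
  refine setIntegral_congr_fun measurableSet_Ioi fun x hx => ?_
  simp only [add_sub_cancel_right, Real.rpow_natCast]
  ring

open Set in
lemma integrable_comp_abs {f : ℝ → ℝ} (hf : IntegrableOn f (Ioi 0)) :
    Integrable fun x => f |x| := by
  have h1 : IntegrableOn (fun x => f |x|) (Ioi 0) :=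
    hf.congr_fun (fun x hx => by rw [abs_of_pos hx]) measurableSet_Ioi
  have h2 : IntegrableOn (fun x => f |x|) (Iio 0) := by
    have := (Measure.measurePreserving_neg (volume : Measure ℝ)).integrableOn_comp_preimage
      (MeasurableEquiv.neg ℝ).measurableEmbedding (f := fun x => f |x|) (s := Ioi 0)
    simpa [Function.comp_def] using this.2 h1
  rw [← integrableOn_univ, ← Iic_union_Ioi (a := (0 : ℝ))]
  exact ((integrableOn_Iic_iff_integrableOn_Iio).2 h2).union h1

instance : IsProbabilityMeasure laplace := by
  constructor
  have hi : Integrable (fun x : ℝ => Real.exp (-|x|) / 2) := by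
    have := integrableOn_pow_mul_exp_neg 0
    simp only [pow_zero, one_mul] at this
    exact (integrable_comp_abs this).div_const 2
  rw [laplace, withDensity_apply _ MeasurableSet.univ, setLIntegral_univ,
    ← ofReal_integral_eq_lintegral_ofReal hi (.of_forall fun _ => by positivity),
    integral_div, integral_comp_abs (f := fun x => Real.exp (-x)), integral_exp_neg_Ioi_zero]
  simp

lemma integrable_sq_laplace : Integrable (fun x : ℝ => x ^ 2) laplace := by
  rw [integrable_laplace_iff]
  have := (integrable_comp_abs (integrableOn_pow_mul_exp_neg 2)).div_const 2
  refine this.congr (.of_forall fun x => ?_)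
  simp only [sq_abs]; ring

lemma integral_sq_laplace : ∫ x, x ^ 2 ∂laplace = 2 := by
  rw [integral_laplace]
  have h : ∀ x : ℝ, Real.exp (-|x|) / 2 * x ^ 2 = (|x| ^ 2 * Real.exp (-|x|)) / 2 := fun x => by
    rw [sq_abs]; ring
  simp_rw [h]
  rw [integral_div, integral_comp_abs (f := fun x => x ^ 2 * Real.exp (-x)),
    integral_pow_mul_exp_neg]
  norm_num [Nat.factorial]

lemma memLp_id_laplace : MemLp (fun x : ℝ => x) 2 laplace :=
  (memLp_two_iff_integrable_sq (by fun_prop)).2 integrable_sq_laplace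

open Set in
/-- Hardy's inequality on the half-line with exponential weight: integration by parts gives
`∫ w² e⁻ᵗ ≤ ∫ 2 w w' e⁻ᵗ` for `w = u - u 0`, and half of the left-hand side absorbs `w`. -/
lemma half_line_poincare {u : ℝ → ℝ} {K : NNReal} (hu : LipschitzWith K u) :
    ∫ t in Ioi (0 : ℝ), Real.exp (-t) * (u t - u 0) ^ 2 ≤
      4 * ∫ t in Ioi (0 : ℝ), Real.exp (-t) * deriv u t ^ 2 := by
  set w : ℝ → ℝ := fun t => u t - u 0 with hw
  have hwL : LipschitzWith K w := by
    simpa using hu.sub (LipschitzWith.const (u 0))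
  have hwc : Continuous w := hwL.continuous
  have hdw : ∀ t, deriv w t = deriv u t := fun t => by rw [hw, deriv_sub_const]
  have hder : ∀ t, |deriv u t| ≤ K := fun t => norm_deriv_le_of_lipschitz hu
  have hdm : Measurable (deriv u) := measurable_deriv u
  have i2 : IntegrableOn (fun t => Real.exp (-t) * deriv u t ^ 2) (Ioi 0) := by
    have h0 := (integrableOn_pow_mul_exp_neg 0).const_mul ((K : ℝ) ^ 2)
    refine Integrable.mono' h0 (by fun_prop) (.of_forall fun t => ?_)
    rw [Real.norm_eq_abs, abs_of_nonneg (by positivity), pow_zero, one_mul, mul_comm]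
    gcongr ?_ * _
    exact sq_le_sq' (abs_le.1 (hder t)).1 (abs_le.1 (hder t)).2
  have i1 : IntegrableOn (fun t => Real.exp (-t) * w t ^ 2) (Ioi 0) := by
    have h0 := (integrableOn_pow_mul_exp_neg 2).const_mul ((K : ℝ) ^ 2)
    refine Integrable.mono' h0 (by fun_prop)
      ((ae_restrict_mem measurableSet_Ioi).mono fun t ht => ?_)
    have h := hu.dist_le_mul t 0
    rw [Real.dist_eq, Real.dist_eq, sub_zero, abs_of_pos ht.out] at h
    rw [Real.norm_eq_abs, abs_of_nonneg (by positivity)]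
    have := sq_le_sq' (abs_le.1 h).1 (abs_le.1 h).2
    rw [mul_comm, ← mul_assoc, ← mul_pow]
    gcongr
  have hfin : ∀ b : ℝ, 0 ≤ b → ∫ t in (0 : ℝ)..b, Real.exp (-t) * w t ^ 2 ≤
      4 * ∫ t in (0 : ℝ)..b, Real.exp (-t) * deriv u t ^ 2 := by
    intro b hb
    have j1 : IntervalIntegrable (fun t => Real.exp (-t) * w t ^ 2) volume 0 b :=
      (intervalIntegrable_iff_integrableOn_Ioc_of_le hb).2 (i1.mono_set Ioc_subset_Ioi_self)
    have j2 : IntervalIntegrable (fun t => Real.exp (-t) * deriv u t ^ 2) volume 0 b :=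
      (intervalIntegrable_iff_integrableOn_Ioc_of_le hb).2 (i2.mono_set Ioc_subset_Ioi_self)
    have ac1 : AbsolutelyContinuousOnInterval w 0 b :=
      (hwL.lipschitzOnWith (s := uIcc 0 b)).absolutelyContinuousOnInterval
    have ac2 : AbsolutelyContinuousOnInterval (fun t => Real.exp (-t)) 0 b := by
      have : ContDiff ℝ 1 fun t : ℝ => Real.exp (-t) := by fun_prop
      obtain ⟨L, hL⟩ := this.contDiffOn.exists_lipschitzOnWith (s := uIcc 0 b) one_ne_zero
        (convex_uIcc 0 b) isCompact_uIcc
      exact hL.absolutelyContinuousOnInterval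
    have ibp := (ac1.fun_mul ac1).integral_deriv_mul_eq_sub ac2
    have hd1 : ∀ᵐ t : ℝ, deriv (fun t => w t * w t) t = 2 * w t * deriv u t := by
      filter_upwards [hu.ae_differentiableAt_real] with t ht
      have : DifferentiableAt ℝ w t := ht.sub_const _
      rw [deriv_fun_mul this this, hdw]; ring
    have hd2 : ∀ t : ℝ, deriv (fun t => Real.exp (-t)) t = - Real.exp (-t) := fun t => by
      simpa using ((hasDerivAt_neg t).exp).deriv
    have e1 : ∫ t in (0 : ℝ)..b,
        (2 * (Real.exp (-t) * (w t * deriv u t)) - Real.exp (-t) * w t ^ 2) =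
        w b ^ 2 * Real.exp (-b) := by
      rw [intervalIntegral.integral_congr_ae (g := fun x => deriv (fun t => w t * w t) x *
        Real.exp (-x) + w x * w x * deriv (fun t => Real.exp (-t)) x), ibp]
      · simp [hw, sq]
      · filter_upwards [hd1] with t ht _
        rw [ht, hd2]; ring
    have hle : ∫ t in (0 : ℝ)..b,
        (2 * (Real.exp (-t) * (w t * deriv u t)) - Real.exp (-t) * w t ^ 2) ≤
        ∫ t in (0 : ℝ)..b, (2 * (Real.exp (-t) * deriv u t ^ 2) -
          1 / 2 * (Real.exp (-t) * w t ^ 2)) := by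
      refine intervalIntegral.integral_mono_on hb ?_ ((j2.const_mul 2).sub (j1.const_mul _)) ?_
      · refine IntervalIntegrable.sub (IntervalIntegrable.const_mul ?_ 2) j1
        refine IntervalIntegrable.mono_fun (j2.add j1) (by fun_prop) (.of_forall fun t => ?_)
        have h0 : 0 ≤ Real.exp (-t) * deriv u t ^ 2 + Real.exp (-t) * w t ^ 2 := by positivity
        simp only [Real.norm_eq_abs]
        rw [abs_of_nonneg h0, abs_mul, abs_of_pos (Real.exp_pos _), ← mul_add]
        refine mul_le_mul_of_nonneg_left ?_ (Real.exp_pos _).le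
        rw [abs_le]
        constructor <;> nlinarith [sq_nonneg (w t - deriv u t), sq_nonneg (w t + deriv u t)]
      · intro t _
        -- `2 w u' ≤ w ^ 2 / 2 + 2 u' ^ 2`
        nlinarith [mul_nonneg (Real.exp_pos (-t)).le (sq_nonneg (w t - 2 * deriv u t))]
    rw [e1, intervalIntegral.integral_sub (j2.const_mul 2) (j1.const_mul _),
      intervalIntegral.integral_const_mul, intervalIntegral.integral_const_mul] at hle
    have : 0 ≤ w b ^ 2 * Real.exp (-b) := by positivity
    linarith
  refine le_of_tendsto_of_tendsto
    (intervalIntegral_tendsto_integral_Ioi 0 i1 Filter.tendsto_id)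
    ((intervalIntegral_tendsto_integral_Ioi 0 i2 Filter.tendsto_id).const_mul 4) ?_
  filter_upwards [Filter.eventually_ge_atTop 0] with b hb using hfin b hb

lemma memLp_laplace_of_lipschitz {u : ℝ → ℝ} {K : NNReal} (hu : LipschitzWith K u) :
    MemLp u 2 laplace := by
  have h : MemLp (fun t : ℝ => |u 0| + K * |t|) 2 laplace :=
    (memLp_const |u 0|).add (memLp_id_laplace.abs.const_mul (K : ℝ))
  refine h.mono hu.continuous.aestronglyMeasurable (.of_forall fun t => ?_)
  have := hu.dist_le_mul t 0
  rw [Real.dist_eq, Real.dist_eq, sub_zero] at this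
  rw [Real.norm_eq_abs, Real.norm_eq_abs, abs_of_nonneg (a := |u 0| + K * |t|) (by positivity)]
  have h2 := abs_add_le (u t - u 0) (u 0)
  rw [sub_add_cancel] at h2
  linarith

open Set in
/-- The Poincaré inequality for the Laplace distribution on the line. -/
lemma poincare_laplace {u : ℝ → ℝ} {K : NNReal} (hu : LipschitzWith K u) :
    ∫ t, u t ^ 2 ∂laplace - (∫ t, u t ∂laplace) ^ 2 ≤ 4 * ∫ t, deriv u t ^ 2 ∂laplace := by
  have hL := memLp_laplace_of_lipschitz hu
  have hdL : Integrable (fun t => deriv u t ^ 2) laplace := by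
    refine Integrable.mono' (integrable_const ((K : ℝ) ^ 2))
      ((measurable_deriv u).pow_const 2).aestronglyMeasurable (.of_forall fun t => ?_)
    have : |deriv u t| ≤ K := norm_deriv_le_of_lipschitz hu
    rw [Real.norm_eq_abs, abs_of_nonneg (by positivity)]
    exact sq_le_sq' (abs_le.1 this).1 (abs_le.1 this).2
  have hwL : MemLp (fun t => u t - u 0) 2 laplace := hL.sub (memLp_const _)
  have hw2 := hwL.integrable_sq
  -- centring at `u 0` instead of the mean only increases the mean square
  have e1 : ∫ t, (u t - u 0) ^ 2 ∂laplace = ∫ t, u t ^ 2 ∂laplace - 2 * u 0 * ∫ t, u t ∂laplace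
      + u 0 ^ 2 := by
    have : ∀ t, (u t - u 0) ^ 2 = u t ^ 2 - 2 * u 0 * u t + u 0 ^ 2 := fun t => by ring
    simp_rw [this]
    have i1 := hL.integrable_sq
    have i2 := (hL.integrable one_le_two).const_mul (2 * u 0)
    rw [integral_add (f := fun t => u t ^ 2 - 2 * u 0 * u t) (i1.sub i2) (integrable_const _),
      integral_sub i1 i2, integral_const_mul]
    simp
  have split : ∀ g : ℝ → ℝ, Integrable g laplace → ∫ t, g t ∂laplace =
      (∫ t in Ioi (0 : ℝ), Real.exp (-t) * g t) / 2 +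
      (∫ t in Ioi (0 : ℝ), Real.exp (-t) * g (-t)) / 2 := by
    intro g hg
    rw [integral_laplace]
    rw [integrable_laplace_iff] at hg
    have hneg := integral_comp_neg_Ioi 0 (fun x => Real.exp (-|x|) / 2 * g x)
    rw [neg_zero] at hneg
    rw [← integral_add_compl measurableSet_Ioi hg, compl_Ioi, ← hneg, ← integral_div,
      ← integral_div]
    congr 1
    · refine setIntegral_congr_fun measurableSet_Ioi fun t ht => ?_
      simp only [abs_of_pos ht.out]; ring
    · refine setIntegral_congr_fun measurableSet_Ioi fun t ht => ?_
      simp only [abs_neg, abs_of_pos ht.out]; ring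
  have h1 := half_line_poincare hu
  have h2 := half_line_poincare (u := fun t => u (-t)) (K := K) (by
    have := hu.comp (LipschitzWith.id (α := ℝ)).neg
    rwa [mul_one] at this)
  have hd : ∀ t, deriv (fun t => u (-t)) t ^ 2 = deriv u (-t) ^ 2 := fun t => by
    rw [deriv_comp_neg]; ring
  simp only [hd, neg_zero] at h2
  have e2 := split _ hw2
  have e3 := split _ hdL
  nlinarith [sq_nonneg (∫ t, u t ∂laplace - u 0)]

/-- The product of `n` Laplace distributions. -/
def laplacePi (n : ℕ) : Measure (Fin n → ℝ) := Measure.pi fun _ => laplace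

instance (n : ℕ) : IsProbabilityMeasure (laplacePi n) := by unfold laplacePi; infer_instance

lemma memLp_eval_laplacePi {n : ℕ} (i : Fin n) : MemLp (fun x => x i) 2 (laplacePi n) :=
  memLp_id_laplace.comp_measurePreserving
    (measurePreserving_eval (fun _ : Fin n => laplace) i)

lemma memLp_laplacePi_of_lipschitz {n : ℕ} {F : (Fin n → ℝ) → ℝ} {K : NNReal}
    (hF : LipschitzWith K F) : MemLp F 2 (laplacePi n) := by
  have hs : MemLp (fun x : Fin n → ℝ => ∑ i, |x i|) 2 (laplacePi n) :=
    memLp_finsetSum _ fun i _ => (memLp_eval_laplacePi i).abs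
  have h : MemLp (fun x : Fin n → ℝ => |F 0| + K * ∑ i, |x i|) 2 (laplacePi n) :=
    (memLp_const |F 0|).add (hs.const_mul (K : ℝ))
  refine h.mono hF.continuous.aestronglyMeasurable (.of_forall fun x => ?_)
  have := hF.dist_le_mul x 0
  rw [Real.dist_eq, dist_zero_right] at this
  have hx : ‖x‖ ≤ ∑ i, |x i| :=
    (pi_norm_le_iff_of_nonneg (by positivity)).2 fun i =>
      Finset.single_le_sum (f := fun i => |x i|) (fun _ _ => abs_nonneg _) (Finset.mem_univ i)
  rw [Real.norm_eq_abs, Real.norm_eq_abs,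
    abs_of_nonneg (a := |F 0| + K * ∑ i, |x i|) (by positivity)]
  have h2 := abs_add_le (F x - F 0) (F 0)
  rw [sub_add_cancel] at h2
  have h3 : K * ‖x‖ ≤ K * ∑ i, |x i| := by gcongr
  linarith

lemma abs_lineDeriv_le_of_lipschitz {E : Type*} [NormedAddCommGroup E] [NormedSpace ℝ E]
    {F : E → ℝ} {K : NNReal} (hF : LipschitzWith K F) (x v : E) :
    |lineDeriv ℝ F x v| ≤ K * ‖v‖ := norm_lineDeriv_le_of_lipschitz ℝ hF

lemma integrable_lineDeriv_sq {n : ℕ} {F : (Fin n → ℝ) → ℝ} {K : NNReal}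
    (hF : LipschitzWith K F) (v : Fin n → ℝ) :
    Integrable (fun x => lineDeriv ℝ F x v ^ 2) (laplacePi n) := by
  refine Integrable.mono' (integrable_const ((K * ‖v‖ : ℝ) ^ 2))
    ((measurable_lineDeriv hF.continuous).pow_const 2).aestronglyMeasurable (.of_forall fun x => ?_)
  have := abs_lineDeriv_le_of_lipschitz hF x v
  rw [Real.norm_eq_abs, abs_of_nonneg (by positivity)]
  exact sq_le_sq' (abs_le.1 this).1 (abs_le.1 this).2

lemma lipschitzWith_cons_left {n : ℕ} {F : (Fin (n + 1) → ℝ) → ℝ} {K : NNReal}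
    (hF : LipschitzWith K F) (b : Fin n → ℝ) : LipschitzWith K fun a : ℝ => F (Fin.cons a b) := by
  refine LipschitzWith.of_dist_le_mul fun a a' => (hF.dist_le_mul _ _).trans ?_
  gcongr
  refine (dist_pi_le_iff dist_nonneg).2 fun i => ?_
  refine Fin.cases ?_ (fun j => ?_) i <;> simp

lemma lipschitzWith_cons_right {n : ℕ} {F : (Fin (n + 1) → ℝ) → ℝ} {K : NNReal}
    (hF : LipschitzWith K F) (a : ℝ) :
    LipschitzWith K fun b : Fin n → ℝ => F (Fin.cons a b) := by
  refine LipschitzWith.of_dist_le_mul fun b b' => (hF.dist_le_mul _ _).trans ?_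
  gcongr
  refine (dist_pi_le_iff dist_nonneg).2 fun i => ?_
  refine Fin.cases (by simp) (fun j => ?_) i
  simpa using dist_le_pi_dist b b' j

lemma cons_eq_piFinSuccAbove_symm (n : ℕ) :
    (fun z : ℝ × (Fin n → ℝ) => (Fin.cons z.1 z.2 : Fin (n + 1) → ℝ)) =
      (MeasurableEquiv.piFinSuccAbove (fun _ : Fin (n + 1) => ℝ) 0).symm := by
  funext z
  exact (Fin.insertNth_zero' z.1 z.2).symm

lemma measurePreserving_cons (n : ℕ) :
    MeasurePreserving (fun z : ℝ × (Fin n → ℝ) => (Fin.cons z.1 z.2 : Fin (n + 1) → ℝ))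
      (laplace.prod (laplacePi n)) (laplacePi (n + 1)) := by
  rw [cons_eq_piFinSuccAbove_symm]
  exact (measurePreserving_piFinSuccAbove (fun _ : Fin (n + 1) => laplace) 0).symm

/-- The Poincaré inequality for the product Laplace distribution. -/
theorem poincare_laplacePi {n : ℕ} {F : (Fin n → ℝ) → ℝ} {K : NNReal} (hF : LipschitzWith K F) :
    ∫ x, F x ^ 2 ∂laplacePi n - (∫ x, F x ∂laplacePi n) ^ 2 ≤
      4 * ∑ i, ∫ x, lineDeriv ℝ F x (Pi.single i 1) ^ 2 ∂laplacePi n := by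
  induction n with
  | zero =>
    have : ∀ x, F x = F 0 := fun x => congrArg F (Subsingleton.elim _ _)
    simp [this]
  | succ n ih =>
    have mp := measurePreserving_cons n
    set cons : ℝ × (Fin n → ℝ) → (Fin (n + 1) → ℝ) := fun z => Fin.cons z.1 z.2 with hcons
    have me : MeasurableEmbedding cons := by
      rw [hcons, cons_eq_piFinSuccAbove_symm]
      exact (MeasurableEquiv.piFinSuccAbove (fun _ : Fin (n + 1) => ℝ) 0).symm.measurableEmbedding
    have hFL := (memLp_laplacePi_of_lipschitz hF).comp_measurePreserving mp
    have key := variance_prod_le hFL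
    have e0 : ∀ G : (Fin (n + 1) → ℝ) → ℝ, ∫ x, G x ∂laplacePi (n + 1) =
        ∫ z, G (cons z) ∂laplace.prod (laplacePi n) := fun G => (mp.integral_comp me G).symm
    have ld : ∀ i, Integrable (fun z => lineDeriv ℝ F (cons z) (Pi.single i 1) ^ 2)
        (laplace.prod (laplacePi n)) := fun i =>
      mp.integrable_comp_of_integrable (integrable_lineDeriv_sq hF _)
    have d0 : ∀ a b, deriv (fun a => F (Fin.cons a b)) a =
        lineDeriv ℝ F (cons (a, b)) (Pi.single 0 1) := by
      intro a b
      rw [lineDeriv]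
      have : (fun t : ℝ => F (cons (a, b) + t • Pi.single 0 1)) =
          fun t => (fun a => F (Fin.cons a b)) (a + t) := by
        funext t
        congr 1
        funext i
        refine Fin.cases ?_ (fun j => ?_) i <;> simp [hcons]
      rw [this, deriv_comp_const_add (f := fun a => F (Fin.cons a b)), add_zero]
    have ds : ∀ a b i, lineDeriv ℝ (fun b : Fin n → ℝ => F (Fin.cons a b)) b (Pi.single i 1) =
        lineDeriv ℝ F (cons (a, b)) (Pi.single i.succ 1) := by
      intro a b i
      rw [lineDeriv, lineDeriv]
      congr 1
      funext t
      congr 1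
      funext k
      refine Fin.cases ?_ (fun j => ?_) k
      · simp [hcons]
      · simp [hcons, Pi.single_apply, Fin.succ_inj]
    have hb : ∀ a, ∫ b, F (cons (a, b)) ^ 2 ∂laplacePi n - (∫ b, F (cons (a, b)) ∂laplacePi n) ^ 2
        ≤ 4 * ∑ i : Fin n,
          ∫ b, lineDeriv ℝ F (cons (a, b)) (Pi.single i.succ 1) ^ 2 ∂laplacePi n := by
      intro a
      have := ih (lipschitzWith_cons_right hF a)
      simpa only [ds] using this
    have ha : ∀ b, ∫ a, F (cons (a, b)) ^ 2 ∂laplace - (∫ a, F (cons (a, b)) ∂laplace) ^ 2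
        ≤ 4 * ∫ a, lineDeriv ℝ F (cons (a, b)) (Pi.single 0 1) ^ 2 ∂laplace := by
      intro b
      have := poincare_laplace (lipschitzWith_cons_left hF b)
      simpa only [d0] using this
    have sq2 := hFL.integrable_sq
    have ia : Integrable (fun a => ∫ b, F (cons (a, b)) ^ 2 ∂laplacePi n -
        (∫ b, F (cons (a, b)) ∂laplacePi n) ^ 2) laplace :=
      sq2.integral_prod_left.sub (memLp_two_integral_prod hFL).integrable_sq
    have ib : Integrable (fun b => ∫ a, F (cons (a, b)) ^ 2 ∂laplace -
        (∫ a, F (cons (a, b)) ∂laplace) ^ 2) (laplacePi n) :=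
      sq2.integral_prod_right.sub (memLp_two_integral_prod (F := fun z => F (cons z.swap))
        (hFL.comp_measurePreserving Measure.measurePreserving_swap)).integrable_sq
    have i1 := integral_mono ia ((integrable_finsetSum Finset.univ
      fun (i : Fin n) _ => (ld i.succ).integral_prod_left).const_mul 4) hb
    have i2 := integral_mono ib ((ld 0).integral_prod_right.const_mul 4) ha
    rw [integral_const_mul, integral_finsetSum _ fun i _ => (ld _).integral_prod_left] at i1
    rw [integral_const_mul] at i2
    rw [Fin.sum_univ_succ]
    simp only [e0]
    rw [integral_prod_symm _ (ld 0)]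
    simp_rw [fun i : Fin n => integral_prod _ (ld i.succ)]
    refine key.trans ?_
    rw [mul_add, add_comm]
    exact add_le_add i2 i1

lemma integrable_laplaceDensity : Integrable fun x : ℝ => Real.exp (-|x|) / 2 := by
  simpa using (integrable_laplace_iff fun _ => (1 : ℝ)).1 (integrable_const _)

/-- The density of the product Laplace distribution. -/
lemma laplacePi_eq_withDensity (n : ℕ) :
    laplacePi n = volume.withDensity fun x : Fin n → ℝ =>
      ENNReal.ofReal (∏ i, Real.exp (-|x i|) / 2) := by
  refine (Measure.pi_eq fun s hs => ?_)
  have hi : ∀ i, Integrable (fun x : ℝ => Real.exp (-|x|) / 2) (volume.restrict (s i)) := fun i =>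
    integrable_laplaceDensity.integrableOn
  rw [withDensity_apply _ (MeasurableSet.univ_pi hs), volume_pi, Measure.restrict_pi_pi,
    ← ofReal_integral_eq_lintegral_ofReal (Integrable.fintype_prod hi)
      (.of_forall fun x => Finset.prod_nonneg fun _ _ => by positivity),
    integral_fintype_prod_eq_prod (fun _ x => Real.exp (-|x|) / 2),
    ENNReal.ofReal_prod_of_nonneg fun i _ => integral_nonneg fun _ => by positivity]
  refine Finset.prod_congr rfl fun i _ => ?_
  rw [laplace, withDensity_apply _ (hs i),
    ← ofReal_integral_eq_lintegral_ofReal (hi i) (.of_forall fun x => by positivity)]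

lemma laplacePi_absolutelyContinuous (n : ℕ) : laplacePi n ≪ volume := by
  rw [laplacePi_eq_withDensity]
  exact withDensity_absolutelyContinuous _ _

lemma integral_laplacePi (g : Vec d → ℝ) :
    ∫ x, g (WithLp.toLp 2 x) ∂laplacePi d =
      (1 / 2) ^ d * ∫ x : Vec d, g x * Real.exp (-ellNorm 1 x) := by
  rw [laplacePi_eq_withDensity,
    integral_withDensity_eq_integral_toReal_smul (by fun_prop) (by simp),
    ← integral_const_mul, ← (PiLp.volume_preserving_toLp (Fin d)).integral_comp
      (MeasurableEquiv.toLp 2 (Fin d → ℝ)).measurableEmbedding]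
  congr 1; ext x
  rw [ENNReal.toReal_ofReal (Finset.prod_nonneg fun _ _ => by positivity), ellNorm_one,
    Finset.prod_div_distrib, ← Real.exp_sum, smul_eq_mul, Finset.sum_neg_distrib]
  simp
  ring

/-- Under the product Laplace distribution the direction is uniform on the `ℓ_1`-sphere and
independent of the `ℓ_1`-norm, which has a Gamma distribution. -/
lemma integral_laplacePi_polar (hd : 0 < d) {g : Vec d → ℝ} (hg : Measurable g) (m : ℕ) :
    ∫ x, g ((ellNorm 1 (WithLp.toLp 2 x : Vec d))⁻¹ • WithLp.toLp 2 x) *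
        ellNorm 1 (WithLp.toLp 2 x : Vec d) ^ m ∂laplacePi d =
      ((d - 1 + m).factorial / (d - 1).factorial : ℝ) * ∫ s, g s ∂unifL1Sphere d := by
  have key : ∀ {g : Vec d → ℝ} (_ : Measurable g) (m : ℕ),
      ∫ x, g ((ellNorm 1 (WithLp.toLp 2 x : Vec d))⁻¹ • WithLp.toLp 2 x) *
        ellNorm 1 (WithLp.toLp 2 x : Vec d) ^ m ∂laplacePi d =
      (1 / 2) ^ d * (surfL1 d * (∫ s, g s ∂unifL1Sphere d) * (d - 1 + m).factorial) := by
    intro g hg m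
    rw [integral_laplacePi fun x : Vec d => g ((ellNorm 1 x)⁻¹ • x) * ellNorm 1 x ^ m]
    congr 1
    simp only [mul_assoc (g _)]
    rw [integral_polar_l1 hd hg (fun ρ => ρ ^ m * Real.exp (-ρ)), ← integral_pow_mul_exp_neg]
    simp_rw [← mul_assoc, ← pow_add]
  have h1 := key (g := fun _ => 1) measurable_const 0
  have h0 : ((d - 1).factorial : ℝ) ≠ 0 := by positivity
  simp at h1
  rw [key hg, div_mul_eq_mul_div, eq_div_iff h0]
  calc _ = ((2 ^ d)⁻¹ * (surfL1 d * (d - 1).factorial)) *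
      ((d - 1 + m).factorial * ∫ s, g s ∂unifL1Sphere d) := by rw [one_div, inv_pow]; ring
    _ = _ := by rw [← h1, one_mul]

/-- The mean square of a Gamma variable with parameter `d`, such as the `ℓ_1`-norm under the product
Laplace distribution. -/
lemma factorial_ratio (hd : 0 < d) :
    ((d - 1 + 2).factorial : ℝ) / (d - 1).factorial = d * (d + 1) := by
  obtain ⟨n, rfl⟩ := Nat.exists_eq_succ_of_ne_zero hd.ne'
  simp only [Nat.succ_eq_add_one, Nat.add_sub_cancel, Nat.factorial_succ]
  push_cast
  have : (n.factorial : ℝ) ≠ 0 := by positivity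
  field_simp

/-- The mean square of the Euclidean norm on the `ℓ_1`-sphere. -/
lemma integral_norm_sq_unifL1Sphere (hd : 0 < d) :
    ∫ s, ‖s‖ ^ 2 ∂unifL1Sphere d = 2 / (d + 1) := by
  have h := integral_laplacePi_polar hd (g := fun s => ‖s‖ ^ 2) (by fun_prop) 2
  have e : ∀ x : Fin d → ℝ,
      ‖(ellNorm 1 (WithLp.toLp 2 x : Vec d))⁻¹ • (WithLp.toLp 2 x : Vec d)‖ ^ 2 *
      ellNorm 1 (WithLp.toLp 2 x : Vec d) ^ 2 = ∑ i, x i ^ 2 := by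
    intro x
    have hs : ∑ i, x i ^ 2 = ‖(WithLp.toLp 2 x : Vec d)‖ ^ 2 := by
      rw [EuclideanSpace.norm_sq_eq]; simp
    rw [hs]
    generalize (WithLp.toLp 2 x : Vec d) = z
    rcases eq_or_ne (ellNorm 1 z) 0 with h0 | h0
    · rw [(ellNorm_eq_zero le_rfl).1 h0]; simp
    · rw [norm_smul, mul_pow, norm_inv, Real.norm_eq_abs, inv_pow, sq_abs]
      field_simp
  simp_rw [e] at h
  rw [integral_finsetSum _ fun i _ => (memLp_eval_laplacePi i).integrable_sq] at h
  have e2 : ∀ i : Fin d, ∫ x, x i ^ 2 ∂laplacePi d = 2 := fun i => by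
    have mp := measurePreserving_eval (fun _ : Fin d => laplace) i
    rw [← integral_sq_laplace, ← mp.map_eq, integral_map mp.measurable.aemeasurable (by fun_prop)]
    rfl
  have hf := factorial_ratio hd
  simp only [e2, Finset.sum_const, Finset.card_univ, Fintype.card_fin, nsmul_eq_mul, hf] at h
  have : (d : ℝ) ≠ 0 := by positivity
  rw [eq_div_iff (by positivity)]
  apply mul_left_cancel₀ this
  linarith

/-! ### The variance of an odd Lipschitz function on the `ℓ_1`-sphere -/

/-- The positively `1`-homogeneous extension of a function on the `ℓ_1`-sphere; it vanishes at `0`,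
where the direction is a junk value. -/
def homExt (k : Vec d → ℝ) (x : Vec d) : ℝ := k ((ellNorm 1 x)⁻¹ • x) * ellNorm 1 x

lemma ellNorm_one_normalize {x : Vec d} (hx : x ≠ 0) :
    ellNorm 1 ((ellNorm 1 x)⁻¹ • x) = 1 := by
  have h0 : ellNorm 1 x ≠ 0 := fun h => hx ((ellNorm_eq_zero le_rfl).1 h)
  rw [ellNorm_smul le_rfl, abs_inv, abs_of_nonneg (ellNorm_nonneg le_rfl x), inv_mul_cancel₀ h0]

/-- The local Lipschitz bound for the homogeneous extension at a point `s` of the sphere. -/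
def homExtSlope (k : Vec d → ℝ) (M : ℝ) (s : Vec d) : ℝ := √d * |k s| + M * (1 + √d * ‖s‖)

lemma abs_ellNorm_one_sub_le (x y : Vec d) : |ellNorm 1 x - ellNorm 1 y| ≤ √d * ‖x - y‖ := by
  refine le_trans ?_ (ellNorm_one_le_sqrt_mul_norm (x - y))
  rw [abs_le]
  have h1 := ellNorm_add_le le_rfl (x - y) y
  have h2 := ellNorm_add_le le_rfl (y - x) x
  rw [ellNorm_sub_comm le_rfl] at h2
  rw [sub_add_cancel] at h1 h2
  constructor <;> linarith

lemma abs_homExt_sub_le {k : Vec d → ℝ} {M : ℝ} (hM : 0 ≤ M)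
    (hk : ∀ s s', ellNorm 1 s = 1 → ellNorm 1 s' = 1 → |k s - k s'| ≤ M * ‖s - s'‖)
    (hk0 : ∀ s, ellNorm 1 s = 1 → |k s| ≤ M * ‖s‖) {x : Vec d} (hx : x ≠ 0) (y : Vec d) :
    |homExt k y - homExt k x| ≤ homExtSlope k M ((ellNorm 1 x)⁻¹ • x) * ‖y - x‖ := by
  set n := ellNorm 1 x with hn
  set s := n⁻¹ • x with hs
  have hn0 : 0 < n := (ellNorm_nonneg le_rfl x).lt_of_ne'
    fun h => hx ((ellNorm_eq_zero le_rfl).1 h)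
  have hsx : x = n • s := by rw [hs, smul_inv_smul₀ hn0.ne']
  have hs1 : ellNorm 1 s = 1 := ellNorm_one_normalize hx
  have hx' : homExt k x = k s * n := rfl
  rcases eq_or_ne y 0 with rfl | hy
  · have : homExt k 0 = 0 := by rw [homExt, ellNorm_zero le_rfl, mul_zero]
    rw [this, hx', zero_sub, zero_sub, abs_neg, norm_neg, abs_mul, abs_of_pos hn0, homExtSlope]
    have h1 := hk0 s hs1
    have h2 : ‖x‖ = n * ‖s‖ := by
      rw [hsx, norm_smul, Real.norm_eq_abs, abs_of_pos hn0]
    rw [h2]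
    have h3 : 0 ≤ √d * |k s| + M * (√d * ‖s‖) := by positivity
    have h4 : |k s| * n ≤ M * ‖s‖ * n := by gcongr
    nlinarith [mul_nonneg h3 (mul_nonneg hn0.le (norm_nonneg s))]
  · set n' := ellNorm 1 y with hn'
    set s' := n'⁻¹ • y with hs'
    have hn0' : 0 < n' := (ellNorm_nonneg le_rfl y).lt_of_ne'
      fun h => hy ((ellNorm_eq_zero le_rfl).1 h)
    have hsy : y = n' • s' := by rw [hs', smul_inv_smul₀ hn0'.ne']
    have hs1' : ellNorm 1 s' = 1 := ellNorm_one_normalize hy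
    have hy' : homExt k y = k s' * n' := rfl
    have hnn : |n' - n| ≤ √d * ‖y - x‖ := abs_ellNorm_one_sub_le y x
    have e1 : n' • (s' - s) = (y - x) - (n' - n) • s := by
      rw [smul_sub, sub_smul, ← hsy, ← hsx]; abel
    have h1 : n' * ‖s' - s‖ ≤ ‖y - x‖ + |n' - n| * ‖s‖ := by
      have := norm_sub_le (y - x) ((n' - n) • s)
      rwa [← e1, norm_smul, norm_smul, Real.norm_eq_abs, Real.norm_eq_abs, abs_of_pos hn0'] at this
    have h2 : homExt k y - homExt k x = (n' - n) * k s + n' * (k s' - k s) := by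
      rw [hx', hy']; ring
    rw [h2, homExtSlope]
    calc |(n' - n) * k s + n' * (k s' - k s)|
        ≤ |n' - n| * |k s| + n' * |k s' - k s| := by
          refine (abs_add_le _ _).trans ?_
          rw [abs_mul, abs_mul, abs_of_pos hn0']
      _ ≤ |n' - n| * |k s| + n' * (M * ‖s' - s‖) := by
          gcongr; exact hk s' s hs1' hs1
      _ = |n' - n| * |k s| + M * (n' * ‖s' - s‖) := by ring
      _ ≤ |n' - n| * |k s| + M * (‖y - x‖ + |n' - n| * ‖s‖) := by gcongr
      _ ≤ (√d * ‖y - x‖) * |k s| + M * (‖y - x‖ + (√d * ‖y - x‖) * ‖s‖) := by gcongr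
      _ = _ := by ring

lemma homExtSlope_nonneg (k : Vec d → ℝ) {M : ℝ} (hM : 0 ≤ M) (s : Vec d) :
    0 ≤ homExtSlope k M s := by unfold homExtSlope; positivity

lemma lipschitzWith_homExt {k : Vec d → ℝ} {M : ℝ} (hM : 0 ≤ M)
    (hk : ∀ s s', ellNorm 1 s = 1 → ellNorm 1 s' = 1 → |k s - k s'| ≤ M * ‖s - s'‖)
    (hk0 : ∀ s, ellNorm 1 s = 1 → |k s| ≤ M * ‖s‖) :
    LipschitzWith (Real.toNNReal (M * (1 + 2 * √d))) (homExt k) := by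
  have main : ∀ x y : Vec d, x ≠ 0 →
      |homExt k y - homExt k x| ≤ M * (1 + 2 * √d) * ‖y - x‖ := by
    intro x y hx
    refine (abs_homExt_sub_le hM hk hk0 hx y).trans ?_
    gcongr
    have hs1 := ellNorm_one_normalize hx
    have h1 : ‖(ellNorm 1 x)⁻¹ • x‖ ≤ 1 := hs1 ▸ norm_le_ellNorm_one _
    have h2 : |k ((ellNorm 1 x)⁻¹ • x)| ≤ M * 1 := (hk0 _ hs1).trans (by gcongr)
    rw [homExtSlope]
    calc _ ≤ √d * (M * 1) + M * (1 + √d * 1) := by gcongr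
      _ = _ := by ring
  refine LipschitzWith.of_dist_le_mul fun x y => ?_
  rw [Real.coe_toNNReal _ (by positivity), Real.dist_eq, dist_eq_norm]
  rcases eq_or_ne y 0 with rfl | hy
  · rcases eq_or_ne x 0 with rfl | hx
    · simp
    · rw [abs_sub_comm, norm_sub_rev]; exact main x 0 hx
  · exact main y x hy

/-- At a point of differentiability, the Euclidean norm of the gradient is bounded by any local
Lipschitz constant. -/
lemma sum_lineDeriv_sq_le {F : Vec d → ℝ} {x : Fin d → ℝ}
    (hF : DifferentiableAt ℝ (fun x : Fin d → ℝ => F (WithLp.toLp 2 x)) x) {K : ℝ} (hK : 0 ≤ K)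
    (hl : ∀ y, |F y - F (WithLp.toLp 2 x)| ≤ K * ‖y - WithLp.toLp 2 x‖) :
    ∑ i, lineDeriv ℝ (fun x : Fin d → ℝ => F (WithLp.toLp 2 x)) x (Pi.single i 1) ^ 2 ≤ K ^ 2 := by
  set F' := fderiv ℝ (fun x : Fin d → ℝ => F (WithLp.toLp 2 x)) x with hF'
  set v : Fin d → ℝ := fun i => F' (Pi.single i 1) with hv
  have hld : ∀ w, lineDeriv ℝ (fun x : Fin d → ℝ => F (WithLp.toLp 2 x)) x w = F' w := fun w =>
    hF.lineDeriv_eq_fderiv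
  have hFv : F' v = ∑ i, v i ^ 2 := by
    conv_lhs => rw [← Finset.univ_sum_single v]
    rw [map_sum]
    refine Finset.sum_congr rfl fun i _ => ?_
    have : (Pi.single i (v i) : Fin d → ℝ) = v i • Pi.single i 1 := by
      rw [← Pi.single_smul, smul_eq_mul, mul_one]
    rw [this, map_smul, smul_eq_mul, sq]
  have hnv : ‖(WithLp.toLp 2 v : Vec d)‖ ^ 2 = ∑ i, v i ^ 2 := by
    rw [EuclideanSpace.norm_sq_eq]; simp
  have hb : |F' v| ≤ K * ‖(WithLp.toLp 2 v : Vec d)‖ := by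
    have ht := (hF.hasFDerivAt.hasLineDerivAt v).tendsto_slope_zero
    refine le_of_tendsto ht.abs (.of_forall fun t => ?_)
    rw [smul_eq_mul, abs_mul]
    have h1 := hl (WithLp.toLp 2 (x + t • v))
    have h2 : (WithLp.toLp 2 (x + t • v) : Vec d) - WithLp.toLp 2 x = t • WithLp.toLp 2 v := by
      ext i; simp
    rw [h2, norm_smul, Real.norm_eq_abs] at h1
    rcases eq_or_ne t 0 with rfl | h0
    · simp; positivity
    · rw [abs_inv, inv_mul_le_iff₀ (abs_pos.2 h0)]
      simpa using h1.trans_eq (by ring)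
  simp_rw [hld]
  change ∑ i, v i ^ 2 ≤ K ^ 2
  set N := ‖(WithLp.toLp 2 v : Vec d)‖ with hN
  rw [← hnv]
  rw [hFv, ← hnv, abs_of_nonneg (by positivity)] at hb
  have hN0 : 0 ≤ N := norm_nonneg _
  have : N ≤ K := by
    by_contra! h
    nlinarith
  gcongr

lemma integrable_of_bound_on_sphere (hd : 0 < d) {g : Vec d → ℝ} (hg : Measurable g) {C : ℝ}
    (h : ∀ s, ellNorm 1 s = 1 → |g s| ≤ C) : Integrable g (unifL1Sphere d) := by
  refine Integrable.mono' (integrable_const C) hg.aestronglyMeasurable ?_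
  filter_upwards [ae_ellNorm_one_eq_one hd] with s hs using h s hs

/-- An odd function on the `ℓ_1`-sphere that is `M`-Lipschitz for the Euclidean norm has variance
of order `M² / d²`. This follows from the Poincaré inequality for the homogeneous extension `F`
under the product Laplace distribution. With `V` the variance, the mean square of `F` is
`d (d + 1) V`, while that of its gradient is at most `2 d V + 12 M²`; the first of these two terms
comes from the radial variable and is absorbed in the left-hand side as soon as `d ≥ 8`. In smaller
dimensions `V ≤ M²` is enough. -/
theorem integral_sq_odd_le (hd : 0 < d) {k : Vec d → ℝ} (hkm : Measurable k) {M : ℝ} (hM : 0 ≤ M)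
    (hodd : ∀ s, k (-s) = - k s)
    (hk : ∀ s s', ellNorm 1 s = 1 → ellNorm 1 s' = 1 → |k s - k s'| ≤ M * ‖s - s'‖) :
    ∫ s, k s ^ 2 ∂unifL1Sphere d ≤ 384 * M ^ 2 / d ^ 2 := by
  have hk0 : ∀ s, ellNorm 1 s = 1 → |k s| ≤ M * ‖s‖ := by
    intro s hs
    have h := hk s (-s) hs (by rw [ellNorm_neg le_rfl, hs])
    have e : s - -s = (2 : ℝ) • s := by rw [two_smul]; abel
    rw [hodd, e, norm_smul, sub_neg_eq_add, ← two_mul, abs_mul] at h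
    norm_num at h
    linarith
  have hk1 : ∀ s, ellNorm 1 s = 1 → k s ^ 2 ≤ M ^ 2 := by
    intro s hs
    have h1 : ‖s‖ ≤ 1 := hs ▸ norm_le_ellNorm_one s
    have h2 : |k s| ≤ M := (hk0 s hs).trans (mul_le_of_le_one_right hM h1)
    exact sq_le_sq' (abs_le.1 h2).1 (abs_le.1 h2).2
  have ik2 : Integrable (fun s => k s ^ 2) (unifL1Sphere d) :=
    integrable_of_bound_on_sphere hd (by fun_prop) (C := M ^ 2) fun s hs => by
      rw [abs_of_nonneg (sq_nonneg _)]; exact hk1 s hs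
  have in2 : Integrable (fun s : Vec d => ‖s‖ ^ 2) (unifL1Sphere d) :=
    integrable_of_bound_on_sphere hd (by fun_prop) (C := 1) fun s hs => by
      rw [abs_of_nonneg (sq_nonneg _)]
      exact pow_le_one₀ (norm_nonneg _) (hs ▸ norm_le_ellNorm_one s)
  set V := ∫ s, k s ^ 2 ∂unifL1Sphere d with hV
  have hV0 : 0 ≤ V := integral_nonneg fun _ => sq_nonneg _
  have hVM : V ≤ M ^ 2 := by
    calc V ≤ ∫ _, M ^ 2 ∂unifL1Sphere d := by
          refine integral_mono_ae ik2 (integrable_const _) ?_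
          filter_upwards [ae_ellNorm_one_eq_one hd] with s hs using hk1 s hs
      _ = M ^ 2 := by simp
  have hd0 : (0 : ℝ) < d := by exact_mod_cast hd
  have hslope : ∫ s, homExtSlope k M s ^ 2 ∂unifL1Sphere d ≤ 2 * d * V + 12 * M ^ 2 := by
    calc ∫ s, homExtSlope k M s ^ 2 ∂unifL1Sphere d
        ≤ ∫ s, (2 * d * k s ^ 2 + (4 * M ^ 2 + 4 * M ^ 2 * d * ‖s‖ ^ 2)) ∂unifL1Sphere d := by
          refine integral_mono_of_nonneg (.of_forall fun _ => sq_nonneg _)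
            ((ik2.const_mul _).add ((integrable_const _).add (in2.const_mul _)))
            (.of_forall fun s => ?_)
          simp only [homExtSlope]
          have e1 : (√d * |k s|) ^ 2 = d * k s ^ 2 := by
            rw [mul_pow, Real.sq_sqrt hd0.le, sq_abs]
          have e2 : (√d * ‖s‖) ^ 2 = d * ‖s‖ ^ 2 := by rw [mul_pow, Real.sq_sqrt hd0.le]
          have e3 : (1 + √d * ‖s‖) ^ 2 ≤ 2 + 2 * (d * ‖s‖ ^ 2) := by
            rw [← e2]; nlinarith [sq_nonneg (1 - √d * ‖s‖)]
          have e4 := mul_le_mul_of_nonneg_left e3 (sq_nonneg M)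
          nlinarith [sq_nonneg (√d * |k s| - M * (1 + √d * ‖s‖))]
      _ = 2 * d * V + (4 * M ^ 2 + 4 * M ^ 2 * d * (2 / (d + 1))) := by
          rw [integral_add (g := fun s : Vec d => 4 * M ^ 2 + 4 * M ^ 2 * d * ‖s‖ ^ 2)
              (ik2.const_mul _) ((integrable_const _).add (in2.const_mul _)),
            integral_add (integrable_const _) (in2.const_mul _), integral_const,
            integral_const_mul (2 * (d : ℝ)), integral_const_mul (4 * M ^ 2 * (d : ℝ)),
            integral_norm_sq_unifL1Sphere hd]
          simp [hV]
      _ ≤ _ := by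
          have : (d : ℝ) * (2 / (d + 1)) ≤ 2 := by
            rw [mul_div_assoc', div_le_iff₀ (by positivity)]; linarith
          nlinarith [mul_le_mul_of_nonneg_left this (sq_nonneg M)]
  have hL := lipschitzWith_homExt hM hk hk0
  set F : (Fin d → ℝ) → ℝ := fun x => homExt k (WithLp.toLp 2 x) with hF
  obtain ⟨K, hFL⟩ : ∃ K, LipschitzWith K F :=
    ⟨_, hL.comp (PiLp.lipschitzWith_toLp 2 (fun _ : Fin d => ℝ))⟩
  have hP := poincare_laplacePi hFL
  have e1 : ∫ x, F x ∂laplacePi d = 0 := by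
    have := integral_laplacePi_polar hd hkm 1
    simp only [pow_one] at this
    have hz : ∫ s, k s ∂unifL1Sphere d = 0 := by
      have h := integral_neg_unifL1Sphere k
      simp_rw [hodd] at h
      rw [integral_neg] at h
      linarith
    rw [hF]
    simp only [homExt]
    rw [this, hz, mul_zero]
  have hf := factorial_ratio hd
  have e2 : ∫ x, F x ^ 2 ∂laplacePi d = d * (d + 1) * V := by
    have := integral_laplacePi_polar hd (g := fun s => k s ^ 2) (by fun_prop) 2
    rw [hf] at this
    rw [← this, hF]
    simp only [homExt, mul_pow]
  have e3 : ∑ i, ∫ x, lineDeriv ℝ F x (Pi.single i 1) ^ 2 ∂laplacePi d ≤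
      ∫ s, homExtSlope k M s ^ 2 ∂unifL1Sphere d := by
    have hsm : Measurable fun s => homExtSlope k M s ^ 2 := by
      unfold homExtSlope
      exact ((hkm.abs.const_mul _).add (by fun_prop)).pow_const 2
    have h := integral_laplacePi_polar hd hsm 0
    have h0 : ((d - 1).factorial : ℝ) ≠ 0 := by positivity
    simp only [pow_zero, mul_one, add_zero, div_self h0, one_mul] at h
    rw [← integral_finsetSum _ fun i _ => integrable_lineDeriv_sq hFL _, ← h]
    have hn : ∀ᵐ x : Fin d → ℝ ∂laplacePi d, x ≠ 0 := by
      have : Nonempty (Fin d) := ⟨⟨0, hd⟩⟩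
      exact (laplacePi_absolutelyContinuous d).ae_le
        (compl_mem_ae_iff.2 (measure_singleton (0 : Fin d → ℝ)))
    have hbd : ∀ x : Fin d → ℝ, x ≠ 0 →
        (WithLp.toLp 2 x : Vec d) ≠ 0 := fun x hx h => hx (by
      have := congrArg WithLp.ofLp h; simpa using this)
    refine integral_mono_ae (integrable_finsetSum _ fun i _ => integrable_lineDeriv_sq hFL _) ?_ ?_
    · refine Integrable.mono' (integrable_const ((M * (1 + 2 * √d)) ^ 2))
        (hsm.comp (measurable_l1Normalize.comp (by fun_prop))).aestronglyMeasurable ?_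
      filter_upwards [hn] with x hx
      rw [Real.norm_eq_abs, abs_of_nonneg (sq_nonneg _)]
      refine pow_le_pow_left₀ (homExtSlope_nonneg k hM _) ?_ 2
      have hs1 := ellNorm_one_normalize (hbd x hx)
      set s := (ellNorm 1 (WithLp.toLp 2 x : Vec d))⁻¹ • (WithLp.toLp 2 x : Vec d)
      have h1 : ‖s‖ ≤ 1 := hs1 ▸ norm_le_ellNorm_one _
      have h2 : |k s| ≤ M * 1 := (hk0 _ hs1).trans (by gcongr)
      rw [homExtSlope]
      calc _ ≤ √d * (M * 1) + M * (1 + √d * 1) := by gcongr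
        _ = _ := by ring
    · filter_upwards [hn, (laplacePi_absolutelyContinuous d).ae_le hFL.ae_differentiableAt]
        with x hx hdx
      exact sum_lineDeriv_sq_le hdx (homExtSlope_nonneg k hM _)
        fun y => abs_homExt_sub_le hM hk hk0 (hbd x hx) y
  rw [e1, e2] at hP
  have hfin : (d : ℝ) * (d + 1) * V ≤ 8 * d * V + 48 * M ^ 2 := by
    calc _ ≤ 4 * (2 * d * V + 12 * M ^ 2) := by linarith
      _ = _ := by ring
  rw [le_div_iff₀ (by positivity)]
  rcases le_or_gt d 7 with h7 | h8
  · have : (d : ℝ) ≤ 7 := by exact_mod_cast h7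
    calc V * d ^ 2 ≤ M ^ 2 * 7 ^ 2 := by gcongr
      _ ≤ _ := by nlinarith [sq_nonneg M]
  · -- `d (d - 7) V ≤ 48 M ^ 2` and `d ≤ 8 (d - 7)`
    have : (8 : ℝ) ≤ d := by exact_mod_cast h8
    nlinarith [mul_nonneg (mul_nonneg hV0 hd0.le) (sub_nonneg.2 this)]

/-! ### The gradient estimator and the smoothed loss -/

/-- A Lipschitz kernel on the `ℓ_1`-ball, close to the indicator of the ball for large `m`. -/
def ballKernel (m : ℕ) (x : Vec d) : ℝ := max 0 (1 - ellNorm 1 x ^ (m + 1))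

lemma ballKernel_nonneg (m : ℕ) (x : Vec d) : 0 ≤ ballKernel m x := le_max_left _ _

lemma ballKernel_of_one_le {m : ℕ} {x : Vec d} (h : 1 ≤ ellNorm 1 x) : ballKernel m x = 0 :=
  max_eq_left (by have := one_le_pow₀ h (n := m + 1); linarith)

lemma ballKernel_of_le_one {m : ℕ} {x : Vec d} (h : ellNorm 1 x ≤ 1) :
    ballKernel m x = 1 - ellNorm 1 x ^ (m + 1) :=
  max_eq_right (by have := pow_le_one₀ (ellNorm_nonneg le_rfl x) h (n := m + 1); linarith)

lemma continuous_ballKernel (m : ℕ) : Continuous (ballKernel (d := d) m) := by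
  have := continuous_ellNorm (d := d) (p := 1) le_rfl
  unfold ballKernel
  fun_prop

lemma isCompact_ellNorm_one_le (C : ℝ) : IsCompact {x : Vec d | ellNorm 1 x ≤ C} := by
  refine Metric.isCompact_of_isClosed_isBounded
    (isClosed_le (continuous_ellNorm le_rfl) continuous_const) ?_
  refine (Metric.isBounded_closedBall (x := (0 : Vec d)) (r := C)).subset fun x hx => ?_
  rw [mem_closedBall_zero_iff]
  exact (norm_le_ellNorm_one x).trans hx

lemma hasCompactSupport_ballKernel (m : ℕ) : HasCompactSupport (ballKernel (d := d) m) := by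
  refine HasCompactSupport.intro (isCompact_ellNorm_one_le 1) fun x hx => ?_
  exact ballKernel_of_one_le (not_le.1 hx).le

lemma abs_ballKernel_sub_le (m : ℕ) (x y : Vec d) :
    |ballKernel m x - ballKernel m y| ≤ (m + 1) * ellNorm 1 (x - y) := by
  have hform : ∀ x : Vec d, ballKernel m x = 1 - min (ellNorm 1 x) 1 ^ (m + 1) := by
    intro x
    rcases le_total (ellNorm 1 x) 1 with h | h
    · rw [ballKernel_of_le_one h, min_eq_left h]
    · rw [ballKernel_of_one_le h, min_eq_right h]; simp
  have hN : |min (ellNorm 1 x) 1 - min (ellNorm 1 y) 1| ≤ ellNorm 1 (x - y) := by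
    refine (abs_min_sub_min_le_max _ _ _ _).trans ?_
    rw [sub_self, abs_zero, max_eq_left (abs_nonneg _)]
    rw [abs_le]
    have h1 := ellNorm_add_le le_rfl (x - y) y
    have h2 := ellNorm_add_le le_rfl (y - x) x
    rw [ellNorm_sub_comm le_rfl] at h2
    rw [sub_add_cancel] at h1 h2
    constructor <;> linarith
  have hr : ∀ x : Vec d, |min (ellNorm 1 x) 1| ≤ 1 := fun x => by
    rw [abs_of_nonneg (le_min (ellNorm_nonneg le_rfl x) zero_le_one)]
    exact min_le_right _ _
  rw [hform, hform]
  have e : 1 - min (ellNorm 1 x) 1 ^ (m + 1) - (1 - min (ellNorm 1 y) 1 ^ (m + 1)) =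
    -(min (ellNorm 1 x) 1 ^ (m + 1) - min (ellNorm 1 y) 1 ^ (m + 1)) := by ring
  rw [e, abs_neg]
  refine (abs_pow_sub_pow_le _ _ _).trans ?_
  have h3 : max |min (ellNorm 1 x) 1| |min (ellNorm 1 y) 1| ^ (m + 1 - 1) ≤ 1 :=
    pow_le_one₀ (le_max_of_le_left (abs_nonneg _)) (max_le (hr x) (hr y))
  have h4 := ellNorm_nonneg le_rfl (x - y)
  calc _ ≤ ellNorm 1 (x - y) * ((m + 1 : ℕ) : ℝ) * 1 := by gcongr
    _ = _ := by push_cast; ring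

lemma hasDerivAt_ellNorm_one_line {x : Vec d} (hx : ∀ i, x i ≠ 0) (w : Vec d) :
    HasDerivAt (fun t : ℝ => ellNorm 1 (x - t • w)) (-inner ℝ (signVec x) w) 0 := by
  simp_rw [ellNorm_one, inner_eq_sum, ← Finset.sum_neg_distrib]
  refine HasDerivAt.fun_sum fun i _ => ?_
  have h1 : HasDerivAt (fun t : ℝ => x i - t * w i) (-w i) 0 := by
    simpa using ((hasDerivAt_id (0 : ℝ)).mul_const (w i)).const_sub (x i)
  have h2 : x i - 0 * w i ≠ 0 := by simpa using hx i
  have h3 := (hasDerivAt_abs h2).comp 0 h1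
  have e : -(signVec x i * w i) = (SignType.sign (x i - 0 * w i) : ℝ) * -w i := by
    simp only [zero_mul, sub_zero, signVec]
    rcases lt_or_gt_of_ne (hx i) with h | h
    · rw [if_neg (not_le.2 h), sign_neg h]; simp
    · rw [if_pos h.le, sign_pos h]; simp
  rw [e]
  exact h3

lemma hasDerivAt_ballKernel_line (m : ℕ) {x : Vec d} (hx : ∀ i, x i ≠ 0) (h1 : ellNorm 1 x ≠ 1)
    (w : Vec d) :
    HasDerivAt (fun t : ℝ => ballKernel m (x - t • w))
      ((ellBall d 1).indicator (fun x => (m + 1) * ellNorm 1 x ^ m * inner ℝ (signVec x) w) x)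
      0 := by
  have hN := hasDerivAt_ellNorm_one_line hx w
  have h0 : ellNorm 1 (x - (0 : ℝ) • w) = ellNorm 1 x := by rw [zero_smul, sub_zero]
  rcases lt_or_gt_of_ne h1 with h | h
  · rw [Set.indicator_of_mem (show x ∈ ellBall d 1 from h)]
    have hev : (fun t : ℝ => ballKernel m (x - t • w)) =ᶠ[nhds 0]
        fun t => 1 - ellNorm 1 (x - t • w) ^ (m + 1) := by
      have : ∀ᶠ t in nhds (0 : ℝ), ellNorm 1 (x - t • w) < 1 :=
        hN.continuousAt.eventually_lt continuousAt_const (by simpa only [h0] using h)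
      filter_upwards [this] with t ht using ballKernel_of_le_one ht.le
    refine HasDerivAt.congr_of_eventuallyEq ?_ hev
    have h3 := (hN.fun_pow (m + 1)).const_sub 1
    rw [h0] at h3
    convert h3 using 1
    push_cast; simp
  · rw [Set.indicator_of_notMem (show x ∉ ellBall d 1 from not_lt.2 h.le)]
    have hev : (fun t : ℝ => ballKernel m (x - t • w)) =ᶠ[nhds 0] fun t => 0 := by
      have : ∀ᶠ t in nhds (0 : ℝ), 1 < ellNorm 1 (x - t • w) :=
        continuousAt_const.eventually_lt hN.continuousAt (by simpa only [h0] using h)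
      filter_upwards [this] with t ht using ballKernel_of_one_le ht.le
    exact (hasDerivAt_const _ _).congr_of_eventuallyEq hev

lemma ae_forall_apply_ne_zero : ∀ᵐ x : Vec d, ∀ i, x i ≠ 0 := by
  rw [ae_all_iff]
  intro i
  have h : ∀ᵐ x : Fin d → ℝ, x i ≠ 0 :=
    Measure.ae_eval_ne (μ := fun _ : Fin d => (volume : Measure ℝ)) i 0
  exact (PiLp.volume_preserving_ofLp (Fin d)).quasiMeasurePreserving.ae h

lemma ae_ellNorm_one_ne_one (hd : 0 < d) : ∀ᵐ x : Vec d, ellNorm 1 x ≠ 1 := by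
  have : Nonempty (Fin d) := ⟨⟨0, hd⟩⟩
  have : Nontrivial (PiLp 1 (fun _ : Fin d => ℝ)) :=
    (WithLp.equiv 1 (Fin d → ℝ)).nontrivial
  have h : ∀ᵐ z ∂volL1 d, ‖z‖ ≠ 1 := by
    have := Measure.addHaar_sphere (volL1 d) 0 1
    filter_upwards [compl_mem_ae_iff.2 this] with z hz
    simpa using hz
  rw [volL1, measurableEmbedding_euclidEquivL1.ae_map_iff] at h
  exact h

/-- The derivative of the smoothed loss in the direction `v - y` is at most its increment from `y`
to `v`. The derivative falls on the kernel, so that the loss need not be differentiated. -/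
lemma integral_ballKernel_deriv_le (hd : 0 < d) {f : Vec d → ℝ} (hf : ConvexOn ℝ Set.univ f)
    (hfc : Continuous f) {μ : ℝ} (hμ : 0 < μ) (y v : Vec d) (m : ℕ) :
    1 / μ * ∫ x in ellBall d 1,
        f (y + μ • x) * ((m + 1) * ellNorm 1 x ^ m * inner ℝ (signVec x) (v - y)) ≤
      ∫ x, ballKernel m x * (f (v + μ • x) - f (y + μ • x)) := by
  set w := v - y with hw
  set w' := μ⁻¹ • w with hw'
  have hK := continuous_ballKernel (d := d) m
  have hKc := hasCompactSupport_ballKernel (d := d) m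
  have hfy : Continuous fun x => f (y + μ • x) := by fun_prop
  have int1 : ∀ z : Vec d, Integrable fun x => ballKernel m x * f (z + μ • x) := fun z =>
    (hK.mul (by fun_prop)).integrable_of_hasCompactSupport hKc.mul_right
  -- the difference quotients
  set Q : ℝ → Vec d → ℝ := fun τ x =>
    f (y + μ • x) * (τ⁻¹ * (ballKernel m (x - τ • w') - ballKernel m x)) with hQ
  have hQle : ∀ τ : ℝ, 0 < τ → τ ≤ 1 →
      ∫ x, Q τ x ≤ ∫ x, ballKernel m x * (f (v + μ • x) - f (y + μ • x)) := by
    intro τ h0 h1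
    have shift : ∫ x, ballKernel m (x - τ • w') * f (y + μ • x) =
        ∫ x, ballKernel m x * f ((y + τ • w) + μ • x) := by
      rw [← integral_sub_right_eq_self (fun x => ballKernel m x * f ((y + τ • w) + μ • x))
        (τ • w')]
      congr 1; ext x
      congr 2
      have : μ • τ • w' = τ • w := by rw [smul_comm, hw', smul_inv_smul₀ hμ.ne']
      rw [smul_sub μ x, this]
      abel
    have intS : Integrable fun x => ballKernel m (x - τ • w') * f (y + μ • x) := by
      refine ((hK.comp (by fun_prop : Continuous fun x => x - τ • w')).mul
        hfy).integrable_of_hasCompactSupport (HasCompactSupport.mul_right ?_)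
      exact hKc.comp_homeomorph (Homeomorph.subRight (τ • w'))
    have e : ∀ x, Q τ x = τ⁻¹ * (ballKernel m (x - τ • w') * f (y + μ • x)
        - ballKernel m x * f (y + μ • x)) := fun x => by simp only [hQ]; ring
    simp_rw [e]
    rw [integral_const_mul, integral_sub intS (int1 y), shift, ← integral_sub (int1 _) (int1 y),
      ← integral_const_mul]
    refine integral_mono (((int1 _).sub (int1 _)).const_mul _)
      (by simp only [mul_sub]; exact (int1 v).sub (int1 y)) fun x => ?_
    simp only
    rw [← mul_sub, ← mul_assoc, mul_comm τ⁻¹, mul_assoc]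
    refine mul_le_mul_of_nonneg_left ?_ (ballKernel_nonneg m x)
    rw [inv_mul_le_iff₀ h0]
    have hconv := hf.2 (Set.mem_univ (y + μ • x)) (Set.mem_univ (v + μ • x))
      (sub_nonneg.2 h1) h0.le (sub_add_cancel 1 τ)
    have ep : (1 - τ) • (y + μ • x) + τ • (v + μ • x) = y + τ • w + μ • x := by
      rw [hw]; module
    rw [ep, smul_eq_mul, smul_eq_mul] at hconv
    linarith
  have hlim : Filter.Tendsto (fun τ => ∫ x, Q τ x) (nhdsWithin 0 (Set.Ioi 0))
      (nhds (∫ x, f (y + μ • x) * (ellBall d 1).indicator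
        (fun x => (m + 1) * ellNorm 1 x ^ m * inner ℝ (signVec x) w') x)) := by
    set W := ellNorm 1 w' with hW
    have hW0 : 0 ≤ W := ellNorm_nonneg le_rfl _
    have hcomp := isCompact_ellNorm_one_le (d := d) (1 + W)
    refine tendsto_integral_filter_of_dominated_convergence
      ({x : Vec d | ellNorm 1 x ≤ 1 + W}.indicator fun x => |f (y + μ • x)| * ((m + 1) * W))
      ?_ ?_ ?_ ?_
    · refine .of_forall fun τ => Continuous.aestronglyMeasurable ?_
      exact hfy.mul (continuous_const.mul ((hK.comp (by fun_prop)).sub hK))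
    · filter_upwards [Ioc_mem_nhdsGT zero_lt_one] with τ hτ
      refine .of_forall fun x => ?_
      have hdiff : ellNorm 1 (x - (x - τ • w')) = τ * W := by
        rw [sub_sub_cancel, ellNorm_smul le_rfl, abs_of_pos hτ.1]
      rw [Real.norm_eq_abs, hQ, abs_mul]
      by_cases hx : ellNorm 1 x ≤ 1 + W
      · rw [Set.indicator_of_mem (by exact hx)]
        refine mul_le_mul_of_nonneg_left ?_ (abs_nonneg _)
        rw [abs_mul, abs_of_pos (inv_pos.2 hτ.1), inv_mul_le_iff₀ hτ.1, abs_sub_comm]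
        have := abs_ballKernel_sub_le m x (x - τ • w')
        rw [hdiff] at this
        exact this.trans_eq (by ring)
      · rw [Set.indicator_of_notMem (by exact hx)]
        have h1 : 1 ≤ ellNorm 1 x := by linarith
        have h2 : 1 ≤ ellNorm 1 (x - τ • w') := by
          have h3 := ellNorm_add_le le_rfl (x - τ • w') (x - (x - τ • w'))
          rw [hdiff, add_sub_cancel] at h3
          have : τ * W ≤ 1 * W := by gcongr; exact hτ.2
          linarith
        rw [ballKernel_of_one_le h1, ballKernel_of_one_le h2]
        simp
    · rw [integrable_indicator_iff hcomp.measurableSet]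
      exact ContinuousOn.integrableOn_compact hcomp (by fun_prop)
    · filter_upwards [ae_forall_apply_ne_zero, ae_ellNorm_one_ne_one hd] with x hx h1
      have h := (hasDerivAt_ballKernel_line m hx h1 w').tendsto_slope_zero_right
      simp only [zero_add, zero_smul, sub_zero, smul_eq_mul] at h
      exact h.const_mul _
  have hle := le_of_tendsto hlim (by
    filter_upwards [Ioc_mem_nhdsGT zero_lt_one] with τ hτ using hQle τ hτ.1 hτ.2)
  refine le_of_eq_of_le ?_ hle
  rw [← integral_indicator measurableSet_ellBall_one, ← integral_const_mul]
  congr 1; ext x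
  by_cases hx : x ∈ ellBall d 1
  · rw [Set.indicator_of_mem hx, Set.indicator_of_mem hx, hw', inner_smul_right]
    field_simp
  · rw [Set.indicator_of_notMem hx, Set.indicator_of_notMem hx]; simp

lemma signVec_l1Normalize (x : Vec d) : signVec ((ellNorm 1 x)⁻¹ • x) = signVec x := by
  rcases (ellNorm_nonneg le_rfl x).eq_or_lt with h | h
  · rw [(ellNorm_eq_zero le_rfl).1 h.symm, smul_zero]
  · ext i
    simp [signVec, mul_nonneg_iff_of_pos_left (inv_pos.2 h)]

open Set in
/-- Polar coordinates on the `ℓ_1`-ball with a power weight. -/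
lemma integral_ball_polar_pow (hd : 0 < d) {g : Vec d → ℝ} (hg : Measurable g) (m : ℕ) :
    ∫ x in ellBall d 1, g ((ellNorm 1 x)⁻¹ • x) * ellNorm 1 x ^ m =
      surfL1 d * (∫ s, g s ∂unifL1Sphere d) * (1 / (d + m)) := by
  have h := integral_polar_l1 hd hg ((Iio 1).indicator fun ρ => ρ ^ m)
  have h3 : ∫ ρ in Ioi (0 : ℝ), ρ ^ (d - 1) * (Iio (1 : ℝ)).indicator (fun ρ => ρ ^ m) ρ =
      1 / (d + m) := by
    have : ∀ ρ : ℝ, ρ ^ (d - 1) * (Iio (1 : ℝ)).indicator (fun ρ => ρ ^ m) ρ =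
        (Iio (1 : ℝ)).indicator (fun ρ => ρ ^ (d - 1 + m)) ρ := by
      intro ρ
      by_cases h : ρ < 1 <;> simp [h, pow_add]
    simp_rw [this]
    rw [setIntegral_indicator measurableSet_Iio, Ioi_inter_Iio, ← integral_Ioc_eq_integral_Ioo,
      ← intervalIntegral.integral_of_le zero_le_one, integral_pow]
    push_cast
    rw [Nat.cast_pred hd]
    simp
    ring
  rw [h3] at h
  rw [← h, ← integral_indicator measurableSet_ellBall_one]
  congr 1; ext x
  by_cases hx : ellNorm 1 x < 1 <;> simp [ellBall, indicator, hx]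

lemma integral_ball_pow (hd : 0 < d) (m : ℕ) :
    ∫ x in ellBall d 1, ellNorm 1 x ^ m = surfL1 d * (1 / (d + m)) := by
  simpa using integral_ball_polar_pow hd (g := fun _ => 1) measurable_const m

lemma integrableOn_ellBall {g : Vec d → ℝ} (hg : Measurable g) {C : ℝ}
    (hC : ∀ x, ellNorm 1 x ≤ 1 → |g x| ≤ C) : IntegrableOn g (ellBall d 1) := by
  have : IsFiniteMeasure (volume.restrict (ellBall d 1)) :=
    ⟨by rw [Measure.restrict_apply_univ]; exact volume_ellBall_one_ne_top.lt_top⟩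
  refine Integrable.mono' (integrable_const C) hg.aestronglyMeasurable ?_
  filter_upwards [ae_restrict_mem measurableSet_ellBall_one] with x hx using hC x (le_of_lt hx)

lemma integrableOn_ball_pow (m : ℕ) : IntegrableOn (fun x => ellNorm 1 x ^ m) (ellBall d 1) :=
  integrableOn_ellBall ((continuous_ellNorm le_rfl).measurable.pow_const m) (C := 1) fun x hx => by
    rw [abs_of_nonneg (pow_nonneg (ellNorm_nonneg le_rfl x) m)]
    exact pow_le_one₀ (ellNorm_nonneg le_rfl x) hx

lemma integral_ballKernel (hd : 0 < d) (m : ℕ) :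
    ∫ x : Vec d, ballKernel m x = surfL1 d * (1 / d - 1 / (d + (m + 1))) := by
  have e : ∀ x : Vec d, ballKernel m x =
      (ellBall d 1).indicator (fun x => 1 - ellNorm 1 x ^ (m + 1)) x := by
    intro x
    by_cases hx : ellNorm 1 x < 1
    · rw [Set.indicator_of_mem (show x ∈ ellBall d 1 from hx), ballKernel_of_le_one hx.le]
    · rw [Set.indicator_of_notMem (show x ∉ ellBall d 1 from hx),
        ballKernel_of_one_le (not_lt.1 hx)]
  simp_rw [e]
  have h0 := integral_ball_pow (d := d) hd 0
  have h1 := integral_ball_pow (d := d) hd (m + 1)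
  have i0 := integrableOn_ball_pow (d := d) 0
  simp only [pow_zero] at h0 i0
  rw [integral_indicator measurableSet_ellBall_one, integral_sub i0 (integrableOn_ball_pow _), h0,
    h1]
  push_cast
  ring

lemma abs_inner_signVec_le (x w : Vec d) : |inner ℝ (signVec x) w| ≤ ellNorm 1 w := by
  rw [inner_eq_sum, ellNorm_one]
  refine (Finset.abs_sum_le_sum_abs _ _).trans (Finset.sum_le_sum fun i _ => ?_)
  rw [abs_mul, abs_signVec_apply, one_mul]

/-- The version of `le_integral_sphere` for smoothing by `ballKernel m`. The derivative of the
kernel concentrates near the sphere as `m → ∞`; replacing the loss by its value at the radial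
projection onto the sphere costs the last term, which tends to `0`. -/
lemma le_integral_sphere_aux (hd : 0 < d) {f : Vec d → ℝ} (hf : ConvexOn ℝ Set.univ f)
    (hfc : Continuous f) {μ A : ℝ} (hμ : 0 < μ) (hA : 0 ≤ A) {y v : Vec d}
    (hy : ∀ x x', ellNorm 1 x ≤ 1 → ellNorm 1 x' ≤ 1 →
      |f (y + μ • x) - f (y + μ • x')| ≤ A * ellNorm 1 (x - x'))
    (hv : ∀ x x', ellNorm 1 x ≤ 1 → ellNorm 1 x' ≤ 1 →
      |f (v + μ • x) - f (v + μ • x')| ≤ A * ellNorm 1 (x - x')) (m : ℕ) :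
    (f y - f v - 2 * A) * (1 / d - 1 / (d + (m + 1))) ≤
      1 / μ * ((m + 1) / (d + m) *
        (∫ s, f (y + μ • s) * inner ℝ (signVec s) (y - v) ∂unifL1Sphere d)
        + A * ellNorm 1 (y - v) / (d + m)) := by
  set W := ellNorm 1 (y - v) with hW
  have hW0 : 0 ≤ W := ellNorm_nonneg le_rfl _
  set I := ∫ s, f (y + μ • s) * inner ℝ (signVec s) (y - v) ∂unifL1Sphere d with hI
  have hS := surfL1_pos hd
  have hd0 : (0 : ℝ) < d := by exact_mod_cast hd
  have hK := continuous_ballKernel (d := d) m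
  have hKc := hasCompactSupport_ballKernel (d := d) m
  have hKi : Integrable (ballKernel (d := d) m) := hK.integrable_of_hasCompactSupport hKc
  have hNc := continuous_ellNorm (d := d) (p := 1) le_rfl
  have h1 := integral_ballKernel_deriv_le hd hf hfc hμ y v m
  -- the increment of the smoothed loss
  have h2 : ∫ x, ballKernel m x * (f (v + μ • x) - f (y + μ • x)) ≤
      -((f y - f v - 2 * A) * (surfL1 d * (1 / d - 1 / (d + (m + 1))))) := by
    rw [← integral_ballKernel hd m, ← integral_const_mul, ← integral_neg]
    refine integral_mono ((hK.mul (by fun_prop)).integrable_of_hasCompactSupport hKc.mul_right)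
      (hKi.const_mul _).neg fun x => ?_
    simp only
    rcases le_total (ellNorm 1 x) 1 with hx | hx
    · have e0 : ellNorm 1 (0 : Vec d) ≤ 1 := by rw [ellNorm_zero le_rfl]; exact zero_le_one
      have hy1 := hy x 0 hx e0
      have hv1 := hv x 0 hx e0
      rw [smul_zero, add_zero, sub_zero] at hy1 hv1
      have : A * ellNorm 1 x ≤ A := mul_le_of_le_one_right hA hx
      have h3 := (abs_le.1 hy1).1
      have h4 := (abs_le.1 hv1).2
      nlinarith [ballKernel_nonneg m x]
    · rw [ballKernel_of_one_le hx]; simp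
  -- the boundary term, first with the loss evaluated at the projection onto the sphere
  set P : Vec d → ℝ := fun x => f (y + μ • ((ellNorm 1 x)⁻¹ • x)) *
    inner ℝ (signVec ((ellNorm 1 x)⁻¹ • x)) (y - v) * ellNorm 1 x ^ m with hP
  have hgm : Measurable fun s => f (y + μ • s) * inner ℝ (signVec s) (y - v) :=
    (by fun_prop : Measurable fun s => f (y + μ • s)).mul
      (measurable_signVec.inner measurable_const)
  have hPI : ∫ x in ellBall d 1, P x = surfL1 d * I * (1 / (d + m)) :=
    integral_ball_polar_pow hd hgm m
  have hfb : ∀ x, ellNorm 1 x ≤ 1 → |f (y + μ • x)| ≤ A + |f y| := by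
    intro x hx
    have e0 : ellNorm 1 (0 : Vec d) ≤ 1 := by rw [ellNorm_zero le_rfl]; exact zero_le_one
    have hy1 := hy x 0 hx e0
    rw [smul_zero, add_zero, sub_zero] at hy1
    have h3 : A * ellNorm 1 x ≤ A := mul_le_of_le_one_right hA hx
    have := abs_add_le (f (y + μ • x) - f y) (f y)
    rw [sub_add_cancel] at this
    linarith
  have hnorm : ∀ x : Vec d, ellNorm 1 ((ellNorm 1 x)⁻¹ • x) ≤ 1 := by
    intro x
    rcases eq_or_ne x 0 with rfl | hx
    · rw [smul_zero, ellNorm_zero le_rfl]; exact zero_le_one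
    · exact (ellNorm_one_normalize hx).le
  have hpow : ∀ x : Vec d, ellNorm 1 x ≤ 1 → |ellNorm 1 x ^ m| ≤ 1 := fun x hx => by
    rw [abs_of_nonneg (pow_nonneg (ellNorm_nonneg le_rfl x) m)]
    exact pow_le_one₀ (ellNorm_nonneg le_rfl x) hx
  have iP : IntegrableOn P (ellBall d 1) := by
    refine integrableOn_ellBall ((hgm.comp measurable_l1Normalize).mul
      (hNc.measurable.pow_const m)) (C := (A + |f y|) * W * 1) fun x hx => ?_
    rw [abs_mul, abs_mul]
    have := hpow x hx
    gcongr
    · exact hfb _ (hnorm x)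
    · exact abs_inner_signVec_le _ _
  set Q : Vec d → ℝ := fun x =>
    f (y + μ • x) * ((m + 1) * ellNorm 1 x ^ m * inner ℝ (signVec x) (v - y)) with hQ
  have iQ : IntegrableOn Q (ellBall d 1) := by
    have hm : Measurable Q := (by fun_prop : Measurable fun s => f (y + μ • s)).mul
      (((hNc.measurable.pow_const m).const_mul _).mul (measurable_signVec.inner measurable_const))
    refine integrableOn_ellBall hm (C := (A + |f y|) * ((m + 1) * 1 * W)) fun x hx => ?_
    have e1 : |((m : ℝ) + 1)| = m + 1 := abs_of_nonneg (by positivity)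
    rw [hQ, abs_mul, abs_mul, abs_mul, e1]
    have := hpow x hx
    have h3 := hfb x hx
    have h4 : |inner ℝ (signVec x) (v - y)| ≤ W := by
      rw [hW, ellNorm_sub_comm le_rfl]; exact abs_inner_signVec_le _ _
    gcongr
  have iR : IntegrableOn (fun x : Vec d => ellNorm 1 x ^ m - ellNorm 1 x ^ (m + 1)) (ellBall d 1) :=
    (integrableOn_ball_pow m).sub (integrableOn_ball_pow (m + 1))
  have h3 : -((m + 1) * (surfL1 d * I * (1 / (d + m)))) - (m + 1) * A * W *
      (surfL1 d * (1 / (d + m)) - surfL1 d * (1 / (d + (m + 1 : ℕ)))) ≤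
      ∫ x in ellBall d 1, Q x := by
    rw [← integral_ball_pow hd m, ← integral_ball_pow hd (m + 1), ← hPI,
      ← integral_sub (integrableOn_ball_pow m) (integrableOn_ball_pow (m + 1)),
      ← integral_const_mul, ← integral_const_mul, ← integral_neg,
      ← integral_sub (f := fun x => -(((m : ℝ) + 1) * P x)) (iP.const_mul _).neg (iR.const_mul _)]
    refine setIntegral_mono_on ((iP.const_mul _).neg.sub (iR.const_mul _)) iQ
      measurableSet_ellBall_one fun x hx => ?_
    have hx : ellNorm 1 x < 1 := hx
    rw [hP, hQ]
    simp only
    rw [signVec_l1Normalize, ← neg_sub y v, inner_neg_right]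
    set n := ellNorm 1 x with hn
    have hn0 : 0 ≤ n := ellNorm_nonneg le_rfl x
    have e : ellNorm 1 (n⁻¹ • x - x) ≤ 1 - n := by
      rcases hn0.eq_or_lt with h | h
      · rw [(ellNorm_eq_zero le_rfl).1 (hn.symm.trans h.symm)]
        simp [ellNorm_zero]; linarith
      · have : n⁻¹ • x - x = (n⁻¹ - 1) • x := by rw [sub_smul, one_smul]
        rw [this, ellNorm_smul le_rfl, abs_of_nonneg (sub_nonneg.2 ((one_le_inv₀ h).2 hx.le)), ← hn,
          sub_mul, inv_mul_cancel₀ h.ne', one_mul]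
    have h4 := (hy _ x (hnorm x) hx.le).trans (mul_le_mul_of_nonneg_left e hA)
    rw [← hn] at h4
    have h5 : |(f (y + μ • n⁻¹ • x) - f (y + μ • x)) * inner ℝ (signVec x) (y - v)| ≤
        A * (1 - n) * W := by
      rw [abs_mul]
      exact mul_le_mul h4 (abs_inner_signVec_le _ _) (abs_nonneg _)
        (mul_nonneg hA (by linarith))
    have h6 := (abs_le.1 h5).1
    have h7 : 0 ≤ ((m : ℝ) + 1) * n ^ m := by positivity
    have h8 := mul_le_mul_of_nonneg_left h6 h7
    rw [pow_succ]
    nlinarith [h8]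
  have h4 : ((m : ℝ) + 1) * (1 / (d + m) - 1 / (d + (m + 1))) ≤ 1 / (d + m) := by
    rw [div_sub_div _ _ (by positivity) (by positivity), mul_div_assoc', div_le_div_iff₀
      (by positivity) (by positivity)]
    nlinarith [hd0, mul_pos hd0 hd0, (Nat.cast_nonneg m : (0 : ℝ) ≤ m),
      mul_nonneg hd0.le (Nat.cast_nonneg m : (0 : ℝ) ≤ m)]
  push_cast at h3
  have h5 : 1 / μ * (-((m + 1) * (surfL1 d * I * (1 / (d + m)))) - (m + 1) * A * W *
      (surfL1 d * (1 / (d + m)) - surfL1 d * (1 / (d + (m + 1))))) ≤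
      -((f y - f v - 2 * A) * (surfL1 d * (1 / d - 1 / (d + (m + 1))))) :=
    (mul_le_mul_of_nonneg_left h3 (by positivity)).trans (h1.trans h2)
  have h6 : A * W * (((m : ℝ) + 1) * (1 / (d + m) - 1 / (d + (m + 1)))) ≤ A * W * (1 / (d + m)) :=
    mul_le_mul_of_nonneg_left h4 (by positivity)
  have h7 : (f y - f v - 2 * A) * (1 / d - 1 / (d + (m + 1))) ≤ 1 / μ * ((m + 1) / (d + m) * I +
      A * W * (((m : ℝ) + 1) * (1 / (d + m) - 1 / (d + (m + 1))))) := by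
    refine le_of_mul_le_mul_left ?_ hS
    have : (m + 1) / (d + m) * I = (m + 1) * I * (1 / (d + m : ℝ)) := by ring
    rw [this]
    linarith [h5]
  refine h7.trans (mul_le_mul_of_nonneg_left ?_ (by positivity))
  rw [div_eq_mul_one_div (A * W)]
  linarith

open Filter Topology in
/-- The subgradient inequality for the smoothed loss, the gradient being written as an integral
over the `ℓ_1`-sphere; the smoothing error is at most `2 A`. -/
theorem le_integral_sphere (hd : 0 < d) {f : Vec d → ℝ} (hf : ConvexOn ℝ Set.univ f)
    (hfc : Continuous f) {μ A : ℝ} (hμ : 0 < μ) (hA : 0 ≤ A) {y v : Vec d}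
    (hy : ∀ x x', ellNorm 1 x ≤ 1 → ellNorm 1 x' ≤ 1 →
      |f (y + μ • x) - f (y + μ • x')| ≤ A * ellNorm 1 (x - x'))
    (hv : ∀ x x', ellNorm 1 x ≤ 1 → ellNorm 1 x' ≤ 1 →
      |f (v + μ • x) - f (v + μ • x')| ≤ A * ellNorm 1 (x - x')) :
    f y - f v - 2 * A ≤
      d / μ * ∫ s, f (y + μ • s) * inner ℝ (signVec s) (y - v) ∂unifL1Sphere d := by
  have hd0 : (0 : ℝ) < d := by exact_mod_cast hd
  set I := ∫ s, f (y + μ • s) * inner ℝ (signVec s) (y - v) ∂unifL1Sphere d with hI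
  have hinv : ∀ c : ℝ, Tendsto (fun m : ℕ => c / ((d : ℝ) + m)) atTop (𝓝 0) := fun c =>
    tendsto_const_nhds.div_atTop (tendsto_atTop_add_const_left _ _ tendsto_natCast_atTop_atTop)
  have hinv' : Tendsto (fun m : ℕ => 1 / ((d : ℝ) + (m + 1))) atTop (𝓝 0) := by
    have := (hinv 1).comp (tendsto_add_atTop_nat 1)
    simpa [Function.comp_def] using this
  have hone : Tendsto (fun m : ℕ => ((m : ℝ) + 1) / (d + m)) atTop (𝓝 1) := by
    have : ∀ m : ℕ, ((m : ℝ) + 1) / (d + m) = 1 - (d - 1) / (d + m) := fun m => by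
      field_simp; ring
    simp_rw [this]
    simpa using (hinv (d - 1)).const_sub 1
  have hl : Tendsto (fun m : ℕ => (f y - f v - 2 * A) * (1 / d - 1 / (d + ((m : ℝ) + 1)))) atTop
      (𝓝 ((f y - f v - 2 * A) * (1 / d - 0))) := (hinv'.const_sub _).const_mul _
  have hr : Tendsto (fun m : ℕ => 1 / μ * (((m : ℝ) + 1) / (d + m) * I
        + A * ellNorm 1 (y - v) / (d + m))) atTop (𝓝 (1 / μ * (1 * I + 0))) :=
    ((hone.mul_const _).add (hinv _)).const_mul _
  have := le_of_tendsto_of_tendsto' hl hr fun m => le_integral_sphere_aux hd hf hfc hμ hA hy hv m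
  rw [sub_zero, one_mul, add_zero, mul_one_div, div_le_iff₀ hd0] at this
  exact this.trans_eq (by ring)

lemma ae_forall_apply_ne_zero_sphere (hd : 0 < d) : ∀ᵐ s ∂unifL1Sphere d, ∀ i, s i ≠ 0 := by
  have : Nonempty (Fin d) := ⟨⟨0, hd⟩⟩
  have hms : MeasurableSet {s : Vec d | ∀ i, s i ≠ 0} := by
    simp only [Set.ofPred_forall]
    refine MeasurableSet.iInter fun i => ?_
    exact (measurableSet_eq_fun (by fun_prop) measurable_const).compl
  rw [unifL1Sphere, ae_map_iff measurable_l1Normalize.aemeasurable hms]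
  refine cond_absolutelyContinuous.ae_le ?_
  filter_upwards [ae_forall_apply_ne_zero] with x hx i
  have h0 : ellNorm 1 x ≠ 0 := fun h => hx ⟨0, hd⟩ (by
    rw [(ellNorm_eq_zero le_rfl).1 h]; rfl)
  simpa [h0] using hx i

lemma signVec_neg {s : Vec d} (hs : ∀ i, s i ≠ 0) : signVec (-s) = -signVec s := by
  ext i
  change (if 0 ≤ -s i then (1 : ℝ) else -1) = -(if 0 ≤ s i then (1 : ℝ) else -1)
  rcases lt_or_gt_of_ne (hs i) with h | h
  · rw [if_pos (by linarith), if_neg (not_le.2 h), neg_neg]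
  · rw [if_neg (by linarith), if_pos h.le]

/-- The gradient estimator is, in mean and up to the smoothing error, a subgradient. -/
theorem le_integral_inner_gradEst (hd : 0 < d) {f : Vec d → ℝ} (hf : ConvexOn ℝ Set.univ f)
    (hfc : Continuous f) {μ A : ℝ} (hμ : 0 < μ) (hA : 0 ≤ A) {y v : Vec d}
    (hy : ∀ x x', ellNorm 1 x ≤ 1 → ellNorm 1 x' ≤ 1 →
      |f (y + μ • x) - f (y + μ • x')| ≤ A * ellNorm 1 (x - x'))
    (hv : ∀ x x', ellNorm 1 x ≤ 1 → ellNorm 1 x' ≤ 1 →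
      |f (v + μ • x) - f (v + μ • x')| ≤ A * ellNorm 1 (x - x')) :
    f y - f v - 2 * A ≤ ∫ s, inner ℝ (gradEst f μ y s) (y - v) ∂unifL1Sphere d := by
  refine (le_integral_sphere hd hf hfc hμ hA hy hv).trans_eq ?_
  set g : Vec d → ℝ := fun s => f (y + μ • s) * inner ℝ (signVec s) (y - v) with hg
  have hgm : Measurable g := (by fun_prop : Measurable fun s => f (y + μ • s)).mul
      (measurable_signVec.inner measurable_const)
  have e0 : ellNorm 1 (0 : Vec d) ≤ 1 := by rw [ellNorm_zero le_rfl]; exact zero_le_one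
  have hgi : Integrable g (unifL1Sphere d) := by
    refine integrable_of_bound_on_sphere hd hgm (C := (A + |f y|) * ellNorm 1 (y - v))
      fun s hs => ?_
    have hy1 := hy s 0 hs.le e0
    rw [smul_zero, add_zero, sub_zero, hs, mul_one] at hy1
    have := abs_add_le (f (y + μ • s) - f y) (f y)
    rw [sub_add_cancel] at this
    rw [hg, abs_mul]
    gcongr
    · linarith
    · exact abs_inner_signVec_le _ _
  have hgn : Integrable (fun s => g (-s)) (unifL1Sphere d) := by
    have := (MeasurableEquiv.neg (Vec d)).measurableEmbedding.integrable_map_iff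
      (μ := unifL1Sphere d) (g := g)
    rw [show (MeasurableEquiv.neg (Vec d) : Vec d → Vec d) = fun s => -s from rfl,
      map_neg_unifL1Sphere] at this
    exact this.1 hgi
  have hae : ∀ᵐ s ∂unifL1Sphere d, inner ℝ (gradEst f μ y s) (y - v) =
      d / (2 * μ) * (g s + g (-s)) := by
    filter_upwards [ae_forall_apply_ne_zero_sphere hd] with s hs
    simp only [hg, gradEst, real_inner_smul_left, signVec_neg hs, inner_neg_left, smul_neg,
      ← sub_eq_add_neg]
    ring
  rw [integral_congr_ae hae, integral_const_mul, integral_add hgi hgn, integral_neg_unifL1Sphere]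
  field_simp
  ring

/-- The mean square of the gradient estimator, up to the dual norm of the sign vector. -/
lemma integral_gradEst_coeff_sq_le (hd : 0 < d) {f : Vec d → ℝ} (hfc : Continuous f) {μ B : ℝ}
    (hμ : 0 < μ) (hB : 0 ≤ B) {y : Vec d}
    (hy : ∀ x x', ellNorm 1 x ≤ 1 → ellNorm 1 x' ≤ 1 →
      |f (y + μ • x) - f (y + μ • x')| ≤ B * ‖x - x'‖) :
    ∫ s, ((d : ℝ) / (2 * μ) * (f (y + μ • s) - f (y - μ • s))) ^ 2 ∂unifL1Sphere d ≤
      384 * (B / μ) ^ 2 := by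
  have hd0 : (0 : ℝ) < d := by exact_mod_cast hd
  have key := integral_sq_odd_le hd (k := fun s => f (y + μ • s) - f (y - μ • s))
    (M := 2 * B) (by fun_prop) (by positivity)
    (fun s => by simp only [smul_neg, sub_neg_eq_add, ← sub_eq_add_neg]; ring)
    (fun s s' hs hs' => by
      have h1 := hy s s' hs.le hs'.le
      have h2 := hy (-s) (-s') (by rw [ellNorm_neg le_rfl, hs]) (by rw [ellNorm_neg le_rfl, hs'])
      have e : ‖-s - -s'‖ = ‖s - s'‖ := by rw [neg_sub_neg, norm_sub_rev]
      simp only [smul_neg, ← sub_eq_add_neg] at h2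
      rw [e] at h2
      have e2 : f (y + μ • s) - f (y - μ • s) - (f (y + μ • s') - f (y - μ • s')) =
        (f (y + μ • s) - f (y + μ • s')) - (f (y - μ • s) - f (y - μ • s')) := by ring
      rw [e2]
      refine (abs_sub _ _).trans ?_
      linarith)
  simp_rw [mul_pow]
  rw [integral_const_mul]
  calc _ ≤ ((d : ℝ) / (2 * μ)) ^ 2 * (384 * (2 * B) ^ 2 / d ^ 2) := by gcongr
    _ = _ := by field_simp

/-! ### Mirror descent -/

section MirrorDescent

variable {p : ℝ≥0∞} {lam : ℝ} {S K : Set (Vec d)} {ψ : Vec d → ℝ}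

lemma hasLineDerivAt_of_differentiableAt {y : Vec d} (hy : DifferentiableAt ℝ ψ y) (w : Vec d) :
    HasLineDerivAt ℝ ψ (inner ℝ (gradient ψ y) w) y w := by
  have := hy.hasGradientAt.hasFDerivAt.hasLineDerivAt w
  simpa using this

/-- Strong convexity bounds the Bregman divergence from below. -/
lemma le_bregman (hψ : StrongConvexOnEll p lam S ψ) {x y : Vec d} (hx : x ∈ S) (hy : y ∈ S)
    (hdy : DifferentiableAt ℝ ψ y) : lam / 2 * ellNorm p (x - y) ^ 2 ≤ bregman ψ x y := by
  have ht := (hasLineDerivAt_of_differentiableAt hdy (x - y)).tendsto_slope_zero_right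
  have hr : Filter.Tendsto (fun t : ℝ => ψ x - ψ y - (1 - t) * (lam / 2 * ellNorm p (x - y) ^ 2))
      (nhdsWithin 0 (Set.Ioi 0))
      (nhds (ψ x - ψ y - (1 - 0) * (lam / 2 * ellNorm p (x - y) ^ 2))) :=
    ((by fun_prop : Continuous fun t : ℝ =>
      ψ x - ψ y - (1 - t) * (lam / 2 * ellNorm p (x - y) ^ 2)).tendsto 0).mono_left
      nhdsWithin_le_nhds
  have := le_of_tendsto_of_tendsto ht hr (by
    filter_upwards [Ioc_mem_nhdsGT zero_lt_one] with t ht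
    have h := hψ.2 x hx y hy t (1 - t) ht.1.le (sub_nonneg.2 ht.2) (by ring)
    have e : t • x + (1 - t) • y = y + t • (x - y) := by module
    rw [e] at h
    rw [smul_eq_mul, inv_mul_le_iff₀ ht.1]
    linarith)
  unfold bregman
  linarith

lemma bregman_nonneg (hlam : 0 < lam) (hψ : StrongConvexOnEll p lam S ψ) {x y : Vec d} (hx : x ∈ S)
    (hy : y ∈ S) (hdy : DifferentiableAt ℝ ψ y) : 0 ≤ bregman ψ x y :=
  (by positivity : (0 : ℝ) ≤ lam / 2 * ellNorm p (x - y) ^ 2).trans (le_bregman hψ hx hy hdy)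

/-- The first-order optimality condition for a mirror descent step. -/
lemma mirror_step_optimality (hK : Convex ℝ K) {g y y' : Vec d} {η : ℝ} (hη : 0 < η)
    (hy' : y' ∈ K) (hdy' : DifferentiableAt ℝ ψ y')
    (hmin : IsMinOn (fun z => inner ℝ g z + 1 / η * bregman ψ z y) K y') {z : Vec d} (hz : z ∈ K) :
    0 ≤ inner ℝ (η • g + gradient ψ y' - gradient ψ y) (z - y') := by
  have ht := (hasLineDerivAt_of_differentiableAt hdy' (z - y')).tendsto_slope_zero_right
  have h2 : inner ℝ (gradient ψ y - η • g) (z - y') ≤ inner ℝ (gradient ψ y') (z - y') := by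
    refine ge_of_tendsto ht ?_
    filter_upwards [Ioc_mem_nhdsGT zero_lt_one] with t ht
    have hm : y' + t • (z - y') ∈ K := by
      have := hK hz hy' ht.1.le (sub_nonneg.2 ht.2) (by ring)
      convert this using 1
      module
    have h := hmin hm
    simp only [bregman, Set.mem_ofPred_eq] at h
    have e : y' + t • (z - y') - y = (y' - y) + t • (z - y') := by abel
    rw [e, inner_add_right, inner_add_right, inner_smul_right, inner_smul_right] at h
    rw [smul_eq_mul, ← div_eq_inv_mul, le_div_iff₀ ht.1, inner_sub_left, real_inner_smul_left]
    have h3 := mul_le_mul_of_nonneg_left h hη.le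
    have e3 : ∀ a b : ℝ, η * (a + 1 / η * b) = η * a + b := fun a b => by field_simp
    rw [e3, e3] at h3
    linarith
  rw [inner_sub_left] at h2
  rw [inner_sub_left, inner_add_left]
  linarith

/-- The linearised regret of one mirror descent step: the three-point identity for the Bregman
divergence, with `g` paired with the movement `y - y'` by Hölder's inequality. -/
lemma mirror_step (hp : 1 ≤ p) (hlam : 0 < lam) (hψ : StrongConvexOnEll p lam S ψ) (hK : Convex ℝ K)
    (hKS : K ⊆ S) (hdiff : ∀ x ∈ S, DifferentiableAt ℝ ψ x) {g y y' v : Vec d} {η : ℝ} (hη : 0 < η)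
    (hy : y ∈ K) (hy' : y' ∈ K) (hv : v ∈ K)
    (hmin : IsMinOn (fun z => inner ℝ g z + 1 / η * bregman ψ z y) K y') :
    inner ℝ g (y - v) ≤ 1 / η * (bregman ψ v y - bregman ψ v y') +
      η / (2 * lam) * ellNorm (ENNReal.conjExponent p) g ^ 2 := by
  have h1 := mirror_step_optimality hK hη hy' (hdiff _ (hKS hy')) hmin hv
  have h2 := le_bregman hψ (hKS hy') (hKS hy) (hdiff _ (hKS hy))
  have h3 := (le_abs_self _).trans (abs_inner_le hp g (y - y'))
  rw [ellNorm_sub_comm hp] at h3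
  set a := ellNorm (ENNReal.conjExponent p) g
  set b := ellNorm p (y' - y)
  have h4 : bregman ψ v y - bregman ψ v y' - bregman ψ y' y =
      inner ℝ (gradient ψ y' - gradient ψ y) (v - y') := by
    have e : v - y = (v - y') + (y' - y) := by abel
    simp only [bregman, inner_sub_left]
    rw [e, inner_add_right]
    ring
  have h5 : η * inner ℝ g (y' - v) ≤ bregman ψ v y - bregman ψ v y' - bregman ψ y' y := by
    rw [h4]
    have e : η * inner ℝ g (y' - v) = - inner ℝ (η • g) (v - y') := by
      rw [real_inner_smul_left, ← neg_sub v y', inner_neg_right]; ring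
    rw [e]
    rw [add_sub_assoc, inner_add_left] at h1
    linarith
  have h6 : η * (a * b) ≤ η ^ 2 / (2 * lam) * a ^ 2 + lam / 2 * b ^ 2 := by
    have : η ^ 2 / (2 * lam) * a ^ 2 + lam / 2 * b ^ 2 - η * (a * b) =
      (η * a - lam * b) ^ 2 / (2 * lam) := by field_simp; ring
    have : 0 ≤ (η * a - lam * b) ^ 2 / (2 * lam) := by positivity
    linarith
  have h7 : inner ℝ g (y - v) = inner ℝ g (y - y') + inner ℝ g (y' - v) := by
    rw [← inner_add_right]; congr 1; abel
  refine le_of_mul_le_mul_left ?_ hη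
  have e1 : η * (1 / η * (bregman ψ v y - bregman ψ v y') + η / (2 * lam) * a ^ 2) =
      bregman ψ v y - bregman ψ v y' + η ^ 2 / (2 * lam) * a ^ 2 := by field_simp
  rw [e1, h7, mul_add]
  have := mul_le_mul_of_nonneg_left h3 hη.le
  linarith

/-- Telescoping the Bregman divergences along moving comparators: replacing a comparator by the
next one changes the divergence by a difference of values of `ψ`, which telescopes, and by a linear
term controlled by the path variation. -/
lemma sum_bregman_sub_le (hp : 1 ≤ p) (hlam : 0 < lam) (hψ : StrongConvexOnEll p lam S ψ)
    (hdiff : ∀ x ∈ S, DifferentiableAt ℝ ψ x) {T : ℕ} (hT : 1 ≤ T) {y v : ℕ → Vec d}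
    (hy : ∀ t ≤ T, y t ∈ S) (hv : ∀ t < T, v t ∈ S) {Gψ F : ℝ}
    (hG : ∀ t < T, ellNorm (ENNReal.conjExponent p) (gradient ψ (y t)) ≤ Gψ)
    (hF : ∀ x ∈ S, ∀ z ∈ S, ψ x - ψ z ≤ F) :
    ∑ t ∈ Finset.range T, (bregman ψ (v t) (y t) - bregman ψ (v t) (y (t + 1))) ≤
      F + bregman ψ (v 0) (y 0) + Gψ * ∑ t ∈ Finset.range T, ellNorm p (v (t + 1) - v t) := by
  have hG0 : 0 ≤ Gψ := (ellNorm_nonneg (one_le_conjExponent p) _).trans (hG 0 hT)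
  have main : ∀ n, n + 1 ≤ T →
      ∑ t ∈ Finset.range (n + 1), (bregman ψ (v t) (y t) - bregman ψ (v t) (y (t + 1))) ≤
      bregman ψ (v 0) (y 0) + (ψ (v n) - ψ (v 0)) - bregman ψ (v n) (y (n + 1)) +
        Gψ * ∑ t ∈ Finset.range n, ellNorm p (v (t + 1) - v t) := by
    intro n
    induction n with
    | zero => intro _; simp
    | succ n ih =>
      intro hn
      rw [Finset.sum_range_succ, Finset.sum_range_succ (fun t => ellNorm p (v (t + 1) - v t))]
      have h1 := ih (by omega)
      have h2 : bregman ψ (v (n + 1)) (y (n + 1)) - bregman ψ (v n) (y (n + 1)) =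
          ψ (v (n + 1)) - ψ (v n) + inner ℝ (gradient ψ (y (n + 1))) (-(v (n + 1) - v n)) := by
        have e : -(v (n + 1) - v n) = (v n - y (n + 1)) - (v (n + 1) - y (n + 1)) := by abel
        rw [e, inner_sub_right]
        simp only [bregman]
        ring
      have h3 := (le_abs_self _).trans
        (abs_inner_le hp (gradient ψ (y (n + 1))) (-(v (n + 1) - v n)))
      rw [ellNorm_neg hp] at h3
      have h4 := mul_le_mul_of_nonneg_right (hG (n + 1) (by omega))
        (ellNorm_nonneg hp (v (n + 1) - v n))
      rw [mul_add]
      linarith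
  obtain ⟨n, rfl⟩ := Nat.exists_eq_add_of_le' hT
  have h1 := main n le_rfl
  have h2 := bregman_nonneg hlam hψ (hv n (by omega)) (hy (n + 1) le_rfl)
    (hdiff _ (hy (n + 1) le_rfl))
  have h3 := hF _ (hv n (by omega)) _ (hv 0 (by omega))
  have h4 : ∑ t ∈ Finset.range n, ellNorm p (v (t + 1) - v t) ≤
      ∑ t ∈ Finset.range (n + 1), ellNorm p (v (t + 1) - v t) := by
    rw [Finset.sum_range_succ]
    linarith [ellNorm_nonneg hp (v (n + 1) - v n)]
  have h5 := mul_le_mul_of_nonneg_left h4 hG0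
  linarith

/-- A mirror descent step depends Lipschitz continuously on the dual vector `∇ψ(y) - η g`. -/
lemma dist_mirror_step_le (hp : 1 ≤ p) (hlam : 0 < lam) (hψ : StrongConvexOnEll p lam S ψ)
    (hK : Convex ℝ K) (hKS : K ⊆ S) (hdiff : ∀ x ∈ S, DifferentiableAt ℝ ψ x)
    {g₁ g₂ y₁ y₂ z₁ z₂ : Vec d} {η : ℝ} (hη : 0 < η) (hz₁ : z₁ ∈ K) (hz₂ : z₂ ∈ K)
    (h₁ : IsMinOn (fun z => inner ℝ g₁ z + 1 / η * bregman ψ z y₁) K z₁)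
    (h₂ : IsMinOn (fun z => inner ℝ g₂ z + 1 / η * bregman ψ z y₂) K z₂) :
    dist z₁ z₂ ≤ ((d : ℝ) ^ max 0 (((2 : ℝ≥0∞)⁻¹).toReal - (p⁻¹).toReal)) ^ 2 / lam *
      dist (gradient ψ y₁ - η • g₁) (gradient ψ y₂ - η • g₂) := by
  set c := (d : ℝ) ^ max 0 (((2 : ℝ≥0∞)⁻¹).toReal - (p⁻¹).toReal)
  have o1 := mirror_step_optimality hK hη hz₁ (hdiff _ (hKS hz₁)) h₁ hz₂
  have o2 := mirror_step_optimality hK hη hz₂ (hdiff _ (hKS hz₂)) h₂ hz₁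
  have b1 := le_bregman hψ (hKS hz₁) (hKS hz₂) (hdiff _ (hKS hz₂))
  have b2 := le_bregman hψ (hKS hz₂) (hKS hz₁) (hdiff _ (hKS hz₁))
  rw [ellNorm_sub_comm hp] at b2
  set e := ellNorm p (z₁ - z₂)
  have hn : ‖z₁ - z₂‖ ≤ c * e := ellNorm_le_mul hp (q := 2) (by norm_num) (z₁ - z₂)
  set w₁ := gradient ψ y₁ - η • g₁ with hw₁
  set w₂ := gradient ψ y₂ - η • g₂ with hw₂
  have h3 : lam * e ^ 2 ≤ inner ℝ (w₁ - w₂) (z₁ - z₂) := by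
    have e1 : η • g₁ + gradient ψ z₁ - gradient ψ y₁ = gradient ψ z₁ - w₁ := by rw [hw₁]; abel
    have e2 : η • g₂ + gradient ψ z₂ - gradient ψ y₂ = gradient ψ z₂ - w₂ := by rw [hw₂]; abel
    rw [e1] at o1
    rw [e2] at o2
    unfold bregman at b1 b2
    simp only [inner_sub_left, inner_sub_right] at o1 o2 b1 b2 ⊢
    linarith
  have h4 := h3.trans (real_inner_le_norm (w₁ - w₂) (z₁ - z₂))
  rw [dist_eq_norm, dist_eq_norm, div_mul_eq_mul_div, le_div_iff₀ hlam]
  rcases (norm_nonneg (z₁ - z₂)).eq_or_lt with h | h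
  · rw [← h, zero_mul]; positivity
  · refine le_of_mul_le_mul_right ?_ h
    calc ‖z₁ - z₂‖ * lam * ‖z₁ - z₂‖ = lam * ‖z₁ - z₂‖ ^ 2 := by ring
      _ ≤ lam * (c * e) ^ 2 := by gcongr
      _ = c ^ 2 * (lam * e ^ 2) := by ring
      _ ≤ c ^ 2 * (‖w₁ - w₂‖ * ‖z₁ - z₂‖) := by gcongr
      _ = _ := by ring

end MirrorDescent

/-! ### The feasible region -/

section Feasible

variable {p : ℝ≥0∞} {X : Set (Vec d)} {r R α μ : ℝ}

lemma mem_smul_ellBall (hp : 1 ≤ p) (hr : 0 < r) {x : Vec d} :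
    x ∈ r • ellBall d p ↔ ellNorm p x < r := by
  rw [Set.mem_smul_set_iff_inv_smul_mem₀ hr.ne']
  simp only [ellBall, Set.mem_ofPred_eq]
  rw [ellNorm_smul hp, abs_of_pos (inv_pos.2 hr), inv_mul_lt_iff₀ hr, mul_one]

lemma zero_mem_interior (hp : 1 ≤ p) (hr : 0 < r) (hrX : r • ellBall d p ⊆ X) :
    (0 : Vec d) ∈ interior X := by
  refine mem_interior.2 ⟨{x | ellNorm p x < r}, fun x hx => hrX ((mem_smul_ellBall hp hr).2 hx),
    isOpen_lt (continuous_ellNorm hp) continuous_const, ?_⟩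
  simpa [ellNorm_zero hp] using hr

lemma mem_of_ellNorm_le (hp : 1 ≤ p) (hX : IsClosed X) (hr : 0 < r) (hrX : r • ellBall d p ⊆ X)
    {x : Vec d} (hx : ellNorm p x ≤ r) : x ∈ X := by
  have ht : Filter.Tendsto (fun t : ℝ => t • x) (nhdsWithin 1 (Set.Iio 1)) (nhds ((1 : ℝ) • x)) :=
    ((by fun_prop : Continuous fun t : ℝ => t • x).tendsto 1).mono_left nhdsWithin_le_nhds
  rw [one_smul] at ht
  refine hX.mem_of_tendsto ht ?_
  filter_upwards [Ioo_mem_nhdsLT zero_lt_one] with t ht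
  refine hrX ((mem_smul_ellBall hp hr).2 ?_)
  rw [ellNorm_smul hp, abs_of_pos ht.1]
  have h0 := ellNorm_nonneg hp x
  nlinarith [ht.1, ht.2]

lemma smul_subset_interior (hX : Convex ℝ X) (h0 : (0 : Vec d) ∈ interior X) (hα : 0 < α)
    (hα1 : α < 1) : (1 - α) • X ⊆ interior X := by
  rintro _ ⟨x, hx, rfl⟩
  have := hX.combo_self_interior_mem_interior hx h0 (sub_pos.2 hα1).le hα (by ring)
  simpa using this

lemma le_of_smul_ellBall_subset (hp : 1 ≤ p) (hd : 0 < d) (hr : 0 < r) (hR : 0 < R)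
    (h : r • ellBall d p ⊆ R • ellBall d p) : r ≤ R := by
  by_contra! hlt
  have : Nonempty (Fin d) := ⟨⟨0, hd⟩⟩
  have : Nontrivial (Vec d) := (WithLp.equiv 2 (Fin d → ℝ)).nontrivial
  obtain ⟨x, hx⟩ := exists_ne (0 : Vec d)
  have hx0 : 0 < ellNorm p x :=
    (ellNorm_nonneg hp x).lt_of_ne' fun h => hx ((ellNorm_eq_zero hp).1 h)
  have hn : ellNorm p ((R / ellNorm p x) • x) = R := by
    rw [ellNorm_smul hp, abs_of_pos (by positivity), div_mul_cancel₀ _ hx0.ne']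
  have := (mem_smul_ellBall hp hR).1 (h ((mem_smul_ellBall hp hr).2 (hn.trans_lt hlt)))
  linarith

/-- The query points stay in the feasible region. -/
lemma add_smul_mem (hp : 1 ≤ p) (hd : 0 < d) (hX : IsClosed X) (hXc : Convex ℝ X) (hr : 0 < r)
    (hrX : r • ellBall d p ⊆ X) (hμ : 0 < μ) (hα : 0 < α) (hα1 : α < 1)
    (hμα : μ * (d : ℝ) ^ (1 - (p⁻¹).toReal) = α * r) {y : Vec d} (hy : y ∈ (1 - α) • X)
    {x : Vec d} (hx : ellNorm 1 x ≤ 1) : y + μ • x ∈ X := by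
  obtain ⟨z, hz, rfl⟩ := hy
  have hp1 := toReal_inv_le_one hp
  have hd1 : 1 ≤ (d : ℝ) ^ (1 - (p⁻¹).toReal) :=
    Real.one_le_rpow (by exact_mod_cast hd) (by linarith)
  have hle : μ ≤ α * r := hμα ▸ le_mul_of_one_le_right hμ.le hd1
  have h1 : (μ / α) • x ∈ X := by
    refine mem_of_ellNorm_le hp hX hr hrX ?_
    rw [ellNorm_smul hp, abs_of_pos (by positivity)]
    have : ellNorm p x ≤ 1 := (ellNorm_anti le_rfl hp x).trans hx
    calc μ / α * ellNorm p x ≤ μ / α * 1 := by gcongr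
      _ ≤ r := by rw [mul_one, div_le_iff₀ hα]; linarith
  have := hXc hz h1 (sub_pos.2 hα1).le hα.le (by ring)
  rwa [smul_smul, mul_div_cancel₀ _ hα.ne'] at this

end Feasible

/-! ### Measurability and independence of the iterates -/

/-- A map whose increments are dominated by those of a measurable map is measurable. -/
lemma measurable_of_dist_le_mul {Ω : Type*} [MeasurableSpace Ω] {w z : Ω → Vec d} {c : ℝ}
    (hw : Measurable w) (h : ∀ ω ω', dist (z ω) (z ω') ≤ c * dist (w ω) (w ω')) :
    Measurable z := by
  have hft : Function.FactorsThrough z w := fun ω ω' hωω => by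
    have := h ω ω'
    rw [hωω, dist_self, mul_zero] at this
    exact dist_le_zero.1 this
  have hext : ∀ ω, Function.extend w z 0 (w ω) = z ω := fun ω => hft.extend_apply 0 ω
  have hL : LipschitzOnWith c.toNNReal (Function.extend w z 0) (Set.range w) := by
    refine LipschitzOnWith.of_dist_le_mul ?_
    rintro _ ⟨ω, rfl⟩ _ ⟨ω', rfl⟩
    rw [hext, hext]
    refine (h ω ω').trans ?_
    gcongr
    exact Real.le_coe_toNNReal c
  obtain ⟨g, hg, hgs⟩ := hL.extend_finite_dimension
  have : z = g ∘ w := by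
    funext ω
    rw [Function.comp_apply, ← hgs ⟨ω, rfl⟩, hext]
  rw [this]
  exact hg.continuous.measurable.comp hw

lemma measurable_gradient (ψ : Vec d → ℝ) : Measurable (gradient ψ) :=
  (InnerProductSpace.toDual ℝ (Vec d)).symm.continuous.measurable.comp (measurable_fderiv ℝ ψ)

lemma measurable_gradEst {f : Vec d → ℝ} (hf : Continuous f) (μ : ℝ) :
    Measurable fun z : Vec d × Vec d => gradEst f μ z.1 z.2 := by
  unfold gradEst
  exact (by fun_prop : Measurable fun z : Vec d × Vec d =>
    (d : ℝ) / (2 * μ) * (f (z.1 + μ • z.2) - f (z.1 - μ • z.2))).smul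
    (measurable_signVec.comp measurable_snd)

/-- The `σ`-algebra generated by the perturbations of the rounds before round `t`. -/
@[reducible]
def pastInfo {Ω : Type*} (T : ℕ) (s : ℕ → Ω → Vec d) (t : ℕ) : MeasurableSpace Ω :=
  ⨆ i ∈ {i : Fin T | i < t}, MeasurableSpace.comap (s i) inferInstance

section Iterates

variable {Ω : Type*} {X S : Set (Vec d)} {f : ℕ → Vec d → ℝ} {ψ : Vec d → ℝ} {p : ℝ≥0∞}
  {μ α η lam : ℝ} {T : ℕ} {y₁ : Vec d} {s y : ℕ → Ω → Vec d}

lemma IsBMDRun.mem (h : IsBMDRun X f ψ μ α η T y₁ s y) {t : ℕ} (ht : t ≤ T) (ω : Ω) :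
    y t ω ∈ (1 - α) • X := by
  rcases t with _ | t
  · rw [h.init]; exact h.init_mem
  · exact h.step_mem t ht ω

/-- The iterate of round `t` is a measurable function of the earlier perturbations. -/
lemma IsBMDRun.measurable_pastInfo (h : IsBMDRun X f ψ μ α η T y₁ s y) (hp : 1 ≤ p)
    (hlam : 0 < lam) (hψ : StrongConvexOnEll p lam S ψ) (hX : Convex ℝ X)
    (hXS : (1 - α) • X ⊆ S) (hdiff : ∀ x ∈ S, DifferentiableAt ℝ ψ x) (hη : 0 < η)
    (hf : ∀ t < T, Continuous (f t)) {t : ℕ} (ht : t ≤ T) :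
    Measurable[pastInfo T s t] (y t) := by
  induction t with
  | zero =>
    have : y 0 = fun _ => y₁ := funext h.init
    rw [this]
    exact measurable_const
  | succ t ih =>
    have hmono : pastInfo T s t ≤ pastInfo T s (t + 1) :=
      biSup_mono fun i (hi : (i : ℕ) < t) => Nat.lt_succ_of_lt hi
    have hy : Measurable[pastInfo T s (t + 1)] (y t) := (ih (by omega)).mono hmono le_rfl
    have hs : Measurable[pastInfo T s (t + 1)] (s t) := by
      refine Measurable.mono (comap_measurable (s t)) ?_ le_rfl
      exact le_iSup₂_of_le (f := fun (i : Fin T) (_ : i ∈ {i : Fin T | (i : ℕ) < t + 1}) =>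
        MeasurableSpace.comap (s i) inferInstance) ⟨t, ht⟩ (Nat.lt_succ_self t) le_rfl
    have hw : Measurable[pastInfo T s (t + 1)]
        fun ω => gradient ψ (y t ω) - η • gradEst (f t) μ (y t ω) (s t ω) :=
      ((measurable_gradient ψ).comp hy).sub
        (((measurable_gradEst (hf t ht) μ).comp (hy.prodMk hs)).const_smul η)
    exact @measurable_of_dist_le_mul d Ω (pastInfo T s (t + 1)) _ _ _ hw fun ω ω' =>
      dist_mirror_step_le hp hlam hψ (hX.smul _) hXS hdiff hη (h.step_mem t ht ω)
        (h.step_mem t ht ω') (h.step_min t ht ω) (h.step_min t ht ω')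

lemma pastInfo_le [mΩ : MeasurableSpace Ω] (hs : ∀ t < T, Measurable (s t)) (t : ℕ) :
    pastInfo T s t ≤ mΩ :=
  iSup₂_le fun i _ => (hs i i.2).comap_le

/-- The perturbation of a round is independent of the iterate of that round. -/
lemma indepFun_of_measurable_pastInfo [mΩ : MeasurableSpace Ω] {P : Measure Ω}
    (hs : ∀ t < T, Measurable (s t)) (hind : iIndepFun (fun t : Fin T => s t) P) {t : ℕ}
    (ht : t < T) {Y : Ω → Vec d} (hY : Measurable[pastInfo T s t] Y) : IndepFun Y (s t) P := by
  have h := indep_iSup_of_disjoint (m := fun i : Fin T => MeasurableSpace.comap (s i) inferInstance)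
    (fun i => (hs i i.2).comap_le) hind.iIndep
    (S := {i : Fin T | (i : ℕ) < t}) (T := {⟨t, ht⟩}) (by
      rw [Set.disjoint_singleton_right]
      exact lt_irrefl t)
  rw [iSup_singleton] at h
  rw [IndepFun_iff_Indep]
  exact indep_of_indep_of_le_left h hY.comap_le

end Iterates

/-- Conditioning on the iterate: the perturbation may be integrated out first. -/
lemma integral_comp_of_indepFun {Ω : Type*} [MeasurableSpace Ω] {P : Measure Ω}
    [IsProbabilityMeasure P] {Y s : Ω → Vec d} (hY : Measurable Y) (hs : Measurable s)
    (hlaw : P.map s = unifL1Sphere d) (hind : IndepFun Y s P) {H : Vec d × Vec d → ℝ}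
    (hH : Measurable H) (hi : Integrable (fun ω => H (Y ω, s ω)) P) :
    Integrable (fun ω => ∫ x, H (Y ω, x) ∂unifL1Sphere d) P ∧
      ∫ ω, H (Y ω, s ω) ∂P = ∫ ω, ∫ x, H (Y ω, x) ∂unifL1Sphere d ∂P := by
  have hpm : P.map (fun ω => (Y ω, s ω)) = (P.map Y).prod (unifL1Sphere d) := by
    rw [← hlaw]
    exact hind.map_prod_eq_prod_map_map hY.aemeasurable hs.aemeasurable
  have : IsProbabilityMeasure (P.map Y) := Measure.isProbabilityMeasure_map hY.aemeasurable
  have hi' : Integrable H ((P.map Y).prod (unifL1Sphere d)) := by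
    rw [← hpm, integrable_map_measure hH.aestronglyMeasurable (hY.prodMk hs).aemeasurable]
    exact hi
  have hin := hi'.integral_prod_left
  refine ⟨?_, ?_⟩
  · exact (integrable_map_measure hin.aestronglyMeasurable hY.aemeasurable).1 hin
  · calc ∫ ω, H (Y ω, s ω) ∂P = ∫ z, H z ∂P.map (fun ω => (Y ω, s ω)) :=
          (integral_map (hY.prodMk hs).aemeasurable hH.aestronglyMeasurable).symm
      _ = ∫ y, ∫ x, H (y, x) ∂unifL1Sphere d ∂P.map Y := by rw [hpm, integral_prod _ hi']
      _ = _ := integral_map hY.aemeasurable hin.aestronglyMeasurable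

section Round

variable {Ω : Type*} [MeasurableSpace Ω] {P : Measure Ω}
  {Y s : Ω → Vec d} {K : Set (Vec d)} {f : Vec d → ℝ} {μ A : ℝ}

lemma ae_ellNorm_one_eq_one_of_law (hd : 0 < d) (hs : Measurable s)
    (hlaw : P.map s = unifL1Sphere d) : ∀ᵐ ω ∂P, ellNorm 1 (s ω) = 1 :=
  ae_of_ae_map hs.aemeasurable (hlaw ▸ ae_ellNorm_one_eq_one hd)

/-- On the query points the scalar factor of the gradient estimator is bounded. -/
lemma abs_gradEst_coeff_le (hμ : 0 < μ) {y x : Vec d}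
    (hL : ∀ x x', ellNorm 1 x ≤ 1 → ellNorm 1 x' ≤ 1 →
      |f (y + μ • x) - f (y + μ • x')| ≤ A * ellNorm 1 (x - x')) (hx : ellNorm 1 x = 1) :
    |(d : ℝ) / (2 * μ) * (f (y + μ • x) - f (y - μ • x))| ≤ d / μ * A := by
  have h := hL x (-x) hx.le (by rw [ellNorm_neg le_rfl, hx])
  have e : x - -x = (2 : ℝ) • x := by rw [two_smul]; abel
  rw [e, ellNorm_smul le_rfl, hx, smul_neg, ← sub_eq_add_neg] at h
  norm_num at h
  rw [abs_mul, abs_of_nonneg (by positivity)]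
  calc _ ≤ (d : ℝ) / (2 * μ) * (A * 2) := by gcongr
    _ = _ := by field_simp

lemma abs_inner_gradEst_le (hμ : 0 < μ) (hA : 0 ≤ A) {y x w : Vec d}
    (hL : ∀ x x', ellNorm 1 x ≤ 1 → ellNorm 1 x' ≤ 1 →
      |f (y + μ • x) - f (y + μ • x')| ≤ A * ellNorm 1 (x - x')) (hx : ellNorm 1 x = 1) :
    |inner ℝ (gradEst f μ y x) w| ≤ d / μ * A * ellNorm 1 w := by
  rw [gradEst, real_inner_smul_left, abs_mul]
  exact mul_le_mul (abs_gradEst_coeff_le hμ hL hx) (abs_inner_signVec_le _ _) (abs_nonneg _)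
    (by positivity)

variable [IsProbabilityMeasure P]

/-- The mean of the linearised loss of one round. -/
lemma integral_inner_gradEst_ge (hd : 0 < d) (hY : Measurable Y) (hs : Measurable s)
    (hlaw : P.map s = unifL1Sphere d) (hind : IndepFun Y s P) (hK : IsCompact K)
    (hYK : ∀ ω, Y ω ∈ K) (hf : ConvexOn ℝ Set.univ f) (hfc : Continuous f) (hμ : 0 < μ)
    (hA : 0 ≤ A) (hL : ∀ y ∈ K, ∀ x x', ellNorm 1 x ≤ 1 → ellNorm 1 x' ≤ 1 →
      |f (y + μ • x) - f (y + μ • x')| ≤ A * ellNorm 1 (x - x')) {v : Vec d} (hv : v ∈ K) :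
    Integrable (fun ω => inner ℝ (gradEst f μ (Y ω) (s ω)) (Y ω - v)) P ∧
    Integrable (fun ω => f (Y ω)) P ∧
    ∫ ω, f (Y ω) ∂P - f v - 2 * A ≤
      ∫ ω, inner ℝ (gradEst f μ (Y ω) (s ω)) (Y ω - v) ∂P := by
  have hN := continuous_ellNorm (d := d) (p := 1) le_rfl
  obtain ⟨C, hC⟩ := hK.exists_bound_of_continuousOn
    (f := fun y : Vec d => ellNorm 1 (y - v)) (by fun_prop)
  obtain ⟨Cf, hCf⟩ := hK.exists_bound_of_continuousOn hfc.continuousOn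
  have hHm : Measurable fun z : Vec d × Vec d => inner ℝ (gradEst f μ z.1 z.2) (z.1 - v) :=
    (measurable_gradEst hfc μ).inner (measurable_fst.sub_const v)
  have hi : Integrable (fun ω => inner ℝ (gradEst f μ (Y ω) (s ω)) (Y ω - v)) P := by
    refine Integrable.mono' (integrable_const (d / μ * A * C))
      (hHm.comp (hY.prodMk hs)).aestronglyMeasurable ?_
    filter_upwards [ae_ellNorm_one_eq_one_of_law hd hs hlaw] with ω hω
    refine (abs_inner_gradEst_le hμ hA (hL _ (hYK ω)) hω).trans ?_
    gcongr
    exact (le_abs_self _).trans (hC _ (hYK ω))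
  have hif : Integrable (fun ω => f (Y ω)) P :=
    Integrable.mono' (integrable_const Cf) (hfc.measurable.comp hY).aestronglyMeasurable
      (.of_forall fun ω => hCf _ (hYK ω))
  obtain ⟨h1, h2⟩ := integral_comp_of_indepFun hY hs hlaw hind hHm hi
  refine ⟨hi, hif, ?_⟩
  rw [h2]
  calc ∫ ω, f (Y ω) ∂P - f v - 2 * A = ∫ ω, (f (Y ω) - (f v + 2 * A)) ∂P := by
        rw [integral_sub hif (integrable_const _)]; simp; ring
    _ ≤ _ := by
        refine integral_mono (hif.sub (integrable_const _)) h1 fun ω => ?_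
        have := le_integral_inner_gradEst hd hf hfc hμ hA (hL _ (hYK ω)) (hL _ hv)
        simp only
        linarith

/-- The mean square of the gradient estimator of one round in the dual norm. -/
lemma integral_dual_sq_gradEst_le (hd : 0 < d) {p : ℝ≥0∞} (hp : 1 ≤ p) (hY : Measurable Y)
    (hs : Measurable s)
    (hlaw : P.map s = unifL1Sphere d) (hind : IndepFun Y s P)
    (hYK : ∀ ω, Y ω ∈ K) (hfc : Continuous f) (hμ : 0 < μ)
    (hL : ∀ y ∈ K, ∀ x x', ellNorm 1 x ≤ 1 → ellNorm 1 x' ≤ 1 →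
      |f (y + μ • x) - f (y + μ • x')| ≤ A * ellNorm 1 (x - x')) {B : ℝ} (hB : 0 ≤ B)
    (hL2 : ∀ y ∈ K, ∀ x x', ellNorm 1 x ≤ 1 → ellNorm 1 x' ≤ 1 →
      |f (y + μ • x) - f (y + μ • x')| ≤ B * ‖x - x'‖) :
    Integrable (fun ω => ellNorm (ENNReal.conjExponent p) (gradEst f μ (Y ω) (s ω)) ^ 2) P ∧
    ∫ ω, ellNorm (ENNReal.conjExponent p) (gradEst f μ (Y ω) (s ω)) ^ 2 ∂P ≤
      384 * (B / μ) ^ 2 * ((d : ℝ) ^ (1 - (p⁻¹).toReal)) ^ 2 := by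
  set D := (d : ℝ) ^ (1 - (p⁻¹).toReal) with hD
  set H : Vec d × Vec d → ℝ := fun z =>
    ((d : ℝ) / (2 * μ) * (f (z.1 + μ • z.2) - f (z.1 - μ • z.2))) ^ 2 with hH
  have hHm : Measurable H := by fun_prop
  have hi : Integrable (fun ω => H (Y ω, s ω)) P := by
    refine Integrable.mono' (integrable_const ((d / μ * A) ^ 2))
      (hHm.comp (hY.prodMk hs)).aestronglyMeasurable ?_
    filter_upwards [ae_ellNorm_one_eq_one_of_law hd hs hlaw] with ω hω
    have := abs_gradEst_coeff_le hμ (hL _ (hYK ω)) hω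
    rw [Real.norm_eq_abs, abs_of_nonneg (sq_nonneg _)]
    exact sq_le_sq' (abs_le.1 this).1 (abs_le.1 this).2
  obtain ⟨h1, h2⟩ := integral_comp_of_indepFun hY hs hlaw hind hHm hi
  have hle : ∀ ω, ellNorm (ENNReal.conjExponent p) (gradEst f μ (Y ω) (s ω)) ^ 2 ≤
      D ^ 2 * H (Y ω, s ω) := by
    intro ω
    rw [gradEst, ellNorm_smul (one_le_conjExponent p), mul_pow, sq_abs, mul_comm]
    have h0 := ellNorm_nonneg (one_le_conjExponent p) (signVec (s ω))
    have := ellNorm_signVec_le hp (s ω)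
    simp only [hH]
    gcongr
  have hint : Integrable (fun ω => ellNorm (ENNReal.conjExponent p) (gradEst f μ (Y ω) (s ω)) ^ 2)
      P := by
    refine Integrable.mono' (hi.const_mul (D ^ 2)) ?_ (.of_forall fun ω => ?_)
    · exact (((continuous_ellNorm (one_le_conjExponent p)).measurable.comp
        ((measurable_gradEst hfc μ).comp (hY.prodMk hs))).pow_const 2).aestronglyMeasurable
    · rw [Real.norm_eq_abs, abs_of_nonneg (sq_nonneg _)]; exact hle ω
  refine ⟨hint, ?_⟩
  calc _ ≤ ∫ ω, D ^ 2 * H (Y ω, s ω) ∂P := integral_mono hint (hi.const_mul _) hle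
    _ = D ^ 2 * ∫ ω, ∫ x, H (Y ω, x) ∂unifL1Sphere d ∂P := by rw [integral_const_mul, h2]
    _ ≤ D ^ 2 * ∫ _, 384 * (B / μ) ^ 2 ∂P := by
        refine mul_le_mul_of_nonneg_left (integral_mono h1 (integrable_const _) fun ω => ?_)
          (sq_nonneg _)
        exact integral_gradEst_coeff_sq_le hd hfc hμ hB (hL2 _ (hYK ω))
    _ = _ := by simp; ring

end Round

/-! ### The regret bound -/

lemma xi_pos (hd : 0 < d) (p q : ℝ≥0∞) : 0 < xi d p q :=
  Real.rpow_pos_of_pos (by exact_mod_cast hd) _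

/-- The two sources of the dimension factor `ξ`: the dual norm of a sign vector and the comparison
of the `ℓ_q`-norm with the Euclidean norm. -/
lemma xi_eq (hd : 0 < d) {p q : ℝ≥0∞} (hq : 1 ≤ q) :
    xi d p q = ((d : ℝ) ^ max 0 ((q⁻¹).toReal - ((2 : ℝ≥0∞)⁻¹).toReal)) ^ 2 *
      ((d : ℝ) ^ (1 - (p⁻¹).toReal)) ^ 2 := by
  have hd0 : (0 : ℝ) < d := by exact_mod_cast hd
  rw [xi, ← Real.rpow_natCast, ← Real.rpow_natCast, ← Real.rpow_mul hd0.le, ← Real.rpow_mul hd0.le,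
    ← Real.rpow_add hd0]
  congr 1
  rcases le_total q 2 with h | h
  · have : ((2 : ℝ≥0∞)⁻¹).toReal ≤ (q⁻¹).toReal :=
      ENNReal.toReal_mono (ENNReal.inv_ne_top.2 (by positivity)) (ENNReal.inv_le_inv.2 h)
    rw [min_eq_left h, max_eq_right (by linarith), ENNReal.toReal_inv q]
    simp only [ENNReal.toReal_inv, ENNReal.toReal_ofNat]
    push_cast
    ring
  · have : (q⁻¹).toReal ≤ ((2 : ℝ≥0∞)⁻¹).toReal :=
      ENNReal.toReal_mono (by simp) (ENNReal.inv_le_inv.2 h)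
    rw [min_eq_right h, max_eq_left (by linarith)]
    simp only [ENNReal.toReal_ofNat]
    push_cast
    ring

lemma upsilon_eq (hd : 0 < d) {p q : ℝ≥0∞} (hp : 1 ≤ p) (hq : 1 ≤ q) :
    upsilon d p q = (d : ℝ) ^ (1 - (p⁻¹).toReal) *
      (d : ℝ) ^ max 0 ((q⁻¹).toReal - (p⁻¹).toReal) := by
  have hd0 : (0 : ℝ) < d := by exact_mod_cast hd
  rw [upsilon, ← Real.rpow_add hd0]
  congr 1
  rcases le_total q p with h | h
  · have : (p⁻¹).toReal ≤ (q⁻¹).toReal :=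
      ENNReal.toReal_mono (ENNReal.inv_ne_top.2 (by positivity)) (ENNReal.inv_le_inv.2 h)
    rw [max_eq_right h, max_eq_right (by linarith)]
    ring
  · have : (q⁻¹).toReal ≤ (p⁻¹).toReal :=
      ENNReal.toReal_mono (ENNReal.inv_ne_top.2 (by positivity)) (ENNReal.inv_le_inv.2 h)
    rw [max_eq_left h, max_eq_left (by linarith)]
    ring

lemma upsilon_nonneg (d : ℕ) (p q : ℝ≥0∞) : 0 ≤ upsilon d p q := by unfold upsilon; positivity

lemma zeta_nonneg (d : ℕ) (q : ℝ≥0∞) : 0 ≤ zeta d q := by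
  unfold zeta
  split_ifs
  · positivity
  · have := Real.log_natCast_nonneg d
    positivity

/-- The oscillation of a strongly convex function that is bounded above is finite: tangent
hyperplanes bound it from below on bounded sets. -/
lemma sub_le_oscillation {p : ℝ≥0∞} {lam : ℝ} {X : Set (Vec d)} {ψ : Vec d → ℝ} (hlam : 0 < lam)
    (hX : IsCompact X) (hψ : StrongConvexOnEll p lam (interior X) ψ)
    (hdiff : ∀ x ∈ interior X, DifferentiableAt ℝ ψ x) (hbdd : BddAbove (ψ '' interior X))
    {x z : Vec d} (hx : x ∈ interior X) (hz : z ∈ interior X) : ψ x - ψ z ≤ oscillation X ψ := by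
  have hbelow : BddBelow (ψ '' interior X) := by
    obtain ⟨C, hC⟩ := hX.exists_bound_of_continuousOn
      (f := fun w : Vec d => inner ℝ (gradient ψ z) (w - z)) (by fun_prop)
    refine ⟨ψ z - C, ?_⟩
    rintro _ ⟨w, hw, rfl⟩
    have h1 := bregman_nonneg hlam hψ hw hz (hdiff z hz)
    have h2 := (abs_le.1 (hC w (interior_subset hw))).1
    unfold bregman at h1
    linarith
  have h1 := le_csSup hbdd ⟨x, hx, rfl⟩
  have h2 := csInf_le hbelow ⟨z, hz, rfl⟩
  unfold oscillation
  linarith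

/-- The tuning of the parameters balances the three parts of the regret bound. -/
lemma tuning {c₁ c₂ c₃ D G ξ T lam η μ ρ : ℝ} (hc₁ : 0 < c₁) (hD : 0 < D)
    (hG : 0 < G) (hξ : 0 < ξ) (hT : 0 < T) (hlam : 0 < lam) (hρ : 0 < ρ)
    (h1 : c₁ * √(D / (G ^ 2 * ξ * T / lam)) ≤ η) (h2 : η ≤ c₂ * √(D / (G ^ 2 * ξ * T / lam)))
    (h3 : μ ≤ c₃ * (√(D * ξ) / (√(lam * T) * ρ))) :
    1 / η * D + T * (η / (2 * lam) * (384 * (G ^ 2 * ξ))) + T * (3 * (G * μ * ρ)) ≤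
      (1 / c₁ + 192 * c₂ + 3 * c₃) * (G * √(D * ξ * T / lam)) := by
  set st := √(D / (G ^ 2 * ξ * T / lam)) with hst
  set Z := √(D * ξ * T / lam) with hZ
  have hst0 : 0 < st := Real.sqrt_pos.2 (by positivity)
  have hZ0 : 0 < Z := Real.sqrt_pos.2 (by positivity)
  have hη : 0 < η := (mul_pos hc₁ hst0).trans_le h1
  have e1 : st * (G * Z) = D := by
    have : √(G ^ 2) = G := Real.sqrt_sq hG.le
    rw [hst, hZ, ← this, ← Real.sqrt_mul (by positivity), ← Real.sqrt_mul (by positivity), this]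
    have : D / (G ^ 2 * ξ * T / lam) * (G ^ 2 * (D * ξ * T / lam)) = D ^ 2 := by field_simp
    rw [this, Real.sqrt_sq hD.le]
  have e2 : st * (G ^ 2 * ξ * T / lam) = G * Z := by
    have hZZ : (G * Z) ^ 2 = D * (G ^ 2 * ξ * T / lam) := by
      rw [mul_pow, hZ, Real.sq_sqrt (by positivity)]; field_simp
    have hGZ : 0 < G * Z := by positivity
    refine mul_right_cancel₀ hGZ.ne' ?_
    rw [← sq, hZZ]
    linear_combination (G ^ 2 * ξ * T / lam) * e1
  have p1 : 1 / η * D ≤ 1 / c₁ * (G * Z) := by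
    rw [one_div_mul_eq_div, div_le_iff₀ hη, ← e1]
    calc st * (G * Z) = 1 / c₁ * (G * Z) * (c₁ * st) := by field_simp
      _ ≤ _ := by gcongr
  have p2 : T * (η / (2 * lam) * (384 * (G ^ 2 * ξ))) ≤ 192 * c₂ * (G * Z) := by
    calc _ = η * (192 * (G ^ 2 * ξ * T / lam)) := by field_simp; ring
      _ ≤ (c₂ * st) * (192 * (G ^ 2 * ξ * T / lam)) := by gcongr
      _ = 192 * c₂ * (st * (G ^ 2 * ξ * T / lam)) := by ring
      _ = _ := by rw [e2]
  have p3 : T * (3 * (G * μ * ρ)) ≤ 3 * c₃ * (G * Z) := by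
    have hLT : 0 < √(lam * T) := Real.sqrt_pos.2 (by positivity)
    have e3 : T * (√(D * ξ) / √(lam * T)) = Z := by
      rw [hZ, ← Real.sqrt_div' _ (by positivity)]
      nth_rewrite 1 [← Real.sqrt_sq hT.le]
      rw [← Real.sqrt_mul (by positivity)]
      congr 1
      field_simp
    calc _ ≤ T * (3 * (G * (c₃ * (√(D * ξ) / (√(lam * T) * ρ))) * ρ)) := by gcongr
      _ = 3 * c₃ * (G * (T * (√(D * ξ) / √(lam * T)))) := by field_simp
      _ = _ := by rw [e3]
  linarith

section Comparison

variable {p q : ℝ≥0∞} {X : Set (Vec d)} {f : Vec d → ℝ} {G μ α r R : ℝ}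

lemma LipschitzOnEll.abs_sub_le (h : LipschitzOnEll q G X f) (hq : 1 ≤ q) (hμ : 0 < μ)
    {y x x' : Vec d} (hx : y + μ • x ∈ X) (hx' : y + μ • x' ∈ X) :
    |f (y + μ • x) - f (y + μ • x')| ≤ G * μ * ellNorm q (x - x') := by
  have := h _ hx _ hx'
  rwa [add_sub_add_left_eq_sub, ← smul_sub, ellNorm_smul hq, abs_of_pos hμ, ← mul_assoc] at this

/-- The price of shrinking the comparator so that it lies in `(1 - α) • X`. -/
lemma LipschitzOnEll.sub_smul_le (h : LipschitzOnEll q G X f) (hd : 0 < d) (hp : 1 ≤ p)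
    (hq : 1 ≤ q) (hG : 0 ≤ G) (hr : 0 < r) (hR : 0 < R) (hXR : X ⊆ R • ellBall d p)
    (hα : 0 ≤ α) (hμα : μ * (d : ℝ) ^ (1 - (p⁻¹).toReal) = α * r) {u : Vec d} (hu : u ∈ X)
    (hv : (1 - α) • u ∈ X) :
    f ((1 - α) • u) - f u ≤ G * μ * (upsilon d p q * (R / r)) := by
  have h1 := (le_abs_self _).trans (h _ hv _ hu)
  have e : (1 - α) • u - u = (-α) • u := by module
  rw [e, ellNorm_smul hq, abs_neg, abs_of_nonneg hα] at h1
  have h2 := ellNorm_le_mul hp hq u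
  have h3 : ellNorm p u ≤ R := ((mem_smul_ellBall hp hR).1 (hXR hu)).le
  refine h1.trans ?_
  set c := (d : ℝ) ^ max 0 ((q⁻¹).toReal - (p⁻¹).toReal) with hc
  have hc0 : 0 ≤ c := by positivity
  calc G * (α * ellNorm q u) ≤ G * (α * (c * R)) := by
        have := h2.trans (mul_le_mul_of_nonneg_left h3 hc0)
        gcongr
    _ = G * (α * r * c * (R / r)) := by field_simp
    _ = _ := by rw [← hμα, upsilon_eq hd hp hq]; ring

end Comparison

section Regret

variable {Ω : Type*} [MeasurableSpace Ω] {P : Measure Ω} [IsProbabilityMeasure P]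

/-- The probabilistic estimates for one round: on average over the perturbation the regret exceeds
the linearised regret against the shrunk comparator only by the smoothing errors, and the squared
dual norm of the gradient estimator is of order `G² ξ`. -/
lemma integral_round_regret_le {p q : ℝ≥0∞} {X : Set (Vec d)} {f : Vec d → ℝ} {G μ α r R : ℝ}
    {Y s : Ω → Vec d} (hd : 0 < d) (hp : 1 ≤ p) (hq : 1 ≤ q) (hX : IsCompact X)
    (hXc : Convex ℝ X) (hr : 0 < r) (hR : 0 < R) (hrX : r • ellBall d p ⊆ X)
    (hXR : X ⊆ R • ellBall d p) (hG : 0 ≤ G) (hf : ConvexOn ℝ Set.univ f)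
    (hL : LipschitzOnEll q G X f) (hμ : 0 < μ) (hα : 0 < α) (hα1 : α < 1)
    (hμα : μ * (d : ℝ) ^ (1 - (p⁻¹).toReal) = α * r) (hY : Measurable Y) (hs : Measurable s)
    (hlaw : P.map s = unifL1Sphere d) (hind : IndepFun Y s P)
    (hYK : ∀ ω, Y ω ∈ (1 - α) • X) {u : Vec d} (hu : u ∈ X) :
    Integrable (fun ω => inner ℝ (gradEst f μ (Y ω) (s ω)) (Y ω - (1 - α) • u)) P ∧
    Integrable (fun ω => ellNorm (ENNReal.conjExponent p) (gradEst f μ (Y ω) (s ω)) ^ 2) P ∧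
    Integrable (fun ω => (f (Y ω + μ • s ω) + f (Y ω - μ • s ω)) / 2 - f u) P ∧
    ∫ ω, ((f (Y ω + μ • s ω) + f (Y ω - μ • s ω)) / 2 - f u) ∂P ≤
      ∫ ω, inner ℝ (gradEst f μ (Y ω) (s ω)) (Y ω - (1 - α) • u) ∂P +
        G * μ * (3 + upsilon d p q * (R / r)) ∧
    ∫ ω, ellNorm (ENNReal.conjExponent p) (gradEst f μ (Y ω) (s ω)) ^ 2 ∂P ≤
      384 * (G ^ 2 * xi d p q) := by
  have hfc : Continuous f := by
    rw [← continuousOn_univ]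
    exact hf.continuousOn isOpen_univ
  have hKX : (1 - α) • X ⊆ X :=
    (smul_subset_interior hXc (zero_mem_interior hp hr hrX) hα hα1).trans interior_subset
  have hv : (1 - α) • u ∈ (1 - α) • X := Set.smul_mem_smul_set hu
  have hquery : ∀ y ∈ (1 - α) • X, ∀ x, ellNorm 1 x ≤ 1 → y + μ • x ∈ X := fun y hy x hx =>
    add_smul_mem hp hd hX.isClosed hXc hr hrX hμ hα hα1 hμα hy hx
  have hA : 0 ≤ G * μ := by positivity
  have hLq : ∀ y ∈ (1 - α) • X, ∀ x x', ellNorm 1 x ≤ 1 → ellNorm 1 x' ≤ 1 →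
      |f (y + μ • x) - f (y + μ • x')| ≤ G * μ * ellNorm q (x - x') := fun y hy x x' hx hx' =>
    hL.abs_sub_le hq hμ (hquery y hy x hx) (hquery y hy x' hx')
  have hL1 : ∀ y ∈ (1 - α) • X, ∀ x x', ellNorm 1 x ≤ 1 → ellNorm 1 x' ≤ 1 →
      |f (y + μ • x) - f (y + μ • x')| ≤ G * μ * ellNorm 1 (x - x') := fun y hy x x' hx hx' =>
    (hLq y hy x x' hx hx').trans (mul_le_mul_of_nonneg_left (ellNorm_anti le_rfl hq _) hA)
  set c := (d : ℝ) ^ max 0 ((q⁻¹).toReal - ((2 : ℝ≥0∞)⁻¹).toReal) with hc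
  have hc0 : 0 ≤ c := by positivity
  have hL2 : ∀ y ∈ (1 - α) • X, ∀ x x', ellNorm 1 x ≤ 1 → ellNorm 1 x' ≤ 1 →
      |f (y + μ • x) - f (y + μ • x')| ≤ G * μ * c * ‖x - x'‖ := fun y hy x x' hx hx' => by
    refine (hLq y hy x x' hx hx').trans ?_
    rw [mul_assoc (G * μ)]
    refine mul_le_mul_of_nonneg_left ?_ hA
    rw [← ellNorm_two]
    exact ellNorm_le_mul (by norm_num) hq _
  obtain ⟨hi, hif, hge⟩ := integral_inner_gradEst_ge hd hY hs hlaw hind (hX.smul (1 - α)) hYK hf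
    hfc hμ hA hL1 hv
  obtain ⟨hi2, hle2⟩ := integral_dual_sq_gradEst_le hd hp hY hs hlaw hind hYK hfc hμ hL1
    (by positivity : 0 ≤ G * μ * c) hL2
  have hae := ae_ellNorm_one_eq_one_of_law hd hs hlaw
  have hneg : ∀ ω, Y ω - μ • s ω = Y ω + μ • (-s ω) := fun ω => by rw [smul_neg, sub_eq_add_neg]
  obtain ⟨M, hM⟩ := hX.exists_bound_of_continuousOn hfc.continuousOn
  have hir : Integrable (fun ω => (f (Y ω + μ • s ω) + f (Y ω - μ • s ω)) / 2 - f u) P := by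
    refine Integrable.sub ?_ (integrable_const _)
    refine Integrable.mono' (integrable_const M) (by fun_prop) ?_
    filter_upwards [hae] with ω hω
    have h1 := abs_le.1 (hM _ (hquery _ (hYK ω) (s ω) hω.le))
    have h2 := abs_le.1 (hM _ (hquery _ (hYK ω) (-s ω) (by rw [ellNorm_neg le_rfl, hω])))
    rw [hneg, Real.norm_eq_abs, abs_le]
    constructor <;> linarith [h1.1, h1.2, h2.1, h2.2]
  refine ⟨hi, hi2, hir, ?_, ?_⟩
  · have hshrink := hL.sub_smul_le hd hp hq hG hr hR hXR hα.le hμα hu (hKX hv)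
    have hround : ∫ ω, ((f (Y ω + μ • s ω) + f (Y ω - μ • s ω)) / 2 - f u) ∂P ≤
        ∫ ω, (f (Y ω) + (G * μ - f u)) ∂P := by
      refine integral_mono_ae hir (hif.add (integrable_const _)) ?_
      filter_upwards [hae] with ω hω
      have hz : ellNorm 1 (0 : Vec d) ≤ 1 := by rw [ellNorm_zero le_rfl]; exact zero_le_one
      have h1 := (abs_le.1 (hL1 _ (hYK ω) (s ω) 0 hω.le hz)).2
      have h2 := (abs_le.1 (hL1 _ (hYK ω) (-s ω) 0 (by rw [ellNorm_neg le_rfl, hω]) hz)).2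
      rw [smul_zero, add_zero, sub_zero, hω] at h1
      rw [smul_zero, add_zero, sub_zero, ellNorm_neg le_rfl, hω] at h2
      simp only [hneg]
      linarith
    rw [integral_add hif (integrable_const _)] at hround
    simp only [integral_const, probReal_univ, smul_eq_mul, one_mul] at hround
    linarith
  · refine hle2.trans_eq ?_
    rw [xi_eq hd hq, ← hc]
    field_simp

/-- The regret of bandit mirror descent before tuning: a term for the divergence and the movement of
the comparators, a term for the size of the gradient estimator, a term for the smoothing error. -/
theorem integral_dynRegret_le {p q : ℝ≥0∞} {X : Set (Vec d)} {f : ℕ → Vec d → ℝ}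
    {ψ : Vec d → ℝ} {G μ α η r R lam Gψ : ℝ} {T : ℕ} {u : ℕ → Vec d} {s y : ℕ → Ω → Vec d}
    {y₁ : Vec d} (hd : 0 < d) (hp : 1 ≤ p) (hq : 1 ≤ q) (hX : IsCompact X) (hXc : Convex ℝ X)
    (hr : 0 < r) (hR : 0 < R) (hrX : r • ellBall d p ⊆ X) (hXR : X ⊆ R • ellBall d p)
    (hT : 1 ≤ T) (hG : 0 ≤ G) (hf : ∀ t < T, ConvexOn ℝ Set.univ (f t))
    (hL : ∀ t < T, LipschitzOnEll q G X (f t)) (hlam : 0 < lam)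
    (hψd : DifferentiableOn ℝ ψ (interior X)) (hψ : StrongConvexOnEll p lam (interior X) ψ)
    (hψb : BddAbove (ψ '' interior X)) (hu : ∀ t ≤ T, u t ∈ X)
    (hs : ∀ t < T, Measurable (s t)) (hlaw : ∀ t < T, P.map (s t) = unifL1Sphere d)
    (hind : iIndepFun (fun t : Fin T => s t) P) (hμ : 0 < μ) (hη : 0 < η)
    (hμα : μ * (d : ℝ) ^ (1 - (p⁻¹).toReal) = α * r) (hα1 : α < 1)
    (hrun : IsBMDRun X f ψ μ α η T y₁ s y)
    (hGψ : ∀ᵐ ω ∂P, ∀ t < T, ellNorm (ENNReal.conjExponent p) (gradient ψ (y t ω)) ≤ Gψ) :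
    Integrable (fun ω => dynRegret f μ T u (fun t => y t ω) (fun t => s t ω)) P ∧
    ∫ ω, dynRegret f μ T u (fun t => y t ω) (fun t => s t ω) ∂P ≤
      1 / η * (oscillation X ψ + bregman ψ ((1 - α) • u 0) y₁ + Gψ * pathVariation p T u) +
      T * (η / (2 * lam) * (384 * (G ^ 2 * xi d p q))) +
      T * (G * μ * (3 + upsilon d p q * (R / r))) := by
  have hd0 : (0 : ℝ) < d := by exact_mod_cast hd
  have hα : 0 < α := pos_of_mul_pos_left (hμα ▸ by positivity) hr.le
  have hKS : (1 - α) • X ⊆ interior X :=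
    smul_subset_interior hXc (zero_mem_interior hp hr hrX) hα hα1
  have hdiff : ∀ x ∈ interior X, DifferentiableAt ℝ ψ x := fun x hx =>
    hψd.differentiableAt (isOpen_interior.mem_nhds hx)
  have hfc : ∀ t < T, Continuous (f t) := fun t ht => by
    rw [← continuousOn_univ]
    exact (hf t ht).continuousOn isOpen_univ
  have hv : ∀ t ≤ T, (1 - α) • u t ∈ (1 - α) • X := fun t ht => Set.smul_mem_smul_set (hu t ht)
  have hround : ∀ t ∈ Finset.range T, _ := fun t ht' => by
    have ht : t < T := Finset.mem_range.1 ht'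
    have hm := hrun.measurable_pastInfo hp hlam hψ hXc hKS hdiff hη hfc ht.le
    exact integral_round_regret_le hd hp hq hX hXc hr hR hrX hXR hG (hf t ht) (hL t ht) hμ hα hα1
      hμα (hm.mono (pastInfo_le hs t) le_rfl) (hs t ht) (hlaw t ht)
      (indepFun_of_measurable_pastInfo hs hind ht hm) (fun ω => hrun.mem ht.le ω) (hu t ht.le)
  have hpath : ∀ᵐ ω ∂P,
      ∑ t ∈ Finset.range T, inner ℝ (gradEst (f t) μ (y t ω) (s t ω)) (y t ω - (1 - α) • u t) ≤
      1 / η * (oscillation X ψ + bregman ψ ((1 - α) • u 0) y₁ + Gψ * pathVariation p T u) +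
        ∑ t ∈ Finset.range T, η / (2 * lam) *
          ellNorm (ENNReal.conjExponent p) (gradEst (f t) μ (y t ω) (s t ω)) ^ 2 := by
    filter_upwards [hGψ] with ω hω
    have hGψ0 : 0 ≤ Gψ := (ellNorm_nonneg (one_le_conjExponent p) _).trans (hω 0 hT)
    have h1 := Finset.sum_le_sum fun t (ht' : t ∈ Finset.range T) =>
      have ht : t < T := Finset.mem_range.1 ht'
      mirror_step hp hlam hψ (hXc.smul _) hKS hdiff hη (hrun.mem ht.le ω) (hrun.mem ht ω)
        (hv t ht.le) (hrun.step_min t ht ω)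
    rw [Finset.sum_add_distrib, ← Finset.mul_sum] at h1
    have h2 := sum_bregman_sub_le hp hlam hψ hdiff hT (y := fun t => y t ω)
      (v := fun t => (1 - α) • u t) (fun t ht => hKS (hrun.mem ht ω))
      (fun t ht => hKS (hv t ht.le)) hω
      (fun x hx z hz => sub_le_oscillation hlam hX hψ hdiff hψb hx hz)
    have h3 : ∑ t ∈ Finset.range T, ellNorm p ((1 - α) • u (t + 1) - (1 - α) • u t) ≤
        pathVariation p T u := by
      refine Finset.sum_le_sum fun t _ => ?_
      rw [← smul_sub, ellNorm_smul hp, abs_of_pos (by linarith)]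
      exact mul_le_of_le_one_left (ellNorm_nonneg hp _) (by linarith)
    refine h1.trans ?_
    gcongr
    refine h2.trans ?_
    rw [hrun.init]
    gcongr
  have hint : Integrable (fun ω => ∑ t ∈ Finset.range T, η / (2 * lam) *
      ellNorm (ENNReal.conjExponent p) (gradEst (f t) μ (y t ω) (s t ω)) ^ 2) P :=
    integrable_finsetSum _ fun t ht => (hround t ht).2.1.const_mul _
  refine ⟨integrable_finsetSum _ fun t ht => (hround t ht).2.2.1, ?_⟩
  calc ∫ ω, dynRegret f μ T u (fun t => y t ω) (fun t => s t ω) ∂P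
      = ∑ t ∈ Finset.range T, ∫ ω,
          ((f t (y t ω + μ • s t ω) + f t (y t ω - μ • s t ω)) / 2 - f t (u t)) ∂P :=
        integral_finsetSum _ fun t ht => (hround t ht).2.2.1
    _ ≤ ∑ t ∈ Finset.range T,
          (∫ ω, inner ℝ (gradEst (f t) μ (y t ω) (s t ω)) (y t ω - (1 - α) • u t) ∂P +
            G * μ * (3 + upsilon d p q * (R / r))) :=
        Finset.sum_le_sum fun t ht => (hround t ht).2.2.2.1
    _ = ∫ ω, ∑ t ∈ Finset.range T,
          inner ℝ (gradEst (f t) μ (y t ω) (s t ω)) (y t ω - (1 - α) • u t) ∂P +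
            T * (G * μ * (3 + upsilon d p q * (R / r))) := by
        rw [Finset.sum_add_distrib, integral_finsetSum _ fun t ht => (hround t ht).1]
        simp
    _ ≤ 1 / η * (oscillation X ψ + bregman ψ ((1 - α) • u 0) y₁ + Gψ * pathVariation p T u) +
          ∑ t ∈ Finset.range T, η / (2 * lam) * (384 * (G ^ 2 * xi d p q)) +
            T * (G * μ * (3 + upsilon d p q * (R / r))) := by
        have h := integral_mono_ae (integrable_finsetSum _ fun t ht => (hround t ht).1)
          ((integrable_const _).add hint) hpath
        rw [integral_add' (integrable_const _) hint, integral_const, probReal_univ, one_smul,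
          integral_finsetSum _ fun t ht => (hround t ht).2.1.const_mul _] at h
        gcongr
        refine h.trans ?_
        gcongr with t ht
        rw [integral_const_mul]
        gcongr
        exact (hround t ht).2.2.2.2
    _ = _ := by simp

end Regret

end BMD

end

theorem mainTheorem6 (c₁ c₂ c₃ : ℝ) (hc₁ : 0 < c₁) (hc₂ : 0 < c₂) (hc₃ : 0 < c₃) :
    ∃ C : ℝ, 0 < C ∧
      ∀ (d : ℕ) (_ : 3 ≤ d) (p q : ℝ≥0∞) (_ : 1 ≤ p) (_ : 1 ≤ q)
        -- bounded feasible region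
        (X : Set (BMD.Vec d)) (_ : IsCompact X) (_ : Convex ℝ X)
        (r R : ℝ) (_ : 0 < r) (_ : 0 < R)
        (_ : r • BMD.ellBall d p ⊆ X) (_ : X ⊆ R • BMD.ellBall d p)
        -- convex losses, Lipschitz on the feasible region
        (T : ℕ) (_ : 1 ≤ T) (G : ℝ) (_ : 0 < G) (f : ℕ → BMD.Vec d → ℝ)
        (_ : ∀ t < T, ConvexOn ℝ Set.univ (f t))
        (_ : ∀ t < T, BMD.LipschitzOnEll q G X (f t))
        -- divergence-generating function, with finite oscillation
        (ψ : BMD.Vec d → ℝ) (lam : ℝ) (_ : 0 < lam)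
        (_ : DifferentiableOn ℝ ψ (interior X))
        (_ : BMD.StrongConvexOnEll p lam (interior X) ψ)
        (_ : BddAbove (ψ '' interior X))
        -- comparators
        (u : ℕ → BMD.Vec d) (_ : ∀ t ≤ T, u t ∈ X)
        -- independent perturbations, uniform on the unit sphere
        (Ω : Type*) (_ : MeasurableSpace Ω) (P : Measure Ω) (_ : IsProbabilityMeasure P)
        (s : ℕ → Ω → BMD.Vec d) (_ : ∀ t < T, Measurable (s t))
        (_ : ∀ t < T, P.map (s t) = BMD.unifL1Sphere d)
        (_ : iIndepFun (fun t : Fin T => s t) P)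
        -- a run of the algorithm
        (μ α η : ℝ) (_ : 0 < μ) (_ : 0 < η)
        (_ : μ * (d : ℝ) ^ (1 - (p⁻¹).toReal) = α * r) (_ : α < 1)
        (y₁ : BMD.Vec d) (y : ℕ → Ω → BMD.Vec d)
        (_ : BMD.IsBMDRun X f ψ μ α η T y₁ s y)
        -- the gradient constant of the iterates
        (Gψ : ℝ)
        (_ : ∀ᵐ ω ∂P, ∀ t < T,
          BMD.ellNorm (ENNReal.conjExponent p) (gradient ψ (y t ω)) ≤ Gψ)
        (D : ℝ)
        (_ : D = BMD.oscillation X ψ + BMD.bregman ψ ((1 - α) • u 0) y₁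
          + Gψ * BMD.pathVariation p T u)
        -- tuning of the step size and of the smoothing parameter
        (_ : c₁ * BMD.stepScale d p q T G lam D ≤ η)
        (_ : η ≤ c₂ * BMD.stepScale d p q T G lam D)
        (_ : μ ≤ c₃ * BMD.smoothScale d p q T r R lam D),
        Integrable (fun ω => BMD.dynRegret f μ T u (fun t => y t ω) (fun t => s t ω)) P ∧
        ∫ ω, BMD.dynRegret f μ T u (fun t => y t ω) (fun t => s t ω) ∂P
          ≤ C * (G * Real.sqrt (D * BMD.xi d p q * T / lam)) := by
  refine ⟨1 / c₁ + 192 * c₂ + 3 * c₃, by positivity, ?_⟩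
  intro d hd3 p q hp hq X hX hXc r R hr hR hrX hXR T hT G hG f hf hL ψ lam hlam hψd hψ hψb u hu
    Ω _ P _ s hs hlaw hind μ α η hμ hη hμα hα1 y₁ y hrun Gψ hGψ D hD h1 h2 h3
  have hd : 0 < d := by omega
  have hT0 : (0 : ℝ) < T := by exact_mod_cast hT
  have hξ := BMD.xi_pos hd p q
  -- a positive step size below `c₂ * stepScale` forces `0 < D`
  have hD0 : 0 < D := by
    have h : 0 < BMD.stepScale d p q T G lam D := pos_of_mul_pos_right (hη.trans_le h2) hc₂.le
    exact (div_pos_iff_of_pos_right (by positivity)).1 (Real.sqrt_pos.1 h)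
  have hrR : 1 ≤ R / r :=
    (one_le_div hr).2 (BMD.le_of_smul_ellBall_subset hp hd hr hR (hrX.trans hXR))
  have hυ := BMD.upsilon_nonneg d p q
  have hζ := BMD.zeta_nonneg d q
  have hρ : 0 < (1 + BMD.upsilon d p q + BMD.zeta d q) * (R / r) := by positivity
  obtain ⟨hi, hle⟩ := BMD.integral_dynRegret_le hd hp hq hX hXc hr hR hrX hXR hT hG.le hf hL hlam
    hψd hψ hψb hu hs hlaw hind hμ hη hμα hα1 hrun hGψ
  refine ⟨hi, hle.trans ?_⟩
  rw [BMD.smoothScale, mul_assoc (√(lam * T))] at h3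
  refine le_trans ?_ (BMD.tuning hc₁ hD0 hG hξ hT0 hlam hρ h1 h2 h3)
  rw [← hD]
  have h4 : 3 + BMD.upsilon d p q * (R / r) ≤
      3 * ((1 + BMD.upsilon d p q + BMD.zeta d q) * (R / r)) := by nlinarith
  have h5 := mul_le_mul_of_nonneg_left h4 (by positivity : 0 ≤ T * (G * μ))
  linarith
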